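/- **Setting.** A weighted graph $G=(V,w,m)$ consists of a countable set $V$, a symmetric function $w:V\times V\to[0,\infty)$ vanishing on the diagonal, and $m:V\to(0,\infty)$; write $x\sim y$ if $w(x,y)>0$. All graphs are locally finite, that is, $\deg(x):=\#\{y:y\sim x\}<\infty$ for all $x$. Put $\operatorname{Deg}(x)=\frac1{m(x)}\sum_y w(x,y)$, $\operatorname{Deg}_{\max}=\sup_x\operatorname{Deg}(x)$, $\deg_{\max}=\max_x\deg(x)$ and $\Delta f(x)=\frac1{m(x)}\sum_y w(x,y)(f(y)-f(x))$. Let $d$ be the combinatorial distance (least number of edges of a path), $\operatorname{diam}_d(G)=\sup_{x,y}d(x,y)$, and $S_k(x)=\{y:d(x,y)=k\}$. * $G$ has constant edge degree $\kappa_0$ if $w(x,y)/m(x)\in\{0,\kappa_0\}$ for all $x,y\in V$; the edge degree is constant if this holds for some $\kappa_0$. * The unweighted representation $\widetilde G$ of $G$ has the same vertices and edges, all edge weights of edges equal to $1$, and $m\equiv1$. * $G$ is an $n$-dimensional hypercube, $n\in\mathbb N_0$, if $\widetilde G$ is isomorphic to the graph on the subsets of $\{1,\dots,n\}$ in which $A\sim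 B$ iff the symmetric difference of $A$ and $B$ has exactly one element. For a real number $r$, "$G$ is an $r$-dimensional hypercube" includes that $r$ is a non-negative integer. * With $2\Gamma(f,g)=\Delta(fg)-f\Delta g-g\Delta f$ and $2\Gamma_2(f,g)=\Delta\Gamma(f,g)-\Gamma(f,\Delta g)-\Gamma(g,\Delta f)$, $G$ satisfies $CD(K,\infty)$ if $\Gamma_2(f,f)(x)\ge K\,\Gamma(f,f)(x)$ for all $f:V\to\mathbb R$ and all $x\in V$. * $\lambda_0\le\lambda_1\le\dots$ are the eigenvalues of $-\Delta$ on $\ell^2(V,m)$, counted with multiplicity: $\lambda_k=\mu$ means that at most $k$ of them are smaller than $\mu$ and at least $k+1$ of them are at most $\mu$. * $d_-^{x_0}(z)=\sum_{y\sim z,\ d(y,x_0)<d(z,x_0)}w(y,z)/m(z)$. * For $N,W\in(0,\infty)$, $G$ has the hypercube shell structure $HSS(N,W)$ if there is $x_0\in V$ such that $\operatorname{Deg}(x)=NW$ for all $x\in V$, $G$ is bipartite, and $d_-^{x_0}(x)=W\,d(x,x_0)$ for all $x\in V$. * An unweighted regular graph of degree $D'$ satisfies (SSP) if $\#S_2(x)\le\binom{D'}2$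 for every vertex $x$. It satisfies (NCP) if for every vertex $x$ such that $d_-^x(z)=2$ for all $z\in S_2(x)$, any two distinct $y_1,y_2\in S_1(x)$ have at most one common neighbour in $S_2(x)$. **Theorem.** Let $G=(V,w,m)$ be a connected, locally finite weighted graph with at least two vertices, let $K>0$, and let $x_0\in V$ be such that $D:=\operatorname{Deg}(x_0)=\operatorname{Deg}_{\max}$. The following are equivalent: 1. $G$ is a $\frac{2D}K$-dimensional hypercube with constant edge degree $\frac K2$. 2. $G$ satisfies $CD(K,\infty)$, and $\deg_{\max}$ exists (is finite) with $\lambda_{\deg_{\max}}=K$. 3. The edge degree of $G$ is constant, $G$ satisfies $CD(K,\infty)$, and $\operatorname{diam}_d(G)=\frac{2D}K$. 4. The edge degree of $G$ is constant, $G$ has the hypercube shell structure $HSS\left(\frac{2D}K,\frac K2\right)$, and $G$ satisfies $CD(K,\infty)$. 5. $G$ has constant edge degree $\frac K2$, and $\widetilde G$ has the hypercube shell structure $HSS\left(\frac{2D}K,1\right)$ and satisfies (SSP) and (NCP). -/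

import Mathlib

/-- A locally finite weighted graph `(V, w, m)`: a symmetric edge weight `w ≥ 0` vanishing on the
diagonal, and a positive vertex measure `m`. -/
structure WeightedGraph (V : Type*) where
  w : V → V → ℝ
  w_nonneg : ∀ x y, 0 ≤ w x y
  w_symm : ∀ x y, w x y = w y x
  w_self : ∀ x, w x x = 0
  m : V → ℝ
  m_pos : ∀ x, 0 < m x
  locallyFinite : ∀ x, {y | 0 < w x y}.Finite

namespace WeightedGraph

variable {V : Type*} (G : WeightedGraph V)

/-- The underlying combinatorial graph: `x ∼ y` if and only if `w x y > 0`. -/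
def graph : SimpleGraph V where
  Adj x y := 0 < G.w x y
  symm := ⟨fun x y h => by rw [G.w_symm y x]; exact h⟩
  loopless := ⟨fun x h => by rw [G.w_self x] at h; exact lt_irrefl _ h⟩

/-- The finite set of neighbours of `x`. -/
noncomputable def nbrs (x : V) : Finset V := (G.locallyFinite x).toFinset

/-- The graph Laplacian `Δ f (x) = (1 / m x) ∑ y, w x y * (f y - f x)`. -/
noncomputable def lap (f : V → ℝ) (x : V) : ℝ :=
  (∑ y ∈ G.nbrs x, G.w x y * (f y - f x)) / G.m x

/-- The weighted vertex degree `Deg x = (∑ y, w x y) / m x`. -/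
noncomputable def Deg (x : V) : ℝ := (∑ y ∈ G.nbrs x, G.w x y) / G.m x

/-- The combinatorial vertex degree, i.e. the number of neighbours. -/
noncomputable def deg (x : V) : ℕ := (G.nbrs x).card

/-- `G` has constant edge degree `κ₀`: the edge degree `κ(x, y) = w x y / m x` is `κ₀` on every
oriented edge. -/
def HasConstEdgeDegree (κ₀ : ℝ) : Prop :=
  ∀ x y, G.w x y / G.m x = 0 ∨ G.w x y / G.m x = κ₀

/-- The operator `2 Γ(f, g) = Δ (f g) - f Δ g - g Δ f`. -/
noncomputable def Gam (f g : V → ℝ) : V → ℝ := fun x =>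
  (G.lap (fun y => f y * g y) x - f x * G.lap g x - g x * G.lap f x) / 2

/-- The operator `2 Γ₂(f, g) = Δ Γ(f, g) - Γ(f, Δ g) - Γ(g, Δ f)`. -/
noncomputable def Gam₂ (f g : V → ℝ) : V → ℝ := fun x =>
  (G.lap (G.Gam f g) x - G.Gam f (G.lap g) x - G.Gam g (G.lap f) x) / 2

/-- The Bakry–Émery curvature-dimension inequality `CD(K, ∞)`: at every vertex and for every
function, `Γ₂(f) ≥ K Γ(f)`. -/
def CDInfty (K : ℝ) : Prop :=
  ∀ (f : V → ℝ) (x : V), K * G.Gam f f x ≤ G.Gam₂ f f x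

/-- The space of `f ∈ ℓ²(V, m)` with `-Δ f = μ f`. On a finite graph the condition
`f ∈ ℓ²(V, m)` is void. -/
noncomputable def eigenspace (μ : ℝ) : Submodule ℝ (V → ℝ) where
  carrier := {f | Summable (fun x => G.m x * f x ^ 2) ∧ ∀ x, -G.lap f x = μ * f x}
  zero_mem' := by
    refine ⟨by simp, fun x => by simp [lap]⟩
  add_mem' := by
    rintro f g ⟨hf, hf'⟩ ⟨hg, hg'⟩
    refine ⟨?_, fun x => ?_⟩
    · refine Summable.of_nonneg_of_le (fun x => ?_) (fun x => ?_)
        ((hf.mul_left 2).add (hg.mul_left 2))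
      · exact mul_nonneg (G.m_pos x).le (sq_nonneg _)
      · have h := mul_nonneg (G.m_pos x).le (sq_nonneg (f x - g x))
        simp only [Pi.add_apply]
        nlinarith
    · have h : G.lap (f + g) x = G.lap f x + G.lap g x := by
        simp only [lap, Pi.add_apply, ← add_div, ← Finset.sum_add_distrib]
        congr 1
        exact Finset.sum_congr rfl fun y _ => by ring
      rw [h, neg_add, hf' x, hg' x, Pi.add_apply, mul_add]
  smul_mem' := by
    rintro c f ⟨hf, hf'⟩
    refine ⟨?_, fun x => ?_⟩
    · refine (hf.mul_left (c ^ 2)).congr fun x => ?_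
      simp only [Pi.smul_apply, smul_eq_mul]
      ring
    · have h : G.lap (c • f) x = c * G.lap f x := by
        simp only [lap, Pi.smul_apply, smul_eq_mul, ← mul_div_assoc, Finset.mul_sum]
        congr 1
        exact Finset.sum_congr rfl fun y _ => by ring
      rw [h, Pi.smul_apply, smul_eq_mul, mul_left_comm, ← hf' x]
      ring

/-- `μ = λ_k`, where `λ₀ ≤ λ₁ ≤ λ₂ ≤ …` is the list of the eigenvalues of `-Δ` counted with
multiplicity: at most `k` of them are smaller than `μ`, and at least `k + 1` of them are at
most `μ`. -/
def IsKthEigenvalue (k : ℕ) (μ : ℝ) : Prop :=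
  Module.rank ℝ ↥(⨆ ν ∈ Set.Iio μ, G.eigenspace ν) ≤ (k : Cardinal) ∧
    ((k + 1 : ℕ) : Cardinal) ≤ Module.rank ℝ ↥(⨆ ν ∈ Set.Iic μ, G.eigenspace ν)

open Classical in
/-- The backwards-degree `d₋` of `z` with respect to `x₀`. -/
noncomputable def backDeg (x₀ z : V) : ℝ :=
  ∑ y ∈ (G.nbrs z).filter (fun y => G.graph.dist y x₀ < G.graph.dist z x₀), G.w y z / G.m z

/-- The hypercube shell structure `HSS(N, W, x₀)` with respect to a root `x₀`. -/
structure HSSAt (N W : ℝ) (x₀ : V) : Prop where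
  dim_pos : 0 < N
  weight_pos : 0 < W
  deg_eq : ∀ x, G.Deg x = N * W
  bipartite : G.graph.IsBipartite
  backDeg_eq : ∀ x, G.backDeg x₀ x = W * G.graph.dist x x₀

/-- The hypercube shell structure `HSS(N, W)`, i.e. `HSS(N, W, x₀)` for some `x₀`. -/
def HSS (N W : ℝ) : Prop := ∃ x₀, G.HSSAt N W x₀

open Classical in
/-- The unweighted representation of `G`: the same edges, with unit edge weights and unit vertex
measure. -/
noncomputable def unweighted : WeightedGraph V where
  w x y := if 0 < G.w x y then 1 else 0
  w_nonneg x y := by split_ifs <;> norm_num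
  w_symm x y := by rw [G.w_symm x y]
  w_self x := by simp [G.w_self x]
  m _ := 1
  m_pos _ := one_pos
  locallyFinite x := (G.locallyFinite x).subset fun y hy => by
    by_contra h
    have h' : ¬ 0 < G.w x y := h
    simp [h'] at hy

/-- The sphere of radius `k` around `x` for the combinatorial distance. -/
def sphere (x : V) (k : ℕ) : Set V := {y | G.graph.dist x y = k}

/-- The small sphere property (SSP) at every vertex, for an unweighted regular graph:
`#S₂(x) ≤ (D choose 2)` with `D` the vertex degree. -/
def SSP : Prop := ∀ x, (G.sphere x 2).encard ≤ (((G.deg x).choose 2 : ℕ) : ℕ∞)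

/-- The non-clustering property (NCP) at every vertex, for an unweighted regular graph: if every
`z ∈ S₂(x)` has backwards-degree `2`, then any two distinct `y₁, y₂ ∈ S₁(x)` have at most one
common neighbour in `S₂(x)`. -/
def NCP : Prop :=
  ∀ x, (∀ z ∈ G.sphere x 2, G.backDeg x z = 2) →
    ∀ y₁ ∈ G.sphere x 1, ∀ y₂ ∈ G.sphere x 1, y₁ ≠ y₂ →
      ∀ z ∈ G.sphere x 2, ∀ z' ∈ G.sphere x 2,
        G.graph.Adj y₁ z → G.graph.Adj z y₂ → G.graph.Adj y₁ z' → G.graph.Adj z' y₂ → z = z'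

end WeightedGraph

/-- The `n`-dimensional hypercube graph on the subsets of an `n`-element set: `A ∼ B` if and only
if their symmetric difference has exactly one element. -/
def hypercubeGraph (n : ℕ) : SimpleGraph (Finset (Fin n)) where
  Adj A B := (symmDiff A B).card = 1
  symm := ⟨fun A B h => by rw [symmDiff_comm]; exact h⟩
  loopless := ⟨fun A h => by simp at h⟩

/-- A weighted graph is an `n`-dimensional hypercube if its unweighted representation is
isomorphic to the `n`-dimensional hypercube graph. -/
def WeightedGraph.IsHypercube {V : Type*} (G : WeightedGraph V) (n : ℕ) : Prop :=
  Nonempty (G.unweighted.graph ≃g hypercubeGraph n)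

/-! The proof runs through the cycle 1 → 2 → 3 → 4 → 5 → 1.

The diameter bound `CDInfty.dist_le` makes $G$ finite under $CD(K,\infty)$. It comes from gradient
contraction of the heat equation. Since infinite graphs must be covered, a single explicit Euler
step replaces the semigroup (`CDInfty.Gam_euler_le`).

1 → 2: on a hypercube the coordinate flips commute and are involutions, so $\Gamma_2$ is a sum of
squared second differences whose diagonal alone gives the curvature (`IsFlipSystem.cdInfty`). The
coordinate functions are $n$ eigenfunctions to $K$, besides the constants.

2 → 3: an eigenfunction to $K$ has constant gradient, so it is determined by its increments at one
vertex. Multiplicity $\deg_{\max}$ therefore makes the graph regular and every increment vector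
realisable. Eigenfunctions with a single nonzero increment force the edge degree $K/2$ and exactly
two common neighbours at distance two. The eigenfunction with all increments $1$ at one vertex has
increments $\pm1$ everywhere, and its range gives a pair at distance $\deg_{\max}$
(`CDInfty.exists_le_dist`).

3 → 4: if the diameter bound is attained, the heat flow and the strong minimum principle
(`CDInfty.rigidity`) show that the distance $f$ to an end point has $\Gamma(f)=D/2$ and
$\Gamma_2(f)=K\Gamma(f)$ everywhere. Hence $\Delta f+Kf$ is constant (`CDInfty.lap_add_mul_const`),
which is the shell structure.

4 → 5: the curvature inequality, minimised over the values on the 2-sphere, is tested on indicators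
of one and of two neighbours. This gives (SSP) and (NCP).

5 → 1: the shell structure fixes how many neighbours lie above and below each vertex. Moment counts
between levels $k$ and $k+2$, bounded by (SSP) and by induction, force two common neighbours for all
pairs at distance two (`IsCubical.meets`); (NCP) carries the induction. Each vertex is then encoded
by the set of root neighbours on its geodesics to the root, and this encoding is an isomorphism
(`IsCubical.isHypercube`). -/

namespace WeightedGraph

/-! ### Calculus of $\Delta$, $\Gamma$ and $\Gamma_2$. -/

variable {V : Type*} (G : WeightedGraph V)

/-- The edge degree `w x y / m x`. -/
noncomputable def edgeDeg (x y : V) : ℝ := G.w x y / G.m x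

variable {G}

lemma mem_nbrs {x y : V} : y ∈ G.nbrs x ↔ G.graph.Adj x y := by
  simp [nbrs, graph]

lemma edgeDeg_nonneg (x y : V) : 0 ≤ G.edgeDeg x y :=
  div_nonneg (G.w_nonneg x y) (G.m_pos x).le

lemma edgeDeg_pos {x y : V} (h : G.graph.Adj x y) : 0 < G.edgeDeg x y :=
  div_pos h (G.m_pos x)

lemma edgeDeg_eq_zero {x y : V} (h : ¬ G.graph.Adj x y) : G.edgeDeg x y = 0 := by
  have : G.w x y = 0 := le_antisymm (not_lt.1 h) (G.w_nonneg x y)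
  simp [edgeDeg, this]

lemma Deg_eq (x : V) : G.Deg x = ∑ y ∈ G.nbrs x, G.edgeDeg x y := by
  simp [Deg, edgeDeg, Finset.sum_div]

lemma lap_eq (f : V → ℝ) (x : V) :
    G.lap f x = ∑ y ∈ G.nbrs x, G.edgeDeg x y * (f y - f x) := by
  simp only [lap, edgeDeg, Finset.sum_div]
  exact Finset.sum_congr rfl fun y _ => by ring

lemma Gam_eq (f g : V → ℝ) (x : V) :
    G.Gam f g x = (∑ y ∈ G.nbrs x, G.edgeDeg x y * ((f y - f x) * (g y - g x))) / 2 := by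
  simp only [Gam, lap_eq, Finset.mul_sum, ← Finset.sum_sub_distrib]
  congr 1
  exact Finset.sum_congr rfl fun y _ => by ring

lemma Gam_nonneg (f : V → ℝ) (x : V) : 0 ≤ G.Gam f f x := by
  rw [Gam_eq]
  exact div_nonneg (Finset.sum_nonneg fun y _ =>
    mul_nonneg (edgeDeg_nonneg x y) (mul_self_nonneg _)) two_pos.le

lemma Gam_comm (f g : V → ℝ) : G.Gam f g = G.Gam g f := by
  funext x
  rw [Gam_eq, Gam_eq]
  congr 1
  exact Finset.sum_congr rfl fun y _ => by ring

lemma lap_add_smul (f g : V → ℝ) (c : ℝ) : G.lap (f + c • g) = G.lap f + c • G.lap g := by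
  funext x
  simp only [lap_eq, Pi.add_apply, Pi.smul_apply, smul_eq_mul, Finset.mul_sum,
    ← Finset.sum_add_distrib]
  exact Finset.sum_congr rfl fun y _ => by ring

lemma lap_smul (g : V → ℝ) (c : ℝ) : G.lap (c • g) = c • G.lap g := by
  funext x
  simp only [lap_eq, Pi.smul_apply, smul_eq_mul, Finset.mul_sum]
  exact Finset.sum_congr rfl fun y _ => by ring

lemma Gam_add_smul (f g h : V → ℝ) (c : ℝ) :
    G.Gam h (f + c • g) = G.Gam h f + c • G.Gam h g := by
  funext x
  simp only [Gam_eq, Pi.add_apply, Pi.smul_apply, smul_eq_mul, Finset.mul_sum,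
    ← Finset.sum_add_distrib, mul_div_assoc', ← add_div]
  congr 1
  exact Finset.sum_congr rfl fun y _ => by ring

lemma Gam_add_smul_self (f g : V → ℝ) (c : ℝ) :
    G.Gam (f + c • g) (f + c • g) =
      G.Gam f f + (2 * c) • G.Gam f g + c ^ 2 • G.Gam g g := by
  rw [Gam_add_smul, Gam_comm _ f, Gam_comm _ g, Gam_add_smul, Gam_add_smul, Gam_comm g f]
  funext x
  simp only [Pi.add_apply, Pi.smul_apply, smul_eq_mul]
  ring

lemma Gam_smul_self (f : V → ℝ) (c : ℝ) (x : V) :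
    G.Gam (c • f) (c • f) x = c ^ 2 * G.Gam f f x := by
  simp only [Gam_eq, Pi.smul_apply, smul_eq_mul, Finset.mul_sum, mul_div_assoc']
  congr 1
  exact Finset.sum_congr rfl fun y _ => by ring

lemma Gam₂_add_smul_self (f g : V → ℝ) (c : ℝ) (x : V) :
    G.Gam₂ (f + c • g) (f + c • g) x =
      G.Gam₂ f f x + (2 * c) * G.Gam₂ f g x + c ^ 2 * G.Gam₂ g g x := by
  rw [Gam₂, Gam_add_smul_self]
  simp only [Gam₂, lap_add_smul, Gam_add_smul, Pi.add_apply, Pi.smul_apply, smul_eq_mul]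
  rw [Gam_comm (f + c • g) (G.lap f), Gam_comm (f + c • g) (G.lap g)]
  simp only [Gam_add_smul, Pi.add_apply, Pi.smul_apply, smul_eq_mul]
  rw [Gam_comm (G.lap f) f, Gam_comm (G.lap f) g, Gam_comm (G.lap g) f, Gam_comm (G.lap g) g]
  ring

/-- A function realising equality in the curvature inequality lies in the kernel of the quadratic
form `Γ₂ - K Γ`. -/
lemma CDInfty.polarize {K : ℝ} (h : G.CDInfty K) {f : V → ℝ} {x : V}
    (hf : G.Gam₂ f f x = K * G.Gam f f x) (g : V → ℝ) :
    G.Gam₂ f g x = K * G.Gam f g x := by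
  have key : ∀ c : ℝ, 0 ≤ (2 * c) * (G.Gam₂ f g x - K * G.Gam f g x) +
      c ^ 2 * (G.Gam₂ g g x - K * G.Gam g g x) := by
    intro c
    have := h (f + c • g) x
    rw [Gam₂_add_smul_self, Gam_add_smul_self] at this
    simp only [Pi.add_apply, Pi.smul_apply, smul_eq_mul] at this
    linarith
  set a := G.Gam₂ f g x - K * G.Gam f g x with ha
  set b := G.Gam₂ g g x - K * G.Gam g g x with hb
  have hb0 : 0 ≤ b := sub_nonneg.2 (h g x)
  -- The optimal `c` would be `-a / b`; the shift by one covers `b = 0` and still leaves a negative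
  -- value unless `a = 0`.
  have h1 := key (-a / (b + 1))
  have h2 : (2 * (-a / (b + 1))) * a + (-a / (b + 1)) ^ 2 * b =
      -(a ^ 2 * (b + 2)) / (b + 1) ^ 2 := by
    field_simp
    ring
  rw [h2] at h1
  have h3 : a = 0 := by
    by_contra hne
    have : -(a ^ 2 * (b + 2)) / (b + 1) ^ 2 < 0 := by
      apply div_neg_of_neg_of_pos
      · have := pow_pos (abs_pos.2 hne) 2
        rw [sq_abs] at this
        nlinarith
      · positivity
    linarith
  linarith

/-- Cauchy–Schwarz with the edge degrees as weights. -/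
lemma sq_lap_le (f : V → ℝ) (x : V) : G.lap f x ^ 2 ≤ 2 * G.Deg x * G.Gam f f x := by
  rw [lap_eq, Gam_eq, Deg_eq]
  have h := Finset.sum_sq_le_sum_mul_sum_of_sq_le_mul (G.nbrs x)
    (r := fun y => G.edgeDeg x y * (f y - f x)) (f := fun y => G.edgeDeg x y)
    (g := fun y => G.edgeDeg x y * ((f y - f x) * (f y - f x)))
    (fun y _ => edgeDeg_nonneg x y)
    (fun y _ => mul_nonneg (edgeDeg_nonneg x y) (mul_self_nonneg _)) (fun y _ => le_of_eq (by ring))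
  linarith

lemma edgeDeg_mul_sq_le (f : V → ℝ) {x y : V} (h : G.graph.Adj x y) :
    G.edgeDeg x y * (f y - f x) ^ 2 ≤ 2 * G.Gam f f x := by
  rw [Gam_eq, mul_div_cancel₀ _ two_ne_zero]
  have := Finset.single_le_sum (f := fun y => G.edgeDeg x y * ((f y - f x) * (f y - f x)))
    (fun y _ => mul_nonneg (edgeDeg_nonneg x y) (mul_self_nonneg _)) (mem_nbrs.2 h)
  rwa [pow_two]

lemma Deg_pos [Nontrivial V] (hc : G.graph.Connected) (x : V) : 0 < G.Deg x := by
  obtain ⟨y, hy⟩ := hc.preconnected.exists_adj_of_nontrivial x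
  rw [Deg_eq]
  exact Finset.sum_pos' (fun y _ => edgeDeg_nonneg x y) ⟨y, mem_nbrs.2 hy, edgeDeg_pos hy⟩

lemma eq_of_forall_adj (hc : G.graph.Connected) {α : Type*} {f : V → α}
    (h : ∀ x y, G.graph.Adj x y → f x = f y) (x y : V) : f x = f y := by
  obtain ⟨p⟩ := hc.preconnected x y
  induction p with
  | nil => rfl
  | cons hadj _ ih => exact (h _ _ hadj).trans ih

lemma eq_of_Gam_eq_zero (hc : G.graph.Connected) {f : V → ℝ} (h : ∀ x, G.Gam f f x = 0)
    (x y : V) : f x = f y := by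
  refine eq_of_forall_adj hc (fun a b hab => ?_) x y
  have h1 := edgeDeg_mul_sq_le f hab
  rw [h a, mul_zero] at h1
  have h2 := edgeDeg_pos hab
  have h3 : (f b - f a) ^ 2 = 0 := le_antisymm (by
    by_contra h4
    have := mul_pos h2 (not_le.1 h4)
    linarith) (sq_nonneg _)
  have := pow_eq_zero_iff (two_ne_zero) |>.1 h3
  linarith

lemma m_mul_edgeDeg (x y : V) : G.m x * G.edgeDeg x y = G.w x y := by
  have := (G.m_pos x).ne'
  simp only [edgeDeg]
  field_simp

section Finite

variable [Fintype V]

lemma sum_nbrs (x : V) (a : V → ℝ) :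
    ∑ y ∈ G.nbrs x, G.edgeDeg x y * a y = ∑ y, G.edgeDeg x y * a y := by
  refine Finset.sum_subset (Finset.subset_univ _) fun y _ hy => ?_
  rw [edgeDeg_eq_zero (fun h => hy (mem_nbrs.2 h)), zero_mul]

/-- Green's formula: `m x * edgeDeg x y = w x y` is symmetric, so the double sum may be averaged
with its reversal. -/
lemma sum_m_mul_lap (f g : V → ℝ) :
    ∑ x, G.m x * (f x * G.lap g x) = -∑ x, G.m x * G.Gam f g x := by
  have h1 : ∑ x, G.m x * (f x * G.lap g x) = ∑ x, ∑ y, G.w x y * (f x * (g y - g x)) := by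
    refine Finset.sum_congr rfl fun x _ => ?_
    rw [lap_eq, sum_nbrs, Finset.mul_sum, Finset.mul_sum]
    refine Finset.sum_congr rfl fun y _ => ?_
    rw [← m_mul_edgeDeg]
    ring
  have h2 : ∑ x, G.m x * G.Gam f g x =
      (∑ x, ∑ y, G.w x y * ((f y - f x) * (g y - g x))) / 2 := by
    rw [Finset.sum_div]
    refine Finset.sum_congr rfl fun x _ => ?_
    rw [Gam_eq, sum_nbrs, mul_div_assoc', Finset.mul_sum]
    congr 1
    refine Finset.sum_congr rfl fun y _ => ?_
    rw [← m_mul_edgeDeg]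
    ring
  have h3 : ∑ x, ∑ y, G.w x y * (f x * (g y - g x)) =
      ∑ x, ∑ y, G.w x y * (f y * (g x - g y)) := by
    rw [Finset.sum_comm]
    refine Finset.sum_congr rfl fun x _ => Finset.sum_congr rfl fun y _ => ?_
    rw [G.w_symm]
  have h4 : ∑ x, ∑ y, G.w x y * ((f y - f x) * (g y - g x)) =
      -(∑ x, ∑ y, G.w x y * (f x * (g y - g x))) -
        ∑ x, ∑ y, G.w x y * (f y * (g x - g y)) := by
    simp only [← Finset.sum_neg_distrib, ← Finset.sum_sub_distrib]
    exact Finset.sum_congr rfl fun x _ => Finset.sum_congr rfl fun y _ => by ring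
  rw [h1, h2, h4, ← h3]
  ring

lemma sum_m_lap (g : V → ℝ) : ∑ x, G.m x * G.lap g x = 0 := by
  have := sum_m_mul_lap (G := G) (fun _ => 1) g
  simp only [one_mul] at this
  rw [this]
  simp [Gam_eq]

lemma eq_of_lap_eq_zero (hc : G.graph.Connected) {f : V → ℝ} (h : ∀ x, G.lap f x = 0)
    (x y : V) : f x = f y := by
  refine eq_of_Gam_eq_zero hc (fun z => ?_) x y
  have h1 := sum_m_mul_lap (G := G) f f
  simp only [h, mul_zero, Finset.sum_const_zero] at h1
  have h2 := (Finset.sum_eq_zero_iff_of_nonneg (fun z _ =>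
    mul_nonneg (G.m_pos z).le (Gam_nonneg f z))).1 (neg_eq_zero.1 h1.symm) z (Finset.mem_univ z)
  exact (mul_eq_zero.1 h2).resolve_left (G.m_pos z).ne'

/-- On a finite graph the Laplacian has total mass zero, so subharmonic functions are harmonic. -/
lemma lap_eq_zero_of_nonneg {g : V → ℝ} (h : ∀ x, 0 ≤ G.lap g x) (x : V) : G.lap g x = 0 := by
  have h2 := (Finset.sum_eq_zero_iff_of_nonneg (fun z _ =>
    mul_nonneg (G.m_pos z).le (h z))).1 (sum_m_lap (G := G) g) x (Finset.mem_univ x)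
  exact (mul_eq_zero.1 h2).resolve_left (G.m_pos x).ne'

end Finite

end WeightedGraph

/-! ### The diameter bound and finiteness. -/

namespace WeightedGraph

variable {V : Type*} {G : WeightedGraph V}

lemma Gam_le_of_lipschitz {f : V → ℝ} {x : V} {c : ℝ}
    (h : ∀ y, G.graph.Adj x y → |f y - f x| ≤ c) : G.Gam f f x ≤ G.Deg x * c ^ 2 / 2 := by
  rw [Gam_eq, Deg_eq, Finset.sum_mul]
  gcongr with y hy
  · exact edgeDeg_nonneg x y
  · rw [← pow_two]
    exact sq_le_sq' (abs_le.1 (h y (mem_nbrs.1 hy))).1 (abs_le.1 (h y (mem_nbrs.1 hy))).2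

lemma lap_le_of_le {f : V → ℝ} {x : V} {c : ℝ} (h : ∀ y, f y ≤ c) :
    G.lap f x ≤ G.Deg x * (c - f x) := by
  rw [lap_eq, Deg_eq, Finset.sum_mul]
  gcongr with y hy
  · exact edgeDeg_nonneg x y
  · exact h y

lemma abs_dist_sub_le {a x y : V} (h : G.graph.Adj x y) :
    |(G.graph.dist a y : ℝ) - G.graph.dist a x| ≤ 1 := by
  have h1 := h.reachable.dist_triangle_right a
  have h2 := h.symm.reachable.dist_triangle_right a
  rw [SimpleGraph.dist_eq_one_iff_adj.2 h] at h1
  rw [SimpleGraph.dist_eq_one_iff_adj.2 h.symm] at h2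
  rw [abs_le]
  have h1' : (G.graph.dist a y : ℝ) ≤ G.graph.dist a x + 1 := by exact_mod_cast h1
  have h2' : (G.graph.dist a x : ℝ) ≤ G.graph.dist a y + 1 := by exact_mod_cast h2
  constructor <;> linarith

/-- A gradient bound controls the increment across each edge, hence along a fixed walk. It makes the
supremum in `CDInfty.sub_le_of_Gam_le` finite. -/
lemma exists_bound_of_Gam_le (hc : G.graph.Connected) (M : ℝ) (x v : V) :
    ∃ C : ℝ, ∀ f : V → ℝ, (∀ z, G.Gam f f z ≤ M) → |f v - f x| ≤ C := by
  obtain ⟨p⟩ := hc.preconnected x v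
  induction p with
  | nil => exact ⟨0, fun f _ => by simp⟩
  | @cons a b c hadj _ ih =>
    obtain ⟨C, hC⟩ := ih
    refine ⟨C + (2 * M / G.edgeDeg a b + 1), fun f hf => ?_⟩
    have h1 := hC f hf
    have h2 := edgeDeg_mul_sq_le f hadj
    have h3 := hf a
    have hk := edgeDeg_pos hadj
    have h4 : (f b - f a) ^ 2 ≤ 2 * M / G.edgeDeg a b := by
      rw [le_div_iff₀ hk]
      linarith
    have h5 : |f b - f a| ≤ 2 * M / G.edgeDeg a b + 1 := by
      rw [← sq_abs] at h4
      nlinarith [sq_nonneg (|f b - f a| - 1), abs_nonneg (f b - f a)]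
    calc |f c - f a| = |(f c - f b) + (f b - f a)| := by ring_nf
      _ ≤ _ := abs_add_le _ _
      _ ≤ _ := add_le_add h1 h5

lemma abs_lap_le {f : V → ℝ} {x : V} {D c : ℝ} (hD : G.Deg x ≤ D) (hD0 : 0 ≤ D) (hc : 0 ≤ c)
    (h : G.Gam f f x ≤ c ^ 2 * (D / 2)) : |G.lap f x| ≤ c * D := by
  refine abs_le_of_sq_le_sq ?_ (by positivity)
  calc G.lap f x ^ 2 ≤ 2 * G.Deg x * G.Gam f f x := sq_lap_le f x
    _ ≤ 2 * D * (c ^ 2 * (D / 2)) := by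
        have := Gam_nonneg (G := G) f x
        gcongr
    _ = (c * D) ^ 2 := by ring

/-- One explicit Euler step of the heat equation contracts the gradient, up to second order. -/
lemma CDInfty.Gam_euler_le {K D : ℝ} (h : G.CDInfty K) (hD : ∀ z, G.Deg z ≤ D) (hD0 : 0 < D)
    {f : V → ℝ} (hf : ∀ z, G.Gam f f z ≤ D / 2) {ε : ℝ} (hε : 0 < ε)
    (hεs : (2 * K + D) * ε ≤ 1) (z : V) :
    G.Gam (f + ε • G.lap f) (f + ε • G.lap f) z ≤
      D / 2 * (1 - 2 * K * ε + 4 * D ^ 2 * ε ^ 2) := by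
  have hl : ∀ y, |G.lap f y| ≤ D := fun y => by
    simpa using abs_lap_le (hD y) hD0.le zero_le_one (by simpa using hf y)
  have h1 : G.Gam (G.lap f) (G.lap f) z ≤ 2 * D ^ 3 := by
    refine (Gam_le_of_lipschitz (c := 2 * D) fun y _ => ?_).trans ?_
    · have := abs_sub (G.lap f y) (G.lap f z)
      linarith [hl y, hl z]
    · have := hD z
      calc G.Deg z * (2 * D) ^ 2 / 2 ≤ D * (2 * D) ^ 2 / 2 := by gcongr
        _ = 2 * D ^ 3 := by ring
  have h2 : G.lap (G.Gam f f) z ≤ D * (D / 2 - G.Gam f f z) :=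
    (lap_le_of_le hf).trans (mul_le_mul_of_nonneg_right (hD z) (sub_nonneg.2 (hf z)))
  have h3 := h f z
  simp only [Gam₂] at h3
  rw [Gam_add_smul_self]
  simp only [Pi.add_apply, Pi.smul_apply, smul_eq_mul]
  have h4 : 2 * ε * G.Gam f (G.lap f) z ≤
      ε * (D * (D / 2 - G.Gam f f z)) - 2 * K * ε * G.Gam f f z := by
    have : 2 * G.Gam f (G.lap f) z ≤ D * (D / 2 - G.Gam f f z) - 2 * K * G.Gam f f z := by
      linarith
    nlinarith
  have h5 : ε ^ 2 * G.Gam (G.lap f) (G.lap f) z ≤ ε ^ 2 * (2 * D ^ 3) := by gcongr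
  -- For small `ε` the total coefficient of `Γ f z` is nonnegative, so the worst case is `Γ f z = D
  -- / 2`.
  have h6 : 0 ≤ (1 - (2 * K + D) * ε) * (D / 2 - G.Gam f f z) :=
    mul_nonneg (sub_nonneg.2 hεs) (sub_nonneg.2 (hf z))
  nlinarith

/-- Let `R` be the supremum of the increments between `x` and `v` under the gradient bound. An Euler
step of length `ε` changes the increment by at most `2 * ε * D`, while gradient contraction bounds
the new increment by about `(1 - K * ε) * R`. Letting `ε` tend to zero gives `K * R ≤ 2 * D`. -/
theorem CDInfty.sub_le_of_Gam_le {K D : ℝ} (h : G.CDInfty K) (hK : 0 < K)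
    (hc : G.graph.Connected) (hD : ∀ z, G.Deg z ≤ D) (hD0 : 0 < D) (x v : V)
    {f : V → ℝ} (hf : ∀ z, G.Gam f f z ≤ D / 2) : f v - f x ≤ 2 * D / K := by
  obtain ⟨C, hC⟩ := exists_bound_of_Gam_le hc (D / 2) x v
  set S : Set ℝ := {r | ∃ f : V → ℝ, (∀ z, G.Gam f f z ≤ D / 2) ∧ f v - f x = r} with hS
  have hbdd : BddAbove S := ⟨C, by
    rintro _ ⟨f, hf, rfl⟩
    exact (le_abs_self _).trans (hC f hf)⟩
  have h0 : (0 : ℝ) ∈ S := ⟨fun _ => 0, fun z => by simp [Gam_eq]; positivity, by simp⟩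
  set R := sSup S with hR
  have hR0 : 0 ≤ R := le_csSup hbdd h0
  have key : ∀ ε : ℝ, 0 < ε → (2 * K + D) * ε ≤ 1 → K * R ≤ 2 * D + 2 * D ^ 2 * R * ε := by
    intro ε hε hεs
    -- With `s = 1 + u`, the contraction factor of `Γ` is `1 + 2 * u ≤ s ^ 2`, so dividing the Euler
    -- step by `s` gives an admissible function again.
    set s := 1 - K * ε + 2 * D ^ 2 * ε ^ 2 with hs
    have hs0 : 0 < s := by
      have : K * ε ≤ 1 / 2 := by nlinarith
      have : 0 ≤ 2 * D ^ 2 * ε ^ 2 := by positivity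
      linarith
    have h1 : R ≤ s * R + 2 * ε * D := by
      refine csSup_le ⟨0, h0⟩ ?_
      rintro _ ⟨f, hf, rfl⟩
      have h2 : (f + ε • G.lap f) v - (f + ε • G.lap f) x ≤ s * R := by
        rw [← div_le_iff₀' hs0]
        refine le_csSup hbdd ⟨s⁻¹ • (f + ε • G.lap f), fun z => ?_, ?_⟩
        · rw [Gam_smul_self, inv_pow, inv_mul_le_iff₀ (pow_pos hs0 2)]
          refine (h.Gam_euler_le hD hD0 hf hε hεs z).trans ?_
          rw [mul_comm]
          gcongr
          nlinarith [sq_nonneg (-K * ε + 2 * D ^ 2 * ε ^ 2)]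
        · simp only [Pi.smul_apply, smul_eq_mul]
          field_simp
      have hl : ∀ y, |G.lap f y| ≤ D := fun y => by
        simpa using abs_lap_le (hD y) hD0.le zero_le_one (by simpa using hf y)
      simp only [Pi.add_apply, Pi.smul_apply, smul_eq_mul] at h2
      nlinarith [(abs_le.1 (hl v)).1, (abs_le.1 (hl x)).2]
    have h3 : ε * (K * R) ≤ ε * (2 * D + 2 * D ^ 2 * R * ε) := by
      rw [hs] at h1
      linarith
    exact le_of_mul_le_mul_left h3 hε
  have hfin : K * R ≤ 2 * D := by
    by_contra hlt
    rw [not_le] at hlt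
    set a := K * R - 2 * D with ha
    have ha0 : 0 < a := sub_pos.2 hlt
    -- The first bound permits the Euler step; the second keeps the error `2 * D ^ 2 * R * ε` below
    -- `a`.
    set ε := min (1 / (2 * K + D)) (a / (2 * (2 * D ^ 2 * R + 1))) with hε
    have hε0 : 0 < ε := lt_min (by positivity) (by positivity)
    have h1 := key ε hε0 (by
      rw [← le_div_iff₀' (by positivity)]
      exact min_le_left _ _)
    have h2 : 2 * (2 * D ^ 2 * R + 1) * ε ≤ a := by
      rw [← le_div_iff₀' (by positivity)]
      exact min_le_right _ _
    nlinarith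
  rw [le_div_iff₀' hK]
  have : f v - f x ≤ R := le_csSup hbdd ⟨f, hf, rfl⟩
  nlinarith

/-- The distance to `x` is 1-Lipschitz, so its `Γ` is at most `D / 2`. -/
theorem CDInfty.dist_le {K D : ℝ} (h : G.CDInfty K) (hK : 0 < K)
    (hc : G.graph.Connected) (hD : ∀ z, G.Deg z ≤ D) (hD0 : 0 < D) (x v : V) :
    (G.graph.dist x v : ℝ) ≤ 2 * D / K := by
  have := h.sub_le_of_Gam_le hK hc hD hD0 x v (f := fun z => (G.graph.dist x z : ℝ)) fun z => by
    refine (Gam_le_of_lipschitz fun y hy => abs_dist_sub_le hy).trans ?_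
    simpa using div_le_div_of_nonneg_right (hD z) two_pos.le
  simpa using this

lemma finite_of_dist_le (hc : G.graph.Connected) (x : V) (n : ℕ)
    (h : ∀ v, G.graph.dist x v ≤ n) : Finite V := by
  have key : ∀ k, {v | G.graph.dist x v ≤ k}.Finite := by
    intro k
    induction k with
    | zero =>
      refine (Set.finite_singleton x).subset fun v hv => ?_
      exact (hc.dist_eq_zero_iff.1 (Nat.le_zero.1 hv)).symm
    | succ k ih =>
      refine (ih.union (ih.biUnion fun y _ => (G.nbrs y).finite_toSet)).subset fun v hv => ?_
      obtain ⟨p, hp⟩ := hc.exists_walk_length_eq_dist v x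
      rw [SimpleGraph.dist_comm] at hp
      cases p with
      | nil => left; simp
      | @cons _ b _ hadj q =>
        right
        simp only [Set.mem_iUnion]
        refine ⟨b, ?_, by simpa [mem_nbrs] using hadj.symm⟩
        have h1 := SimpleGraph.dist_le q
        rw [SimpleGraph.dist_comm] at h1
        simp only [SimpleGraph.Walk.length_cons] at hp
        simp only [Set.mem_ofPred_eq] at hv ⊢
        omega
  exact Set.finite_univ_iff.1 ((key n).subset fun v _ => h v)

end WeightedGraph

/-! ### Heat flow, minimum principles and rigidity in the diameter bound. -/

namespace WeightedGraph

variable {V : Type*} {G : WeightedGraph V}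

/-- The squared negative part is differentiable even at zero; this allows the energy argument in
`nonneg_of_supersolution`. -/
lemma hasDerivAt_sq_min_zero (x : ℝ) :
    HasDerivAt (fun y : ℝ => (min y 0) ^ 2) (2 * min x 0) x := by
  rcases lt_trichotomy x 0 with hx | rfl | hx
  · rw [min_eq_left hx.le]
    have h : HasDerivAt (fun y : ℝ => y ^ 2) (2 * x) x := by simpa using hasDerivAt_pow 2 x
    refine h.congr_of_eventuallyEq ?_
    filter_upwards [gt_mem_nhds hx] with y hy
    rw [min_eq_left hy.le]
  · rw [hasDerivAt_iff_isLittleO]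
    simp only [min_self, mul_zero, smul_zero, sub_zero, ne_eq, OfNat.ofNat_ne_zero,
      not_false_eq_true, zero_pow]
    have h1 : (fun y : ℝ => (min y 0) ^ 2) =O[nhds 0] fun y : ℝ => y ^ 2 := by
      refine Asymptotics.IsBigO.of_bound 1 (Filter.Eventually.of_forall fun y => ?_)
      simp only [norm_pow, Real.norm_eq_abs, sq_abs, one_mul]
      rcases le_total y 0 with h | h
      · rw [min_eq_left h]
      · simpa [min_eq_right h] using sq_nonneg y
    exact h1.trans_isLittleO (Asymptotics.isLittleO_pow_id one_lt_two)
  · rw [min_eq_right hx.le, mul_zero]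
    refine (hasDerivAt_const x (0 : ℝ)).congr_of_eventuallyEq ?_
    filter_upwards [lt_mem_nhds hx] with y hy
    rw [min_eq_right hy.le]
    simp

/-- The one-sided derivative decides. This matters at `t = 0`, since the identities for the flow are
known only for nonnegative times. -/
lemma hasDerivAt_eq_zero_of_forall_ge {g : ℝ → ℝ} {g' t : ℝ} (h : HasDerivAt g g' t)
    (h0 : ∀ s, t ≤ s → g s = 0) : g' = 0 := by
  have h1 : HasDerivWithinAt g g' (Set.Ici t) t := h.hasDerivWithinAt
  have h2 : HasDerivWithinAt g 0 (Set.Ici t) t :=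
    (hasDerivWithinAt_const t (Set.Ici t) (0 : ℝ)).congr (fun s hs => h0 s hs) (h0 t le_rfl)
  exact (uniqueDiffWithinAt_Ici t).eq_deriv _ h1 h2

lemma lap_const_sub_mul (f : V → ℝ) (a c : ℝ) (x : V) :
    G.lap (fun z => a - c * f z) x = -(c * G.lap f x) := by
  simp only [lap_eq, Finset.mul_sum, ← Finset.sum_neg_distrib]
  exact Finset.sum_congr rfl fun y _ => by ring

/-- `u` solves the heat equation of the graph. -/
def IsHeatFlow (G : WeightedGraph V) (u : ℝ → V → ℝ) : Prop :=
  ∀ t z, HasDerivAt (fun s => u s z) (G.lap (u t) z) t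

lemma IsHeatFlow.hasDerivAt_Gam {u : ℝ → V → ℝ} (hu : G.IsHeatFlow u) (t : ℝ) (z : V) :
    HasDerivAt (fun s => G.Gam (u s) (u s) z) (2 * G.Gam (u t) (G.lap (u t)) z) t := by
  simp only [Gam_eq]
  have h : ∀ y ∈ G.nbrs z, HasDerivAt
      (fun s => G.edgeDeg z y * ((u s y - u s z) * (u s y - u s z)))
      (G.edgeDeg z y * ((G.lap (u t) y - G.lap (u t) z) * (u t y - u t z) +
        (u t y - u t z) * (G.lap (u t) y - G.lap (u t) z))) t := fun y _ =>
    (((hu t y).sub (hu t z)).mul ((hu t y).sub (hu t z))).const_mul _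
  refine ((HasDerivAt.fun_sum h).div_const 2).congr_deriv ?_
  rw [mul_div_assoc', Finset.mul_sum]
  congr 1
  exact Finset.sum_congr rfl fun y _ => by ring

/-- Strong minimum principle: a nonnegative supersolution that vanishes at a vertex for all times
vanishes identically, and it is a solution. -/
lemma eq_zero_of_supersolution (hc : G.graph.Connected) {B b : ℝ → V → ℝ}
    (hB : ∀ t z, HasDerivAt (fun s => B s z) (b t z) t) (hb : ∀ t z, G.lap (B t) z ≤ b t z)
    (h0 : ∀ t, 0 ≤ t → ∀ z, 0 ≤ B t z) {x : V} (hx : ∀ t, 0 ≤ t → B t x = 0) {t : ℝ}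
    (ht : 0 ≤ t) (z : V) : B t z = 0 ∧ b t z = G.lap (B t) z := by
  -- If `B` stays zero at `y`, then `b` vanishes there and `ΔB ≤ 0`; but `ΔB` is a sum of
  -- nonnegative terms, so `B` vanishes at every neighbour as well.
  have step : ∀ y, (∀ t, 0 ≤ t → B t y = 0) →
      (∀ t, 0 ≤ t → b t y = 0 ∧ G.lap (B t) y = 0) ∧
      ∀ y', G.graph.Adj y y' → ∀ t, 0 ≤ t → B t y' = 0 := by
    intro y hy
    have hnn : ∀ t, 0 ≤ t → ∀ y' ∈ G.nbrs y, 0 ≤ G.edgeDeg y y' * (B t y' - B t y) :=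
      fun t ht y' _ => by
        rw [hy t ht, sub_zero]
        exact mul_nonneg (edgeDeg_nonneg y y') (h0 t ht y')
    have h1 : ∀ t, 0 ≤ t → b t y = 0 ∧ G.lap (B t) y = 0 := by
      intro t ht
      have h2 := hasDerivAt_eq_zero_of_forall_ge (hB t y) fun s hs => hy s (ht.trans hs)
      refine ⟨h2, le_antisymm (h2 ▸ hb t y) ?_⟩
      rw [lap_eq]
      exact Finset.sum_nonneg (hnn t ht)
    refine ⟨h1, fun y' hyy t ht => ?_⟩
    have h2 := (h1 t ht).2
    rw [lap_eq, Finset.sum_eq_zero_iff_of_nonneg (hnn t ht)] at h2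
    have h3 := (mul_eq_zero.1 (h2 y' (mem_nbrs.2 hyy))).resolve_left (edgeDeg_pos hyy).ne'
    rwa [hy t ht, sub_zero] at h3
  have hall : ∀ t, 0 ≤ t → B t z = 0 := by
    have := eq_of_forall_adj hc (f := fun y => ∀ t, 0 ≤ t → B t y = 0)
      (fun y y' h => propext ⟨fun hy => (step y hy).2 y' h,
        fun hy => (step y' hy).2 y h.symm⟩) x z
    exact this.mp hx
  have := (step z hall).1 t ht
  exact ⟨hall t ht, this.1.trans this.2.symm⟩

section Finite

variable [Fintype V]

lemma exists_isHeatFlow (G : WeightedGraph V) (f : V → ℝ) :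
    ∃ u : ℝ → V → ℝ, u 0 = f ∧ G.IsHeatFlow u := by
  let L₀ : (V → ℝ) →ₗ[ℝ] (V → ℝ) :=
    { toFun := G.lap
      map_add' := fun f g => by simpa using lap_add_smul f g 1
      map_smul' := fun c f => lap_smul f c }
  let L : (V → ℝ) →L[ℝ] (V → ℝ) := LinearMap.toContinuousLinearMap L₀
  have hL : ∀ g, L g = G.lap g := fun g => rfl
  refine ⟨fun t => NormedSpace.exp (t • L) f, by simp, fun t z => ?_⟩
  have h1 := hasDerivAt_exp_smul_const' (𝕂 := ℝ) L t
  have h2 := h1.clm_apply (hasDerivAt_const t f)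
  have h3 := (hasDerivAt_pi.1 h2) z
  refine h3.congr_deriv ?_
  simp [← hL]

/-- Weak minimum principle for supersolutions of the heat equation. -/
lemma nonneg_of_supersolution {B b : ℝ → V → ℝ}
    (hB : ∀ t z, HasDerivAt (fun s => B s z) (b t z) t) (hb : ∀ t z, G.lap (B t) z ≤ b t z)
    (h0 : ∀ z, 0 ≤ B 0 z) {t : ℝ} (ht : 0 ≤ t) (z : V) : 0 ≤ B t z := by
  -- The squared norm of the negative part is nonincreasing: by Green's formula its derivative is at
  -- most `-2 ∑ m Γ(min B 0, B)`, and truncation is monotone, so each term of this `Γ` is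
  -- nonnegative.
  set φ : ℝ → ℝ := fun s => ∑ z, G.m z * (min (B s z) 0) ^ 2 with hφ
  have hd : ∀ s, HasDerivAt φ (∑ z, G.m z * (2 * min (B s z) 0 * b s z)) s := fun s =>
    HasDerivAt.fun_sum fun z _ =>
      (HasDerivAt.comp (h₂ := fun y : ℝ => (min y 0) ^ 2) s
        (hasDerivAt_sq_min_zero (B s z)) (hB s z)).const_mul (G.m z)
  have hneg : ∀ s, ∑ z, G.m z * (2 * min (B s z) 0 * b s z) ≤ 0 := by
    intro s
    have h1 : ∑ z, G.m z * (2 * min (B s z) 0 * b s z) ≤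
        2 * ∑ z, G.m z * (min (B s z) 0 * G.lap (B s) z) := by
      rw [Finset.mul_sum]
      refine Finset.sum_le_sum fun z _ => ?_
      have : min (B s z) 0 * b s z ≤ min (B s z) 0 * G.lap (B s) z :=
        mul_le_mul_of_nonpos_left (hb s z) (min_le_right _ _)
      nlinarith [G.m_pos z]
    refine h1.trans ?_
    rw [sum_m_mul_lap (fun z => min (B s z) 0) (B s)]
    have h2 : 0 ≤ ∑ z, G.m z * G.Gam (fun z => min (B s z) 0) (B s) z := by
      refine Finset.sum_nonneg fun z _ => mul_nonneg (G.m_pos z).le ?_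
      rw [Gam_eq]
      refine div_nonneg (Finset.sum_nonneg fun y _ => mul_nonneg (edgeDeg_nonneg z y) ?_)
        two_pos.le
      rcases le_total (B s y) (B s z) with h | h
      · exact mul_nonneg_of_nonpos_of_nonpos (sub_nonpos.2 (min_le_min_right 0 h))
          (sub_nonpos.2 h)
      · exact mul_nonneg (sub_nonneg.2 (min_le_min_right 0 h)) (sub_nonneg.2 h)
    linarith
  have hanti : Antitone φ := antitone_of_deriv_nonpos (fun s => (hd s).differentiableAt)
    fun s => by rw [(hd s).deriv]; exact hneg s
  have h1 : φ t ≤ 0 := by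
    refine (hanti ht).trans (le_of_eq ?_)
    simp only [hφ]
    refine Finset.sum_eq_zero fun z _ => ?_
    rw [min_eq_right (h0 z)]
    simp
  have hnn : ∀ z ∈ Finset.univ, 0 ≤ G.m z * (min (B t z) 0) ^ 2 := fun z _ =>
    mul_nonneg (G.m_pos z).le (sq_nonneg _)
  have h2 := (Finset.sum_eq_zero_iff_of_nonneg hnn).1
    (le_antisymm h1 (Finset.sum_nonneg hnn)) z (Finset.mem_univ z)
  have h3 := pow_eq_zero_iff two_ne_zero |>.1
    ((mul_eq_zero.1 h2).resolve_left (G.m_pos z).ne')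
  exact min_eq_right_iff.1 h3

/-- Equality in the diameter bound forces the gradient to be constant, and equality in the
curvature-dimension inequality. -/
theorem CDInfty.rigidity {K D : ℝ} (h : G.CDInfty K) (hK : 0 < K)
    (hc : G.graph.Connected) (hD : ∀ z, G.Deg z ≤ D) (hD0 : 0 < D) {x v : V}
    {f : V → ℝ} (hf : ∀ z, G.Gam f f z ≤ D / 2) (hxv : 2 * D / K ≤ f v - f x) :
    G.lap f x = D ∧ ∀ z, G.Gam f f z = D / 2 ∧ G.Gam₂ f f z = K * G.Gam f f z := by
  obtain ⟨u, hu0, hu⟩ := G.exists_isHeatFlow f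
  set e : ℝ → ℝ := fun t => Real.exp (2 * K * t) with he
  have hed : ∀ t, HasDerivAt e (2 * K * e t) t := fun t => by
    have := ((hasDerivAt_id t).const_mul (2 * K)).exp
    exact this.congr_deriv (by simp [he, mul_comm])
  -- `B` satisfies `∂ₜB = ΔB + E`, where `E` is the curvature defect of `u t`. It is a
  -- supersolution, and `B ≥ 0` is the gradient estimate.
  set B : ℝ → V → ℝ := fun t z => D / 2 - e t * G.Gam (u t) (u t) z with hB
  set E : ℝ → V → ℝ := fun t z =>
    2 * e t * (G.Gam₂ (u t) (u t) z - K * G.Gam (u t) (u t) z) with hE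
  have hEnn : ∀ t z, 0 ≤ E t z := fun t z =>
    mul_nonneg (mul_nonneg two_pos.le (Real.exp_pos _).le) (sub_nonneg.2 (h (u t) z))
  have hBd : ∀ t z, HasDerivAt (fun s => B s z) (G.lap (B t) z + E t z) t := by
    intro t z
    refine (((hed t).mul (hu.hasDerivAt_Gam t z)).const_sub (D / 2)).congr_deriv ?_
    simp only [hB, hE]
    rw [lap_const_sub_mul]
    simp only [Gam₂]
    ring
  have hle : ∀ t z, G.lap (B t) z ≤ G.lap (B t) z + E t z := fun t z =>
    le_add_of_nonneg_right (hEnn t z)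
  have hB0 : ∀ t, 0 ≤ t → ∀ z, 0 ≤ B t z := fun t ht z =>
    nonneg_of_supersolution hBd hle (fun z => by simpa [hB, he, hu0] using hf z) ht z
  set c : ℝ → ℝ := fun t => Real.exp (-(K * t)) with hcdef
  have hce : ∀ t, c t ^ 2 * e t = 1 := fun t => by
    simp only [hcdef, he]
    rw [← Real.exp_nat_mul, ← Real.exp_add]
    convert Real.exp_zero using 2
    push_cast
    ring
  have hcpos : ∀ t, 0 < c t := fun t => Real.exp_pos _
  have hG : ∀ t, 0 ≤ t → ∀ z, G.Gam (u t) (u t) z ≤ c t ^ 2 * (D / 2) := by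
    intro t ht z
    have h1 := hB0 t ht z
    have h2 := hce t
    simp only [hB] at h1
    have h3 := mul_nonneg (sq_nonneg (c t)) h1
    have h4 : c t ^ 2 * (D / 2 - e t * G.Gam (u t) (u t) z) =
        c t ^ 2 * (D / 2) - (c t ^ 2 * e t) * G.Gam (u t) (u t) z := by ring
    rw [h4, h2] at h3
    linarith
  have hlap : ∀ t, 0 ≤ t → ∀ z, |G.lap (u t) z| ≤ c t * D := fun t ht z =>
    abs_lap_le (hD z) hD0.le (hcpos t).le (hG t ht z)
  have hcd : ∀ t, HasDerivAt c (-K * c t) t := fun t => by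
    have := (((hasDerivAt_id t).const_mul K).neg).exp
    simpa [hcdef, mul_comm] using this
  -- `θ` starts nonnegative and is nondecreasing because `|Δu| ≤ c * D`; the diameter bound for `u
  -- t` divided by `c t` gives `θ ≤ 0`. So `θ` vanishes for all nonnegative times.
  set θ : ℝ → ℝ := fun t => u t v - u t x - 2 * D / K * c t with hθ
  have hθd : ∀ t, HasDerivAt θ (G.lap (u t) v - G.lap (u t) x + 2 * D * c t) t := by
    intro t
    refine (((hu t v).sub (hu t x)).sub ((hcd t).const_mul (2 * D / K))).congr_deriv ?_
    field_simp
    ring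
  have hmono : MonotoneOn θ (Set.Ici 0) := by
    refine monotoneOn_of_deriv_nonneg (convex_Ici 0)
      (fun t _ => (hθd t).continuousAt.continuousWithinAt)
      (fun t _ => (hθd t).differentiableAt.differentiableWithinAt) fun t ht => ?_
    rw [interior_Ici] at ht
    rw [(hθd t).deriv]
    have h1 := abs_le.1 (hlap t (le_of_lt ht) v)
    have h2 := abs_le.1 (hlap t (le_of_lt ht) x)
    linarith [h1.1, h2.2]
  have hθ0 : ∀ t, 0 ≤ t → θ t = 0 := by
    intro t ht
    apply le_antisymm
    · have h1 := h.sub_le_of_Gam_le hK hc hD hD0 x v (f := (c t)⁻¹ • u t) fun z => by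
        rw [Gam_smul_self, inv_pow, inv_mul_le_iff₀ (pow_pos (hcpos t) 2)]
        exact hG t ht z
      have h2 : ((c t)⁻¹ • u t) v - ((c t)⁻¹ • u t) x = (c t)⁻¹ * (u t v - u t x) := by
        simp only [Pi.smul_apply, smul_eq_mul]
        ring
      rw [h2, inv_mul_le_iff₀ (hcpos t)] at h1
      simp only [hθ]
      linarith
    · refine le_trans ?_ (hmono Set.self_mem_Ici ht ht)
      simp only [hθ, hu0, hcdef]
      simpa using hxv
  -- A vanishing derivative of `θ` forces extremal Laplacians at both ends. Cauchy–Schwarz at `x`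
  -- then gives `B t x = 0`, the input of the strong minimum principle.
  have hlx : ∀ t, 0 ≤ t → G.lap (u t) x = c t * D := by
    intro t ht
    have h0 := hasDerivAt_eq_zero_of_forall_ge (hθd t) fun s hs => hθ0 s (ht.trans hs)
    have h1 := abs_le.1 (hlap t ht v)
    have h2 := abs_le.1 (hlap t ht x)
    linarith [h1.1, h2.2]
  have hBx : ∀ t, 0 ≤ t → B t x = 0 := by
    intro t ht
    refine le_antisymm ?_ (hB0 t ht x)
    have h1 := sq_lap_le (G := G) (u t) x
    rw [hlx t ht] at h1
    have h2 : 2 * G.Deg x * G.Gam (u t) (u t) x ≤ 2 * D * G.Gam (u t) (u t) x := by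
      have := Gam_nonneg (G := G) (u t) x
      gcongr
      exact hD x
    have h3 : c t ^ 2 * (D / 2) ≤ G.Gam (u t) (u t) x := by
      refine le_of_mul_le_mul_left (a := 2 * D) ?_ (by positivity)
      calc _ = (c t * D) ^ 2 := by ring
        _ ≤ _ := h1.trans h2
    simp only [hB]
    have h4 := mul_le_mul_of_nonneg_left h3 (Real.exp_pos (2 * K * t)).le
    have h5 : Real.exp (2 * K * t) * (c t ^ 2 * (D / 2)) = D / 2 := by
      calc _ = (c t ^ 2 * e t) * (D / 2) := by ring
        _ = D / 2 := by rw [hce, one_mul]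
    linarith
  refine ⟨by simpa [hu0, hcdef] using hlx 0 le_rfl, fun z => ?_⟩
  obtain ⟨h1, h2⟩ := eq_zero_of_supersolution hc hBd hle hB0 hBx le_rfl z
  have h3 : E 0 z = 0 := by linarith
  simp only [hB, hE, hu0, he, mul_zero, Real.exp_zero, one_mul] at h1 h3
  constructor <;> linarith

/-- A function realising equality in the diameter bound is, up to a constant, an eigenfunction. -/
lemma CDInfty.lap_add_mul_const {K : ℝ} (h : G.CDInfty K) (hc : G.graph.Connected)
    {f : V → ℝ} (hf : ∀ z, G.Gam₂ f f z = K * G.Gam f f z) (x y : V) :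
    G.lap f x + K * f x = G.lap f y + K * f y := by
  -- Pair the kernel equation for `f` with `g` and sum against `m`: Green's formula turns it into `∑
  -- m Γ(g, g) = 0`.
  set g : V → ℝ := G.lap f + K • f with hg
  have h1 : ∑ x, G.m x * G.Gam₂ f g x = ∑ x, G.m x * (K * G.Gam f g x) :=
    Finset.sum_congr rfl fun x _ => by rw [h.polarize (hf x) g]
  have h2 : ∑ x, G.m x * G.Gam₂ f g x = -∑ x, G.m x * G.Gam g (G.lap f) x := by
    have e1 := sum_m_lap (G := G) (G.Gam f g)
    have e2 : ∑ x, G.m x * G.Gam f (G.lap g) x = ∑ x, G.m x * G.Gam g (G.lap f) x := by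
      rw [Gam_comm f (G.lap g), Gam_comm g (G.lap f), ← neg_inj, ← sum_m_mul_lap, ← sum_m_mul_lap]
      exact Finset.sum_congr rfl fun x _ => by ring
    have e3 : ∑ x, G.m x * G.Gam₂ f g x = (∑ x, G.m x * G.lap (G.Gam f g) x -
        ∑ x, G.m x * G.Gam f (G.lap g) x - ∑ x, G.m x * G.Gam g (G.lap f) x) / 2 := by
      rw [← Finset.sum_sub_distrib, ← Finset.sum_sub_distrib, Finset.sum_div]
      refine Finset.sum_congr rfl fun x _ => ?_
      simp only [Gam₂]
      ring
    rw [e3, e1, e2]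
    ring
  have h3 : ∑ x, G.m x * G.Gam g g x = 0 := by
    have : G.Gam g g = G.Gam g (G.lap f) + K • G.Gam g f := Gam_add_smul _ _ _ _
    rw [this]
    simp only [Pi.add_apply, Pi.smul_apply, smul_eq_mul, mul_add, Finset.sum_add_distrib]
    rw [Gam_comm g f]
    linarith
  have h4 := (Finset.sum_eq_zero_iff_of_nonneg fun z _ =>
    mul_nonneg (G.m_pos z).le (Gam_nonneg g z)).1 h3
  exact eq_of_Gam_eq_zero hc (fun z => (mul_eq_zero.1 (h4 z (Finset.mem_univ z))).resolve_left
    (G.m_pos z).ne') x y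

end Finite

end WeightedGraph

/-! ### From extremal diameter to the hypercube shell structure. -/

namespace WeightedGraph

variable {V : Type*} {G : WeightedGraph V}

lemma sq_sub_eq_one_of_Gam_eq {D : ℝ} {f : V → ℝ} {x : V} (hD : G.Deg x ≤ D)
    (hf : ∀ y, G.graph.Adj x y → |f y - f x| ≤ 1) (h : G.Gam f f x = D / 2) :
    G.Deg x = D ∧ ∀ y, G.graph.Adj x y → (f y - f x) ^ 2 = 1 := by
  have hnn : ∀ y ∈ G.nbrs x, 0 ≤ G.edgeDeg x y * (1 - (f y - f x) ^ 2) := fun y hy =>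
    mul_nonneg (edgeDeg_nonneg x y)
      (sub_nonneg.2 ((sq_le_one_iff_abs_le_one _).2 (hf y (mem_nbrs.1 hy))))
  have hsum : ∑ y ∈ G.nbrs x, G.edgeDeg x y * (1 - (f y - f x) ^ 2) = G.Deg x - D := by
    have : D = 2 * G.Gam f f x := by linarith
    rw [this, Gam_eq, Deg_eq, mul_div_cancel₀ _ two_ne_zero, ← Finset.sum_sub_distrib]
    exact Finset.sum_congr rfl fun y _ => by ring
  have h0 : ∑ y ∈ G.nbrs x, G.edgeDeg x y * (1 - (f y - f x) ^ 2) = 0 :=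
    le_antisymm (by linarith) (Finset.sum_nonneg hnn)
  refine ⟨by linarith, fun y hy => ?_⟩
  have h1 := (Finset.sum_eq_zero_iff_of_nonneg hnn).1 h0 y (mem_nbrs.2 hy)
  have h2 := (mul_eq_zero.1 h1).resolve_left (edgeDeg_pos hy).ne'
  linarith

lemma isBipartite_of_dist {x : V}
    (h : ∀ y z, G.graph.Adj y z →
      ((G.graph.dist x z : ℝ) - G.graph.dist x y) ^ 2 = 1) : G.graph.IsBipartite := by
  have col : G.graph.Coloring Bool := SimpleGraph.Coloring.mk
    (fun z => decide (Even (G.graph.dist x z))) (fun {y z} hyz => by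
      have h1 := h y z hyz
      have h2 : ((G.graph.dist x z : ℤ) - G.graph.dist x y) ^ 2 = 1 := by exact_mod_cast h1
      have h3 : Odd (((G.graph.dist x z : ℤ) - G.graph.dist x y) ^ 2) := by
        rw [h2]; exact odd_one
      rw [Int.odd_pow' two_ne_zero, Int.odd_sub, Int.odd_coe_nat, Int.even_coe_nat,
        ← Nat.not_even_iff_odd] at h3
      intro h4
      rw [decide_eq_decide] at h4
      tauto)
  simpa using col.colorable

/-- Apply rigidity to the distance `f` from `x`. Equality in the Lipschitz estimate makes `Deg`
constant and lets each edge change `f` by exactly one. Hence `2 d₋ = Deg - Δf`, and `Δf + K f = D`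
turns this into `K f`. -/
theorem CDInfty.hssAt_of_le_dist [Nontrivial V] [Fintype V] {K D : ℝ} (h : G.CDInfty K)
    (hK : 0 < K) (hc : G.graph.Connected) (hD : ∀ z, G.Deg z ≤ D) (hD0 : 0 < D) {x v : V}
    (hxv : 2 * D / K ≤ G.graph.dist x v) : G.HSSAt (2 * D / K) (K / 2) x := by
  set f : V → ℝ := fun z => (G.graph.dist x z : ℝ) with hf
  have hlip : ∀ z y, G.graph.Adj z y → |f y - f z| ≤ 1 := fun z y hy => abs_dist_sub_le hy
  have hGam : ∀ z, G.Gam f f z ≤ D / 2 := fun z => by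
    refine (Gam_le_of_lipschitz (hlip z)).trans ?_
    simpa using div_le_div_of_nonneg_right (hD z) two_pos.le
  obtain ⟨hlx, hr⟩ := h.rigidity hK hc hD hD0 hGam (x := x) (v := v) (by simpa [hf] using hxv)
  have hsq := fun z => sq_sub_eq_one_of_Gam_eq (hD z) (hlip z) (hr z).1
  have hlap : ∀ z, G.lap f z + K * f z = D := fun z => by
    rw [h.lap_add_mul_const hc (fun z => (hr z).2) z x, hlx]
    simp [hf]
  refine ⟨by positivity, by positivity, fun z => ?_,
    isBipartite_of_dist fun y z hyz => (hsq y).2 z hyz, fun z => ?_⟩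
  · rw [(hsq z).1]
    field_simp
  · have h1 : 2 * G.backDeg x z = G.Deg z - G.lap f z := by
      rw [backDeg, Deg_eq, lap_eq, Finset.mul_sum, ← Finset.sum_sub_distrib,
        Finset.sum_filter]
      refine Finset.sum_congr rfl fun y hy => ?_
      have h2 := (hsq z).2 y (mem_nbrs.1 hy)
      rw [SimpleGraph.dist_comm (v := x), SimpleGraph.dist_comm (v := x), G.w_symm y z]
      change _ = G.edgeDeg z y - G.edgeDeg z y * (f y - f z)
      have h3 : (G.graph.dist x y < G.graph.dist x z) ↔ f y < f z := by simp [hf]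
      rw [if_congr h3 rfl rfl]
      change (if f y < f z then 2 * G.edgeDeg z y else 0) = _
      rcases sq_eq_sq_iff_eq_or_eq_neg.1 (h2.trans (one_pow 2).symm) with h4 | h4
      · rw [if_neg (by linarith), h4]; ring
      · rw [if_pos (by linarith), h4]; ring
    have h2 := hlap z
    rw [(hsq z).1] at h1
    rw [SimpleGraph.dist_comm]
    change _ = K / 2 * f z
    linarith

@[simp] lemma unweighted_graph : G.unweighted.graph = G.graph := by
  ext x y
  simp only [graph, unweighted]
  split_ifs with h <;> simp [h]

@[simp] lemma unweighted_nbrs (x : V) : G.unweighted.nbrs x = G.nbrs x := by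
  ext y
  rw [mem_nbrs, mem_nbrs, unweighted_graph]

lemma unweighted_w_of_adj {x y : V} (h : G.graph.Adj x y) : G.unweighted.w x y = 1 :=
  if_pos h

lemma unweighted_m (x : V) : G.unweighted.m x = 1 := rfl

lemma unweighted_Deg (x : V) : G.unweighted.Deg x = G.deg x := by
  rw [Deg, unweighted_nbrs, unweighted_m, div_one, deg,
    Finset.sum_congr rfl fun y hy => unweighted_w_of_adj (mem_nbrs.1 hy)]
  simp

@[simp] lemma unweighted_deg (x : V) : G.unweighted.deg x = G.deg x := by
  rw [deg, deg, unweighted_nbrs]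

open Classical in
lemma unweighted_backDeg (x z : V) : G.unweighted.backDeg x z =
    ((G.nbrs z).filter fun y => G.graph.dist y x < G.graph.dist z x).card := by
  rw [backDeg, unweighted_graph, unweighted_nbrs, unweighted_m,
    Finset.sum_congr rfl fun y hy => by
      rw [unweighted_w_of_adj (mem_nbrs.1 (Finset.mem_filter.1 hy).1).symm]]
  simp

lemma HasConstEdgeDegree.edgeDeg_eq {κ : ℝ} (h : G.HasConstEdgeDegree κ) {x y : V}
    (hxy : G.graph.Adj x y) : G.edgeDeg x y = κ :=
  (h x y).resolve_left (edgeDeg_pos hxy).ne'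

lemma HasConstEdgeDegree.lap_eq {κ : ℝ} (h : G.HasConstEdgeDegree κ) (f : V → ℝ) (x : V) :
    G.lap f x = κ * ∑ y ∈ G.nbrs x, (f y - f x) := by
  rw [WeightedGraph.lap_eq, Finset.mul_sum]
  exact Finset.sum_congr rfl fun y hy => by rw [h.edgeDeg_eq (mem_nbrs.1 hy)]

lemma HasConstEdgeDegree.Gam_eq {κ : ℝ} (h : G.HasConstEdgeDegree κ) (f g : V → ℝ) (x : V) :
    G.Gam f g x = κ / 2 * ∑ y ∈ G.nbrs x, (f y - f x) * (g y - g x) := by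
  rw [WeightedGraph.Gam_eq, Finset.mul_sum, Finset.sum_div]
  exact Finset.sum_congr rfl fun y hy => by rw [h.edgeDeg_eq (mem_nbrs.1 hy)]; ring

lemma HasConstEdgeDegree.Deg_eq {κ : ℝ} (h : G.HasConstEdgeDegree κ) (x : V) :
    G.Deg x = κ * G.deg x := by
  rw [WeightedGraph.Deg_eq, Finset.sum_congr rfl fun y hy => h.edgeDeg_eq (mem_nbrs.1 hy),
    Finset.sum_const, nsmul_eq_mul, mul_comm, deg]

lemma HasConstEdgeDegree.backDeg_eq {κ : ℝ} (h : G.HasConstEdgeDegree κ) (x z : V) :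
    G.backDeg x z = κ * G.unweighted.backDeg x z := by
  rw [unweighted_backDeg, backDeg, mul_comm, ← nsmul_eq_mul, ← Finset.sum_const]
  refine Finset.sum_congr rfl fun y hy => ?_
  rw [G.w_symm]
  exact h.edgeDeg_eq (mem_nbrs.1 (Finset.mem_filter.1 hy).1)

lemma HSSAt.unweighted {κ N : ℝ} {x : V} (h : G.HasConstEdgeDegree κ) (hs : G.HSSAt N κ x) :
    G.unweighted.HSSAt N 1 x where
  dim_pos := hs.dim_pos
  weight_pos := one_pos
  deg_eq z := by
    have h1 := hs.deg_eq z
    rw [h.Deg_eq, mul_comm N] at h1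
    rw [unweighted_Deg, mul_one]
    exact mul_left_cancel₀ hs.weight_pos.ne' h1
  bipartite := by rw [unweighted_graph]; exact hs.bipartite
  backDeg_eq z := by
    have h1 := hs.backDeg_eq z
    rw [h.backDeg_eq] at h1
    rw [one_mul, unweighted_graph]
    exact mul_left_cancel₀ hs.weight_pos.ne' h1

-- A neighbour of the root has only the root below it, so its backwards-degree `W` is the weight of
-- a single edge.
open Classical in
lemma HSSAt.hasConstEdgeDegree [Nontrivial V] (hc : G.graph.Connected) {κ N W : ℝ} {x : V}
    (h : G.HasConstEdgeDegree κ) (hs : G.HSSAt N W x) : G.HasConstEdgeDegree W := by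
  obtain ⟨y, hy⟩ := hc.preconnected.exists_adj_of_nontrivial x
  have h1 := hs.backDeg_eq y
  rw [SimpleGraph.dist_eq_one_iff_adj.2 hy.symm, h.backDeg_eq, unweighted_backDeg] at h1
  have h2 : (G.nbrs y).filter (fun z => G.graph.dist z x < G.graph.dist y x) = {x} := by
    ext z
    rw [Finset.mem_filter, mem_nbrs, Finset.mem_singleton,
      SimpleGraph.dist_eq_one_iff_adj.2 hy.symm, Nat.lt_one_iff, hc.dist_eq_zero_iff]
    exact ⟨fun h => h.2, fun h => ⟨h ▸ hy.symm, h⟩⟩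
  rw [h2] at h1
  simp only [Finset.card_singleton, Nat.cast_one, mul_one] at h1
  rwa [← h1]

end WeightedGraph

/-! ### Curvature implies the small sphere and non-clustering properties. -/

namespace WeightedGraph

variable {V : Type*} {G : WeightedGraph V}

lemma triangle_free_of_isBipartite (h : G.graph.IsBipartite) {x y z : V}
    (hxy : G.graph.Adj x y) (hyz : G.graph.Adj y z) : ¬ G.graph.Adj x z := by
  obtain ⟨c⟩ := h
  intro hxz
  have h1 := c.valid hxy
  have h2 := c.valid hyz
  have h3 := c.valid hxz
  generalize c x = a at *
  generalize c y = b at *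
  generalize c z = d at *
  revert a b d
  decide

open Classical in
/-- The vertices other than `x` that are reached from `x` by two steps. -/
noncomputable def secondNbrs (G : WeightedGraph V) (x : V) : Finset V :=
  ((G.nbrs x).biUnion G.nbrs).erase x

lemma mem_secondNbrs {x z : V} :
    z ∈ G.secondNbrs x ↔ z ≠ x ∧ ∃ y, G.graph.Adj x y ∧ G.graph.Adj y z := by
  classical
  simp [secondNbrs, mem_nbrs]

open Classical in
/-- The common neighbours of two vertices. -/
noncomputable def commonNbrs (G : WeightedGraph V) (x z : V) : Finset V :=
  G.nbrs x ∩ G.nbrs z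

lemma mem_commonNbrs {x y z : V} :
    y ∈ G.commonNbrs x z ↔ G.graph.Adj x y ∧ G.graph.Adj y z := by
  classical
  simp only [commonNbrs, Finset.mem_inter, mem_nbrs]
  exact and_congr_right fun _ => G.graph.adj_comm _ _

open Classical in
lemma sum_erase_nbrs_comm (x : V) (h : V → V → ℝ) :
    ∑ y ∈ G.nbrs x, ∑ z ∈ (G.nbrs y).erase x, h y z =
      ∑ z ∈ G.secondNbrs x, ∑ y ∈ G.commonNbrs x z, h y z := by
  refine Finset.sum_comm' fun y z => ?_
  simp only [mem_nbrs, Finset.mem_erase, mem_secondNbrs, mem_commonNbrs]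
  constructor
  · rintro ⟨h1, h2, h3⟩
    exact ⟨⟨h1, h3⟩, h2, y, h1, h3⟩
  · rintro ⟨⟨h1, h2⟩, h3, _⟩
    exact ⟨h1, h3, h2⟩

lemma commonNbrs_card_pos {x z : V} (h : z ∈ G.secondNbrs x) : 0 < (G.commonNbrs x z).card := by
  obtain ⟨_, y, hy⟩ := mem_secondNbrs.1 h
  exact Finset.card_pos.2 ⟨y, mem_commonNbrs.2 hy⟩

/-- The coordinates of the 2-sphere in the curvature-dimension inequality of a regular graph. -/
lemma CDInfty.two_step_nonneg {κ : ℝ} (hκ : 0 < κ) (hw : G.HasConstEdgeDegree κ)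
    (h : G.CDInfty (2 * κ)) {n : ℕ} (hn : ∀ x, G.deg x = n) {f : V → ℝ} {x : V} (hx : f x = 0) :
    0 ≤ ∑ z ∈ G.secondNbrs x, ∑ y ∈ G.commonNbrs x z, (f z ^ 2 - 4 * f y * f z) +
      (2 * n - 4) * ∑ y ∈ G.nbrs x, f y ^ 2 + 2 * (∑ y ∈ G.nbrs x, f y) ^ 2 := by
  classical
  rw [← sum_erase_nbrs_comm x (fun y z => f z ^ 2 - 4 * f y * f z)]
  have hcd := h f x
  set N := G.nbrs x with hN
  set A : V → ℝ := fun y => ∑ z ∈ (G.nbrs y).erase x, f z with hA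
  set B : V → ℝ := fun y => ∑ z ∈ (G.nbrs y).erase x, f z ^ 2 with hB
  have hcard : ∀ y, ((G.nbrs y).card : ℝ) = n := fun y => by
    rw [← hn y, deg]
  have hlapx : G.lap f x = κ * ∑ y ∈ N, f y := by
    simp [hw.lap_eq, hx, hN]
  have hGamx : G.Gam f f x = κ / 2 * ∑ y ∈ N, f y ^ 2 := by
    simp [hw.Gam_eq, hx, hN, pow_two]
  have hmem : ∀ y ∈ N, x ∈ G.nbrs y := fun y hy => mem_nbrs.2 (mem_nbrs.1 hy).symm
  have hlapy : ∀ y ∈ N, G.lap f y = κ * (A y - n * f y) := fun y hy => by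
    rw [hw.lap_eq, Finset.sum_sub_distrib, Finset.sum_const, nsmul_eq_mul, hcard,
      ← Finset.add_sum_erase _ _ (hmem y hy), hx, zero_add]
  have hGamy : ∀ y ∈ N, G.Gam f f y = κ / 2 * (n * f y ^ 2 - 2 * f y * A y + B y) :=
    fun y hy => by
    rw [hw.Gam_eq]
    have e1 : ∑ z ∈ G.nbrs y, (f z - f y) * (f z - f y) =
        ∑ z ∈ G.nbrs y, f z ^ 2 - 2 * f y * ∑ z ∈ G.nbrs y, f z + n * f y ^ 2 := by
      rw [← hcard y, ← nsmul_eq_mul, ← Finset.sum_const, Finset.mul_sum,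
        ← Finset.sum_sub_distrib, ← Finset.sum_add_distrib]
      exact Finset.sum_congr rfl fun z _ => by ring
    rw [e1, ← Finset.add_sum_erase _ _ (hmem y hy), ← Finset.add_sum_erase _ f (hmem y hy), hx]
    simp only [hA, hB]
    ring
  have e2 : G.lap (G.Gam f f) x = κ * (∑ y ∈ N, κ / 2 * (n * f y ^ 2 - 2 * f y * A y + B y) -
      n * (κ / 2 * ∑ y ∈ N, f y ^ 2)) := by
    rw [hw.lap_eq, Finset.sum_sub_distrib, Finset.sum_congr rfl hGamy, Finset.sum_const,
      nsmul_eq_mul, hcard, hGamx]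
  have e3 : G.Gam f (G.lap f) x = κ / 2 * (∑ y ∈ N, f y * (κ * (A y - n * f y)) -
      (∑ y ∈ N, f y) * (κ * ∑ y ∈ N, f y)) := by
    rw [hw.Gam_eq, hx, hlapx, Finset.sum_mul, ← Finset.sum_sub_distrib]
    congr 1
    refine Finset.sum_congr rfl fun y hy => ?_
    rw [hlapy y hy]
    ring
  have e4 : ∑ y ∈ N, κ / 2 * (n * f y ^ 2 - 2 * f y * A y + B y) =
      κ / 2 * (n * ∑ y ∈ N, f y ^ 2 - 2 * ∑ y ∈ N, f y * A y + ∑ y ∈ N, B y) := by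
    simp only [Finset.mul_sum, ← Finset.sum_sub_distrib, ← Finset.sum_add_distrib]
    exact Finset.sum_congr rfl fun y _ => by ring
  have e5 : ∑ y ∈ N, f y * (κ * (A y - n * f y)) =
      κ * (∑ y ∈ N, f y * A y - n * ∑ y ∈ N, f y ^ 2) := by
    simp only [Finset.mul_sum, ← Finset.sum_sub_distrib]
    exact Finset.sum_congr rfl fun y _ => by ring
  have e6 : ∑ y ∈ N, ∑ z ∈ (G.nbrs y).erase x, (f z ^ 2 - 4 * f y * f z) =
      ∑ y ∈ N, B y - 4 * ∑ y ∈ N, f y * A y := by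
    rw [Finset.mul_sum, ← Finset.sum_sub_distrib]
    refine Finset.sum_congr rfl fun y _ => ?_
    simp only [hA, hB, Finset.mul_sum, ← Finset.sum_sub_distrib]
    exact Finset.sum_congr rfl fun z _ => by ring
  rw [Gam₂, e2, e3, e4, e5, hGamx] at hcd
  rw [e6]
  have hκ2 : 0 < κ ^ 2 / 4 := by positivity
  refine le_of_mul_le_mul_left (a := κ ^ 2 / 4) ?_ hκ2
  nlinarith

/-- The curvature-dimension inequality, minimised over the values on the 2-sphere. -/
lemma CDInfty.sum_secondNbrs_le {κ : ℝ} (hκ : 0 < κ) (hw : G.HasConstEdgeDegree κ)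
    (h : G.CDInfty (2 * κ)) (htri : ∀ x y z, G.graph.Adj x y → G.graph.Adj y z →
      ¬ G.graph.Adj x z) {n : ℕ} (hn : ∀ x, G.deg x = n) (f : V → ℝ) (x : V) :
    4 * ∑ z ∈ G.secondNbrs x, (∑ y ∈ G.commonNbrs x z, f y) ^ 2 / (G.commonNbrs x z).card ≤
      (2 * n - 4) * ∑ y ∈ G.nbrs x, f y ^ 2 + 2 * (∑ y ∈ G.nbrs x, f y) ^ 2 := by
  classical
  set S : V → ℝ := fun z => ∑ y ∈ G.commonNbrs x z, f y with hS
  -- With `b` common neighbours, the value `t` at `z` contributes `b t² - 4 S t`, which is minimal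
  -- at `t = 2 S / b` with value `-4 S² / b`. Without triangles the 2-sphere avoids the neighbours,
  -- so these choices do not interfere.
  set g : V → ℝ := fun z => if z ∈ G.nbrs x then f z else if z = x then 0 else
    2 * S z / (G.commonNbrs x z).card with hg
  have hgx : g x = 0 := by simp [hg, mem_nbrs]
  have hgN : ∀ y ∈ G.nbrs x, g y = f y := fun y hy => by simp only [hg, if_pos hy]
  have h1 := h.two_step_nonneg hκ hw hn hgx
  rw [Finset.sum_congr rfl hgN, Finset.sum_congr (f := fun y => g y ^ 2) rfl
    fun y hy => by rw [hgN y hy]] at h1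
  have h2 : ∑ z ∈ G.secondNbrs x, ∑ y ∈ G.commonNbrs x z, (g z ^ 2 - 4 * g y * g z) =
      -(4 * ∑ z ∈ G.secondNbrs x, S z ^ 2 / (G.commonNbrs x z).card) := by
    rw [Finset.mul_sum, ← Finset.sum_neg_distrib]
    refine Finset.sum_congr rfl fun z hz => ?_
    have hgz : g z = 2 * S z / (G.commonNbrs x z).card := by
      obtain ⟨hzx, y, hxy, hyz⟩ := mem_secondNbrs.1 hz
      simp only [hg]
      rw [if_neg (fun h => htri x y z hxy hyz (mem_nbrs.1 h)), if_neg hzx]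
    have e1 : ∑ y ∈ G.commonNbrs x z, (g z ^ 2 - 4 * g y * g z) =
        (G.commonNbrs x z).card * g z ^ 2 - 4 * S z * g z := by
      rw [Finset.sum_sub_distrib, Finset.sum_const, nsmul_eq_mul, hS, Finset.mul_sum,
        Finset.sum_mul]
      congr 1
      refine Finset.sum_congr rfl fun y hy => ?_
      rw [hgN y (mem_nbrs.2 (mem_commonNbrs.1 hy).1)]
    have hb : ((G.commonNbrs x z).card : ℝ) ≠ 0 :=
      Nat.cast_ne_zero.2 (commonNbrs_card_pos hz).ne'
    rw [e1, hgz]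
    field_simp
    ring
  rw [h2] at h1
  linarith

lemma sphere_two_eq (hc : G.graph.Connected) (htri : ∀ x y z, G.graph.Adj x y →
    G.graph.Adj y z → ¬ G.graph.Adj x z) (x : V) : G.sphere x 2 = G.secondNbrs x := by
  ext z
  rw [Finset.mem_coe, mem_secondNbrs]
  change G.graph.dist x z = 2 ↔ _
  have he : G.graph.dist x z = 2 ↔ G.graph.edist x z = 2 := by
    rw [← (hc.preconnected x z).coe_dist_eq_edist]
    norm_cast
  rw [he, SimpleGraph.edist_eq_two_iff]
  constructor
  · rintro ⟨h1, h2, y, hy⟩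
    have hy := (SimpleGraph.mem_commonNeighbors _).1 hy
    exact ⟨h1.symm, y, hy.1, hy.2.symm⟩
  · rintro ⟨h1, y, h2, h3⟩
    exact ⟨h1.symm, htri x y z h2 h3, y, (SimpleGraph.mem_commonNeighbors _).2 ⟨h2, h3.symm⟩⟩

lemma unweighted_backDeg_of_mem_secondNbrs (hc : G.graph.Connected)
    (htri : ∀ x y z, G.graph.Adj x y → G.graph.Adj y z → ¬ G.graph.Adj x z) {x z : V}
    (hz : z ∈ G.secondNbrs x) : G.unweighted.backDeg x z = (G.commonNbrs x z).card := by
  classical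
  rw [unweighted_backDeg]
  congr 2
  have h2 : G.graph.dist z x = 2 := by
    rw [SimpleGraph.dist_comm]
    have : z ∈ G.sphere x 2 := by rw [sphere_two_eq hc htri]; exact hz
    exact this
  obtain ⟨hzx, y', hxy', hyz'⟩ := mem_secondNbrs.1 hz
  ext y
  rw [Finset.mem_filter, mem_nbrs, mem_commonNbrs, h2]
  constructor
  · rintro ⟨h3, h4⟩
    refine ⟨?_, h3.symm⟩
    have h5 : G.graph.dist y x ≠ 0 := by
      rw [Ne, hc.dist_eq_zero_iff]
      rintro rfl
      exact htri y y' z hxy' hyz' h3.symm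
    exact (SimpleGraph.dist_eq_one_iff_adj.1 (by omega)).symm
  · rintro ⟨h3, h4⟩
    refine ⟨h4.symm, ?_⟩
    rw [SimpleGraph.dist_eq_one_iff_adj.2 h3.symm]
    norm_num

/-- Testing on the indicator of a neighbour gives `2 * n - 2` on the right. Summed over all
neighbours, each `z` collects total weight one on the left, so `4 * #S₂ ≤ n * (2 * n - 2)`. -/
theorem CDInfty.card_secondNbrs_le {κ : ℝ} (hκ : 0 < κ) (hw : G.HasConstEdgeDegree κ)
    (h : G.CDInfty (2 * κ)) (htri : ∀ x y z, G.graph.Adj x y → G.graph.Adj y z →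
      ¬ G.graph.Adj x z) {n : ℕ} (hn : ∀ x, G.deg x = n) (x : V) :
    (G.secondNbrs x).card ≤ n.choose 2 := by
  classical
  have h1 : ∀ y₀ ∈ G.nbrs x, 4 * ∑ z ∈ G.secondNbrs x, ∑ y ∈ G.commonNbrs x z,
      (if y = y₀ then (1 : ℝ) / (G.commonNbrs x z).card else 0) ≤ 2 * n - 2 := by
    intro y₀ hy₀
    have h2 := h.sum_secondNbrs_le hκ hw htri hn (fun y => if y = y₀ then 1 else 0) x
    simp only [ite_pow, one_pow, ne_eq, OfNat.ofNat_ne_zero, not_false_eq_true, zero_pow,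
      Finset.sum_ite_eq', if_pos hy₀, ite_div, zero_div] at h2 ⊢
    linarith
  have h3 := Finset.sum_le_sum h1
  rw [Finset.sum_const, nsmul_eq_mul, ← Finset.mul_sum, Finset.sum_comm] at h3
  have h4 : ∀ z ∈ G.secondNbrs x, ∑ y₀ ∈ G.nbrs x, ∑ y ∈ G.commonNbrs x z,
      (if y = y₀ then (1 : ℝ) / (G.commonNbrs x z).card else 0) = 1 := by
    intro z hz
    rw [Finset.sum_comm]
    have h5 : ∀ y ∈ G.commonNbrs x z, ∑ y₀ ∈ G.nbrs x,
        (if y = y₀ then (1 : ℝ) / (G.commonNbrs x z).card else 0) =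
          1 / (G.commonNbrs x z).card := fun y hy => by
      rw [Finset.sum_ite_eq, if_pos (mem_nbrs.2 (mem_commonNbrs.1 hy).1)]
    rw [Finset.sum_congr rfl h5, Finset.sum_const, nsmul_eq_mul, mul_one_div_cancel]
    exact Nat.cast_ne_zero.2 (commonNbrs_card_pos hz).ne'
  rw [Finset.sum_congr rfl h4, Finset.sum_const, nsmul_eq_mul, mul_one] at h3
  have h6 : ((G.nbrs x).card : ℝ) = n := by rw [← hn x, deg]
  rw [h6] at h3
  have h7 : ((G.secondNbrs x).card : ℝ) ≤ (n.choose 2 : ℕ) := by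
    rw [Nat.cast_choose_two]
    linarith
  exact_mod_cast h7

/-- Test on the sum of the indicators of `y₁` and `y₂`. The right side is `4 * n`; the left side is
`4 * ((n - 1) + N)` with `N` the number of second neighbours adjacent to both, so `N ≤ 1`. -/
theorem CDInfty.eq_of_adj_adj {κ : ℝ} (hκ : 0 < κ) (hw : G.HasConstEdgeDegree κ)
    (h : G.CDInfty (2 * κ)) (htri : ∀ x y z, G.graph.Adj x y → G.graph.Adj y z →
      ¬ G.graph.Adj x z) {n : ℕ} (hn : ∀ x, G.deg x = n) {x : V}
    (h2 : ∀ z ∈ G.secondNbrs x, (G.commonNbrs x z).card = 2) {y₁ y₂ z z' : V}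
    (hxy₁ : G.graph.Adj x y₁) (hxy₂ : G.graph.Adj x y₂) (hne : y₁ ≠ y₂)
    (hz : z ∈ G.secondNbrs x) (hz' : z' ∈ G.secondNbrs x) (hy₁z : G.graph.Adj y₁ z)
    (hy₂z : G.graph.Adj y₂ z) (hy₁z' : G.graph.Adj y₁ z') (hy₂z' : G.graph.Adj y₂ z') :
    z = z' := by
  classical
  set f : V → ℝ := fun y => (if y = y₁ then 1 else 0) + (if y = y₂ then 1 else 0) with hf
  have hf1 : ∀ T : Finset V, ∑ y ∈ T, f y =
      (if y₁ ∈ T then 1 else 0) + (if y₂ ∈ T then 1 else 0) := fun T => by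
    simp only [hf, Finset.sum_add_distrib, Finset.sum_ite_eq']
  have hf2 : ∀ y, f y ^ 2 = f y := fun y => by
    simp only [hf]
    split_ifs with h3 h4
    · exact absurd (h3.symm.trans h4) hne
    all_goals norm_num
  have h3 := h.sum_secondNbrs_le hκ hw htri hn f x
  have hm₁ := mem_nbrs.2 hxy₁
  have hm₂ := mem_nbrs.2 hxy₂
  simp only [hf2, hf1, if_pos hm₁, if_pos hm₂] at h3
  have hcount : ∀ y, G.graph.Adj x y →
      ∑ w ∈ G.secondNbrs x, (if y ∈ G.commonNbrs x w then (1 : ℝ) else 0) = n - 1 := by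
    intro y hy
    have e1 : (G.secondNbrs x).filter (fun w => y ∈ G.commonNbrs x w) = (G.nbrs y).erase x := by
      ext w
      simp only [Finset.mem_filter, mem_secondNbrs, mem_commonNbrs, Finset.mem_erase, mem_nbrs]
      exact ⟨fun h => ⟨h.1.1, h.2.2⟩, fun h => ⟨⟨h.1, y, hy, h.2⟩, hy, h.2⟩⟩
    rw [← Finset.sum_filter, e1, Finset.sum_const, nsmul_eq_mul, mul_one,
      Finset.cast_card_erase_of_mem (mem_nbrs.2 hy.symm), ← hn y, deg]
  have h4 : ∑ w ∈ G.secondNbrs x, (((if y₁ ∈ G.commonNbrs x w then (1 : ℝ) else 0) +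
      (if y₂ ∈ G.commonNbrs x w then 1 else 0)) ^ 2 / (G.commonNbrs x w).card) =
      (n - 1) + ∑ w ∈ G.secondNbrs x,
        (if y₁ ∈ G.commonNbrs x w ∧ y₂ ∈ G.commonNbrs x w then (1 : ℝ) else 0) := by
    have : (n - 1 : ℝ) = ((n - 1) + (n - 1)) / 2 := by ring
    rw [this]
    nth_rewrite 1 [← hcount y₁ hxy₁]
    rw [← hcount y₂ hxy₂, ← Finset.sum_add_distrib, Finset.sum_div, ← Finset.sum_add_distrib]
    refine Finset.sum_congr rfl fun w hw => ?_
    rw [h2 w hw]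
    by_cases a1 : y₁ ∈ G.commonNbrs x w <;> by_cases a2 : y₂ ∈ G.commonNbrs x w <;>
      simp only [a1, a2, if_true, if_false, and_true, and_false] <;> norm_num
  rw [h4, ← Finset.sum_filter, Finset.sum_const, nsmul_eq_mul, mul_one] at h3
  have h5 : (((G.secondNbrs x).filter fun w =>
      y₁ ∈ G.commonNbrs x w ∧ y₂ ∈ G.commonNbrs x w).card : ℝ) ≤ 1 := by linarith
  have h6 := Finset.card_le_one.1 (Nat.cast_le_one.1 h5)
  refine h6 z ?_ z' ?_ <;> simp only [Finset.mem_filter, mem_commonNbrs] <;> tauto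

end WeightedGraph

/-! ### Levels and counts of two-step paths. -/

namespace WeightedGraph

variable {V : Type*} {G : WeightedGraph V}

lemma mem_secondNbrs_comm {x z : V} : z ∈ G.secondNbrs x ↔ x ∈ G.secondNbrs z := by
  rw [mem_secondNbrs, mem_secondNbrs]
  constructor <;> rintro ⟨h, y, h1, h2⟩ <;> exact ⟨h.symm, y, h2.symm, h1.symm⟩

lemma commonNbrs_comm (x z : V) : G.commonNbrs x z = G.commonNbrs z x := by
  classical
  exact Finset.inter_comm _ _

/-- The combinatorial distance to the root. -/
noncomputable def level (G : WeightedGraph V) (x₀ v : V) : ℕ := G.graph.dist v x₀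

/-- The neighbours one level closer to the root. -/
noncomputable def down (G : WeightedGraph V) (x₀ v : V) : Finset V :=
  (G.nbrs v).filter fun y => G.level x₀ y + 1 = G.level x₀ v

/-- The neighbours one level further from the root. -/
noncomputable def up (G : WeightedGraph V) (x₀ v : V) : Finset V :=
  (G.nbrs v).filter fun y => G.level x₀ y = G.level x₀ v + 1

/-- The number of neighbours in the levels around a vertex agrees with the hypercube, together with
the small sphere property and the non-clustering property. -/
structure IsCubical (G : WeightedGraph V) (x₀ : V) (n : ℕ) : Prop where
  level_step : ∀ y z, G.graph.Adj y z →
    G.level x₀ y + 1 = G.level x₀ z ∨ G.level x₀ y = G.level x₀ z + 1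
  card_nbrs : ∀ v, (G.nbrs v).card = n
  card_down : ∀ v, (G.down x₀ v).card = G.level x₀ v
  ssp : ∀ x, (G.secondNbrs x).card ≤ n.choose 2
  ncp : ∀ x, (∀ z ∈ G.secondNbrs x, (G.commonNbrs x z).card = 2) →
    ∀ y₁ y₂ z z', G.graph.Adj x y₁ → G.graph.Adj x y₂ → y₁ ≠ y₂ →
      z ∈ G.secondNbrs x → z' ∈ G.secondNbrs x → G.graph.Adj y₁ z → G.graph.Adj y₂ z →
      G.graph.Adj y₁ z' → G.graph.Adj y₂ z' → z = z'

/-- Two different vertices of level `k` have at most one common neighbour one level closer to the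
root. -/
def UniqueMeet (G : WeightedGraph V) (x₀ : V) (k : ℕ) : Prop :=
  ∀ z z', G.level x₀ z = k → z ≠ z' → ∀ y₁ y₂, y₁ ∈ G.down x₀ z → y₁ ∈ G.down x₀ z' →
    y₂ ∈ G.down x₀ z → y₂ ∈ G.down x₀ z' → y₁ = y₂

variable {x₀ : V} {n : ℕ}

lemma mem_down {v y : V} :
    y ∈ G.down x₀ v ↔ G.graph.Adj v y ∧ G.level x₀ y + 1 = G.level x₀ v := by
  simp [down, mem_nbrs]

lemma mem_up {v y : V} :
    y ∈ G.up x₀ v ↔ G.graph.Adj v y ∧ G.level x₀ y = G.level x₀ v + 1 := by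
  simp [up, mem_nbrs]

lemma mem_up_iff {v y : V} : y ∈ G.up x₀ v ↔ v ∈ G.down x₀ y := by
  rw [mem_up, mem_down, G.graph.adj_comm]
  exact and_congr_right fun _ => eq_comm

lemma IsCubical.mem_nbrs_iff (h : G.IsCubical x₀ n) {v y : V} :
    G.graph.Adj v y ↔ y ∈ G.down x₀ v ∨ y ∈ G.up x₀ v := by
  rw [mem_down, mem_up]
  constructor
  · intro hv
    have := h.level_step _ _ hv
    rcases this with h1 | h1
    · exact Or.inr ⟨hv, h1.symm⟩
    · exact Or.inl ⟨hv, h1.symm⟩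
  · tauto

lemma disjoint_down_up (v : V) : Disjoint (G.down x₀ v) (G.up x₀ v) := by
  rw [Finset.disjoint_left]
  intro y h1 h2
  rw [mem_down] at h1
  rw [mem_up] at h2
  omega

lemma IsCubical.card_up (h : G.IsCubical x₀ n) (v : V) :
    G.level x₀ v + (G.up x₀ v).card = n := by
  classical
  rw [← h.card_down, ← h.card_nbrs v, ← Finset.card_union_of_disjoint (disjoint_down_up v)]
  congr 1
  ext y
  rw [Finset.mem_union, ← h.mem_nbrs_iff, mem_nbrs]

open Classical in
lemma sum_card_adj_comm (A T : Finset V) :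
    ∑ z ∈ T, (A.filter fun y => G.graph.Adj y z).card =
      ∑ y ∈ A, (T.filter fun z => G.graph.Adj y z).card :=
  (Finset.sum_card_bipartiteAbove_eq_sum_card_bipartiteBelow fun y z => G.graph.Adj y z).symm

section Parts

open Classical in
/-- The vertices two steps from `x` at the given level. -/
noncomputable def secondNbrsAt (G : WeightedGraph V) (x₀ x : V) (k : ℕ) : Finset V :=
  (G.secondNbrs x).filter fun z => G.level x₀ z = k

lemma mem_secondNbrsAt {x z : V} {k : ℕ} :
    z ∈ G.secondNbrsAt x₀ x k ↔ z ∈ G.secondNbrs x ∧ G.level x₀ z = k := by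
  simp [secondNbrsAt]

lemma IsCubical.level_of_mem_secondNbrs (h : G.IsCubical x₀ n) {x z : V}
    (hz : z ∈ G.secondNbrs x) : G.level x₀ z + 2 = G.level x₀ x ∨
      G.level x₀ z = G.level x₀ x ∨ G.level x₀ z = G.level x₀ x + 2 := by
  obtain ⟨_, y, h1, h2⟩ := mem_secondNbrs.1 hz
  have := h.level_step _ _ h1
  have := h.level_step _ _ h2
  omega

open Classical in
/-- The number of common neighbours of `x` and `z` below `x`. -/
noncomputable def downCount (G : WeightedGraph V) (x₀ x z : V) : ℕ :=
  ((G.down x₀ x).filter fun y => G.graph.Adj y z).card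

open Classical in
/-- The number of common neighbours of `x` and `z` above `x`. -/
noncomputable def upCount (G : WeightedGraph V) (x₀ x z : V) : ℕ :=
  ((G.up x₀ x).filter fun y => G.graph.Adj y z).card

lemma IsCubical.card_commonNbrs (h : G.IsCubical x₀ n) (x z : V) :
    (G.commonNbrs x z).card = G.downCount x₀ x z + G.upCount x₀ x z := by
  classical
  rw [downCount, upCount, ← Finset.card_union_of_disjoint
    (Finset.disjoint_filter_filter (disjoint_down_up x)), ← Finset.filter_union]
  congr 1
  ext y
  rw [mem_commonNbrs, Finset.mem_filter, Finset.mem_union, ← h.mem_nbrs_iff]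

lemma upCount_eq_zero {x z : V} (hz : G.level x₀ z + 2 = G.level x₀ x) (h : G.IsCubical x₀ n) :
    G.upCount x₀ x z = 0 := by
  classical
  rw [upCount, Finset.card_eq_zero, Finset.filter_eq_empty_iff]
  intro y hy hyz
  have := h.level_step _ _ hyz
  have := (mem_up.1 hy).2
  omega

lemma downCount_eq_zero {x z : V} (hz : G.level x₀ z = G.level x₀ x + 2)
    (h : G.IsCubical x₀ n) : G.downCount x₀ x z = 0 := by
  classical
  rw [downCount, Finset.card_eq_zero, Finset.filter_eq_empty_iff]
  intro y hy hyz
  have := h.level_step _ _ hyz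
  have := (mem_down.1 hy).2
  omega

/-- This and the next three sums count two-step paths from `x` by their middle vertex: down-down,
down-up, up-down and up-up. In the two mixed cases the return to `x` is excluded, which removes one
choice in the second step. -/
lemma sum_downCount_down {x : V} {k : ℕ} (hk : G.level x₀ x = k + 2) (h : G.IsCubical x₀ n) :
    ∑ z ∈ G.secondNbrsAt x₀ x k, G.downCount x₀ x z = (k + 2) * (k + 1) := by
  classical
  simp only [downCount]
  rw [sum_card_adj_comm]
  have : ∀ y ∈ G.down x₀ x,
      ((G.secondNbrsAt x₀ x k).filter fun z => G.graph.Adj y z).card = k + 1 := by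
    intro y hy
    obtain ⟨h1, h2⟩ := mem_down.1 hy
    have h3 : (G.secondNbrsAt x₀ x k).filter (fun z => G.graph.Adj y z) = G.down x₀ y := by
      ext z
      rw [Finset.mem_filter, mem_secondNbrsAt, mem_secondNbrs, mem_down]
      constructor
      · rintro ⟨⟨_, h4⟩, h5⟩
        exact ⟨h5, by omega⟩
      · rintro ⟨h4, h5⟩
        refine ⟨⟨⟨?_, y, h1, h4⟩, by omega⟩, h4⟩
        rintro rfl
        omega
    rw [h3, h.card_down]
    omega
  rw [Finset.sum_congr rfl this, Finset.sum_const, h.card_down, hk, smul_eq_mul]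

lemma sum_downCount_level {x : V} {k e : ℕ} (hk : G.level x₀ x = k) (hn : k + e = n)
    (h : G.IsCubical x₀ n) :
    ∑ z ∈ G.secondNbrsAt x₀ x k, G.downCount x₀ x z = k * e := by
  classical
  simp only [downCount]
  rw [sum_card_adj_comm]
  have : ∀ y ∈ G.down x₀ x,
      ((G.secondNbrsAt x₀ x k).filter fun z => G.graph.Adj y z).card = e := by
    intro y hy
    obtain ⟨h1, h2⟩ := mem_down.1 hy
    have h3 : (G.secondNbrsAt x₀ x k).filter (fun z => G.graph.Adj y z) =
        (G.up x₀ y).erase x := by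
      ext z
      rw [Finset.mem_filter, mem_secondNbrsAt, mem_secondNbrs, Finset.mem_erase, mem_up]
      constructor
      · rintro ⟨⟨⟨h3, _⟩, h4⟩, h5⟩
        exact ⟨h3, h5, by omega⟩
      · rintro ⟨h3, h4, h5⟩
        exact ⟨⟨⟨h3, y, h1, h4⟩, by omega⟩, h4⟩
    rw [h3, Finset.card_erase_of_mem (mem_up_iff.2 hy)]
    have := h.card_up y
    omega
  rw [Finset.sum_congr rfl this, Finset.sum_const, h.card_down, hk, smul_eq_mul]

lemma sum_upCount_level {x : V} {k e : ℕ} (hk : G.level x₀ x = k) (hn : k + e = n)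
    (h : G.IsCubical x₀ n) :
    ∑ z ∈ G.secondNbrsAt x₀ x k, G.upCount x₀ x z = k * e := by
  classical
  simp only [upCount]
  rw [sum_card_adj_comm]
  have : ∀ y ∈ G.up x₀ x,
      ((G.secondNbrsAt x₀ x k).filter fun z => G.graph.Adj y z).card = k := by
    intro y hy
    obtain ⟨h1, h2⟩ := mem_up.1 hy
    have h3 : (G.secondNbrsAt x₀ x k).filter (fun z => G.graph.Adj y z) =
        (G.down x₀ y).erase x := by
      ext z
      rw [Finset.mem_filter, mem_secondNbrsAt, mem_secondNbrs, Finset.mem_erase, mem_down]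
      constructor
      · rintro ⟨⟨⟨h3, _⟩, h4⟩, h5⟩
        exact ⟨h3, h5, by omega⟩
      · rintro ⟨h3, h4, h5⟩
        exact ⟨⟨⟨h3, y, h1, h4⟩, by omega⟩, h4⟩
    rw [h3, Finset.card_erase_of_mem (mem_up_iff.1 hy), h.card_down]
    omega
  have h4 := h.card_up x
  rw [Finset.sum_congr rfl this, Finset.sum_const, smul_eq_mul, mul_comm]
  congr 1
  omega

lemma sum_upCount_up {x : V} {k e : ℕ} (hk : G.level x₀ x = k) (hn : k + e = n)
    (h : G.IsCubical x₀ n) :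
    ∑ z ∈ G.secondNbrsAt x₀ x (k + 2), G.upCount x₀ x z = e * (e - 1) := by
  classical
  simp only [upCount]
  rw [sum_card_adj_comm]
  have h4 := h.card_up x
  have : ∀ y ∈ G.up x₀ x,
      ((G.secondNbrsAt x₀ x (k + 2)).filter fun z => G.graph.Adj y z).card = e - 1 := by
    intro y hy
    obtain ⟨h1, h2⟩ := mem_up.1 hy
    have h3 : (G.secondNbrsAt x₀ x (k + 2)).filter (fun z => G.graph.Adj y z) = G.up x₀ y := by
      ext z
      rw [Finset.mem_filter, mem_secondNbrsAt, mem_secondNbrs, mem_up]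
      constructor
      · rintro ⟨⟨_, h4⟩, h5⟩
        exact ⟨h5, by omega⟩
      · rintro ⟨h4, h5⟩
        refine ⟨⟨⟨?_, y, h1, h4⟩, by omega⟩, h4⟩
        rintro rfl
        omega
    have := h.card_up y
    rw [h3]
    omega
  rw [Finset.sum_congr rfl this, Finset.sum_const, smul_eq_mul]
  congr 1
  omega

lemma downCount_le_one {x z : V} (hU : G.UniqueMeet x₀ (G.level x₀ x)) (hne : z ≠ x)
    (hz : G.level x₀ z = G.level x₀ x) : G.downCount x₀ x z ≤ 1 := by
  classical
  rw [downCount, Finset.card_le_one]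
  intro y₁ h₁ y₂ h₂
  rw [Finset.mem_filter] at h₁ h₂
  refine hU x z rfl hne.symm y₁ y₂ h₁.1 ?_ h₂.1 ?_
  · exact mem_down.2 ⟨h₁.2.symm, by rw [hz]; exact (mem_down.1 h₁.1).2⟩
  · exact mem_down.2 ⟨h₂.2.symm, by rw [hz]; exact (mem_down.1 h₂.1).2⟩

/-- Two common upper neighbours of `x` and `z` would themselves share the two lower neighbours `x`
and `z`; hence uniqueness is needed one level higher. -/
lemma upCount_le_one {x z : V} (hU : G.UniqueMeet x₀ (G.level x₀ x + 1)) (hne : z ≠ x)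
    (hz : G.level x₀ z = G.level x₀ x) : G.upCount x₀ x z ≤ 1 := by
  classical
  rw [upCount, Finset.card_le_one]
  intro y₁ h₁ y₂ h₂
  rw [Finset.mem_filter] at h₁ h₂
  by_contra hy
  have key : ∀ y, y ∈ G.up x₀ x → G.graph.Adj y z → z ∈ G.down x₀ y := fun y h3 h4 =>
    mem_down.2 ⟨h4, by rw [hz]; exact (mem_up.1 h3).2.symm⟩
  exact hne (hU y₁ y₂ (mem_up.1 h₁.1).2 hy z x (key _ h₁.1 h₁.2) (key _ h₂.1 h₂.2)
    (mem_up_iff.1 h₁.1) (mem_up_iff.1 h₂.1))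

-- Two steps change the level by `-2`, `0` or `2`. Writing the lowest part as `level + 2 = k` makes
-- it empty for `k < 2`, without truncated subtraction.
open Classical in
lemma IsCubical.card_secondNbrs (h : G.IsCubical x₀ n) {x : V} {k : ℕ}
    (hk : G.level x₀ x = k) : (G.secondNbrs x).card =
      (((G.secondNbrs x).filter fun z => G.level x₀ z + 2 = k).card +
        (G.secondNbrsAt x₀ x k).card) + (G.secondNbrsAt x₀ x (k + 2)).card := by
  rw [secondNbrsAt, secondNbrsAt, ← Finset.card_union_of_disjoint,
    ← Finset.card_union_of_disjoint]
  · congr 1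
    ext z
    simp only [Finset.mem_union, Finset.mem_filter]
    constructor
    · intro hz
      have := h.level_of_mem_secondNbrs hz
      rw [hk] at this
      tauto
    · tauto
  · rw [Finset.disjoint_left]
    intro z
    simp only [Finset.mem_union, Finset.mem_filter]
    omega
  · rw [Finset.disjoint_left]
    intro z
    simp only [Finset.mem_filter]
    omega

end Parts

end WeightedGraph

/-! ### Two common neighbours for every pair at distance two. -/

namespace WeightedGraph

variable {V : Type*} {G : WeightedGraph V} {x₀ : V} {n : ℕ}

/-- Every vertex of level `k` has exactly two common neighbours with each vertex at distance two. -/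
def TwoMeets (G : WeightedGraph V) (x₀ : V) (k : ℕ) : Prop :=
  ∀ x, G.level x₀ x = k → ∀ z ∈ G.secondNbrs x, (G.commonNbrs x z).card = 2

/-- Two vertices with a common neighbour one level higher have a common neighbour one level
lower. -/
def HasMeet (G : WeightedGraph V) (x₀ : V) (k : ℕ) : Prop :=
  ∀ z, G.level x₀ z = k → ∀ y₁ ∈ G.down x₀ z, ∀ y₂ ∈ G.down x₀ z, y₁ ≠ y₂ →
    ∃ x, x ∈ G.down x₀ y₁ ∧ x ∈ G.down x₀ y₂

lemma IsCubical.upCount_eq (h : G.IsCubical x₀ n) {x z : V}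
    (hz : G.level x₀ z = G.level x₀ x + 2) : G.upCount x₀ x z = (G.commonNbrs x z).card := by
  rw [h.card_commonNbrs, downCount_eq_zero hz h, zero_add]

lemma IsCubical.downCount_eq (h : G.IsCubical x₀ n) {x z : V}
    (hz : G.level x₀ z = G.level x₀ x + 2) : G.downCount x₀ z x = (G.commonNbrs x z).card := by
  rw [commonNbrs_comm, h.card_commonNbrs, upCount_eq_zero hz.symm h, add_zero]

-- Double counting of triples consisting of `x` and an ordered pair of distinct vertices of `down z`
-- that are both adjacent to `x`. It is the second-moment identity for the number of common
-- neighbours.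
open Classical in
lemma sum_offDiag_downCount (z : V) (k : ℕ) :
    ∑ x ∈ G.secondNbrsAt x₀ z k, G.downCount x₀ z x * (G.downCount x₀ z x - 1) =
      ∑ p ∈ (G.down x₀ z).offDiag, ((G.secondNbrsAt x₀ z k).filter fun x =>
        G.graph.Adj p.1 x ∧ G.graph.Adj p.2 x).card := by
  have h1 : ∀ x ∈ G.secondNbrsAt x₀ z k, G.downCount x₀ z x * (G.downCount x₀ z x - 1) =
      ((G.down x₀ z).offDiag.filter fun p => G.graph.Adj p.1 x ∧ G.graph.Adj p.2 x).card := by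
    intro x _
    rw [downCount, Nat.mul_sub_one, ← Finset.offDiag_card]
    congr 1
    ext p
    simp only [Finset.mem_offDiag, Finset.mem_filter]
    tauto
  rw [Finset.sum_congr rfl h1]
  exact (Finset.sum_card_bipartiteAbove_eq_sum_card_bipartiteBelow
    fun (p : V × V) x => G.graph.Adj p.1 x ∧ G.graph.Adj p.2 x).symm

lemma mem_down_of_adj {z x y : V} {k : ℕ}
    (hz : G.level x₀ z = k + 2) (hx : G.level x₀ x = k) (hy : y ∈ G.down x₀ z)
    (hyx : G.graph.Adj y x) : x ∈ G.down x₀ y := by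
  have := (mem_down.1 hy).2
  exact mem_down.2 ⟨hyx, by omega⟩

open Classical in
lemma card_filter_adj_pair_le_one {k : ℕ} (hU : G.UniqueMeet x₀ (k + 1))
    {z : V} (hz : G.level x₀ z = k + 2) {p : V × V} (hp : p ∈ (G.down x₀ z).offDiag) :
    ((G.secondNbrsAt x₀ z k).filter fun x =>
        G.graph.Adj p.1 x ∧ G.graph.Adj p.2 x).card ≤ 1 := by
  rw [Finset.mem_offDiag] at hp
  obtain ⟨h1, h2, h3⟩ := hp
  rw [Finset.card_le_one]
  intro x hx x' hx'
  rw [Finset.mem_filter, mem_secondNbrsAt] at hx hx'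
  have hp1 := (mem_down.1 h1).2
  exact hU p.1 p.2 (by omega) h3 x x' (mem_down_of_adj hz hx.1.2 h1 hx.2.1)
    (mem_down_of_adj hz hx.1.2 h2 hx.2.2) (mem_down_of_adj hz hx'.1.2 h1 hx'.2.1)
    (mem_down_of_adj hz hx'.1.2 h2 hx'.2.2)

lemma sum_downCount_mul_le (h : G.IsCubical x₀ n) {k : ℕ} (hU : G.UniqueMeet x₀ (k + 1))
    {z : V} (hz : G.level x₀ z = k + 2) :
    ∑ x ∈ G.secondNbrsAt x₀ z k, G.downCount x₀ z x * (G.downCount x₀ z x - 1) ≤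
      (k + 2) * (k + 1) := by
  classical
  rw [sum_offDiag_downCount]
  refine (Finset.sum_le_card_nsmul _ _ 1 fun p hp =>
    card_filter_adj_pair_le_one hU hz hp).trans ?_
  rw [Finset.offDiag_card, h.card_down, hz, smul_eq_mul, mul_one, ← Nat.mul_sub_one]
  simp

/-- If every count is two, then `c * (c - 1) = c`, so the number of triples equals the number of
ordered pairs below `z`. Each pair has at most one common lower neighbour, hence exactly one. -/
lemma hasMeet_of_downCount_eq_two (h : G.IsCubical x₀ n) {k : ℕ}
    (hU : G.UniqueMeet x₀ (k + 1))
    (h2 : ∀ z, G.level x₀ z = k + 2 → ∀ x ∈ G.secondNbrsAt x₀ z k, G.downCount x₀ z x = 2) :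
    G.HasMeet x₀ (k + 2) := by
  classical
  intro z hz y₁ hy₁ y₂ hy₂ hne
  have h3 : ∑ x ∈ G.secondNbrsAt x₀ z k, G.downCount x₀ z x * (G.downCount x₀ z x - 1) =
      (k + 2) * (k + 1) := by
    rw [← sum_downCount_down hz h]
    refine Finset.sum_congr rfl fun x hx => ?_
    rw [h2 z hz x hx]
  have h4 : ∑ p ∈ (G.down x₀ z).offDiag, 1 = (k + 2) * (k + 1) := by
    rw [Finset.sum_const, Finset.offDiag_card, h.card_down, hz, smul_eq_mul, mul_one,
      ← Nat.mul_sub_one]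
    simp
  rw [sum_offDiag_downCount, ← h4, Finset.sum_eq_sum_iff_of_le fun p hp =>
    card_filter_adj_pair_le_one hU hz hp] at h3
  have h5 := h3 (y₁, y₂) (Finset.mem_offDiag.2 ⟨hy₁, hy₂, hne⟩)
  obtain ⟨x, hx⟩ := Finset.card_pos.1 (h5 ▸ one_pos)
  rw [Finset.mem_filter, mem_secondNbrsAt] at hx
  exact ⟨x, mem_down_of_adj hz hx.1.2 hy₁ hx.2.1, mem_down_of_adj hz hx.1.2 hy₂ hx.2.2⟩

open Classical in
lemma two_mul_card_secondNbrs_down (h : G.IsCubical x₀ n) {k : ℕ}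
    (hT : ∀ j, j + 2 = k → G.TwoMeets x₀ j) {x : V} (hx : G.level x₀ x = k) :
    2 * ((G.secondNbrs x).filter fun z => G.level x₀ z + 2 = k).card = k * (k - 1) := by
  match k, hT, hx with
  | 0, _, _ => simp
  | 1, _, _ => simp
  | k + 2, hT, hx =>
    have h1 : (G.secondNbrs x).filter (fun z => G.level x₀ z + 2 = k + 2) =
        G.secondNbrsAt x₀ x k := by
      ext z
      simp [mem_secondNbrsAt]
    rw [h1, mul_comm, ← smul_eq_mul, ← Finset.sum_const]
    have h2 := sum_downCount_down hx h
    rw [Nat.add_succ_sub_one, ← h2]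
    refine Finset.sum_congr rfl fun z hz => ?_
    rw [mem_secondNbrsAt] at hz
    rw [h.downCount_eq (by omega), hT k rfl z hz.2 x (mem_secondNbrs_comm.1 hz.1)]

lemma le_card_secondNbrsAt_level (h : G.IsCubical x₀ n) {k e : ℕ} (hU : G.UniqueMeet x₀ k)
    (hn : k + e = n) {x : V} (hx : G.level x₀ x = k) :
    k * e ≤ (G.secondNbrsAt x₀ x k).card := by
  rw [← sum_downCount_level hx hn h, ← mul_one (Finset.card _), ← smul_eq_mul,
    ← Finset.sum_const]
  refine Finset.sum_le_sum fun z hz => ?_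
  rw [mem_secondNbrsAt] at hz
  exact downCount_le_one (hx ▸ hU) (mem_secondNbrs.1 hz.1).1 (hz.2.trans hx.symm)

lemma two_mul_choose_two (k e : ℕ) :
    2 * (k + e).choose 2 = k * (k - 1) + 2 * (k * e) + e * (e - 1) := by
  have h1 : ∀ m : ℕ, ((m * (m - 1) : ℕ) : ℤ) = m * (m - 1) := fun m => by
    cases m <;> simp
  have h2 : 2 * (k + e).choose 2 = (k + e) * (k + e - 1) := by
    rw [Nat.choose_two_right, Nat.mul_div_cancel' (Nat.even_mul_pred_self _).two_dvd]
  rw [h2]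
  zify
  have := h1 (k + e)
  have h3 := h1 k
  have h4 := h1 e
  push_cast at this h3 h4
  rw [this, h3, h4]
  ring

/-- Twice the (SSP) bound is `k * (k - 1) + 2 * (k * e) + e * (e - 1)`. The downward part uses
exactly the first summand and the level part at least the second. -/
lemma two_mul_card_secondNbrs_up_le (h : G.IsCubical x₀ n) {k e : ℕ} (hU : G.UniqueMeet x₀ k)
    (hT : ∀ j, j + 2 = k → G.TwoMeets x₀ j) (hn : k + e = n) {x : V}
    (hx : G.level x₀ x = k) : 2 * (G.secondNbrsAt x₀ x (k + 2)).card ≤ e * (e - 1) := by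
  have h1 := h.ssp x
  rw [h.card_secondNbrs hx] at h1
  have h2 := two_mul_card_secondNbrs_down h hT hx
  have h3 := le_card_secondNbrsAt_level h hU hn hx
  have h4 := two_mul_choose_two k e
  rw [hn] at h4
  omega

/-- Let `c` be the number of common neighbours of a pair on levels `k` and `k + 2`. Summing from
below, (SSP) makes the average of `c` at least two; summing from above, unique meets give `∑ c² ≤ 2
∑ c`. Together `∑ (c - 2)² ≤ 0`. -/
lemma upCount_eq_two [Fintype V] (h : G.IsCubical x₀ n) {k : ℕ} (hU : G.UniqueMeet x₀ k)
    (hU' : G.UniqueMeet x₀ (k + 1)) (hT : ∀ j, j + 2 = k → G.TwoMeets x₀ j) {x z : V}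
    (hx : G.level x₀ x = k) (hz : z ∈ G.secondNbrsAt x₀ x (k + 2)) :
    G.upCount x₀ x z = 2 := by
  classical
  obtain ⟨e, hn⟩ : ∃ e, k + e = n := ⟨_, hx ▸ h.card_up x⟩
  set X := (Finset.univ : Finset V).filter fun x => G.level x₀ x = k with hX
  set Z := (Finset.univ : Finset V).filter fun z => G.level x₀ z = k + 2 with hZ
  have comm : ∀ F : V → V → ℤ, ∑ x ∈ X, ∑ z ∈ G.secondNbrsAt x₀ x (k + 2), F x z =
      ∑ z ∈ Z, ∑ x ∈ G.secondNbrsAt x₀ z k, F x z := fun F =>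
    Finset.sum_comm' fun x z => by
      simp only [hX, hZ, Finset.mem_filter, Finset.mem_univ, true_and, mem_secondNbrsAt,
        mem_secondNbrs_comm (x := x)]
      tauto
  set c : V → V → ℤ := fun x z => (G.upCount x₀ x z : ℤ) with hc
  have e1 : ∑ x ∈ X, ∑ z ∈ G.secondNbrsAt x₀ x (k + 2), 2 * (2 : ℤ) ≤
      2 * ∑ x ∈ X, ∑ z ∈ G.secondNbrsAt x₀ x (k + 2), c x z := by
    rw [Finset.mul_sum]
    refine Finset.sum_le_sum fun x hx => ?_
    rw [hX, Finset.mem_filter] at hx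
    have h1 := two_mul_card_secondNbrs_up_le h hU hT hn hx.2
    rw [← sum_upCount_up hx.2 hn h] at h1
    rw [Finset.sum_const, nsmul_eq_mul]
    have h2 : (2 * (G.secondNbrsAt x₀ x (k + 2)).card : ℤ) ≤
        ∑ z ∈ G.secondNbrsAt x₀ x (k + 2), c x z := by
      simp only [hc]
      exact_mod_cast h1
    linarith
  have e2 : ∑ x ∈ X, ∑ z ∈ G.secondNbrsAt x₀ x (k + 2), c x z ^ 2 ≤
      2 * ∑ x ∈ X, ∑ z ∈ G.secondNbrsAt x₀ x (k + 2), c x z := by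
    rw [comm, comm, Finset.mul_sum]
    refine Finset.sum_le_sum fun z hz => ?_
    rw [hZ, Finset.mem_filter] at hz
    have h1 := sum_downCount_mul_le h hU' hz.2
    rw [← sum_downCount_down hz.2 h] at h1
    have h2 : ∀ x ∈ G.secondNbrsAt x₀ z k, c x z = (G.downCount x₀ z x : ℤ) := fun x hx => by
      rw [mem_secondNbrsAt] at hx
      simp only [hc]
      rw [h.upCount_eq (by omega), h.downCount_eq (by omega)]
    rw [Finset.sum_congr rfl h2, Finset.sum_congr rfl fun x hx => by rw [h2 x hx]]
    have h3 : ∀ m : ℕ, ((m * (m - 1) : ℕ) : ℤ) = (m : ℤ) ^ 2 - m := fun m => by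
      cases m
      · simp
      · push_cast
        ring
    have h4 : ((∑ x ∈ G.secondNbrsAt x₀ z k,
        G.downCount x₀ z x * (G.downCount x₀ z x - 1) : ℕ) : ℤ) ≤
        ((∑ x ∈ G.secondNbrsAt x₀ z k, G.downCount x₀ z x : ℕ) : ℤ) := by exact_mod_cast h1
    rw [Nat.cast_sum, Nat.cast_sum, Finset.sum_congr rfl fun x _ => h3 _,
      Finset.sum_sub_distrib] at h4
    linarith
  have e3 : ∑ x ∈ X, ∑ z ∈ G.secondNbrsAt x₀ x (k + 2), (c x z - 2) ^ 2 ≤ 0 := by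
    have : ∑ x ∈ X, ∑ z ∈ G.secondNbrsAt x₀ x (k + 2), (c x z - 2) ^ 2 =
        ∑ x ∈ X, ∑ z ∈ G.secondNbrsAt x₀ x (k + 2), c x z ^ 2 -
        4 * ∑ x ∈ X, ∑ z ∈ G.secondNbrsAt x₀ x (k + 2), c x z +
        ∑ x ∈ X, ∑ z ∈ G.secondNbrsAt x₀ x (k + 2), 2 * (2 : ℤ) := by
      simp only [Finset.mul_sum, ← Finset.sum_sub_distrib, ← Finset.sum_add_distrib]
      exact Finset.sum_congr rfl fun x _ => Finset.sum_congr rfl fun z _ => by ring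
    linarith
  have hnn : ∀ x ∈ X, 0 ≤ ∑ z ∈ G.secondNbrsAt x₀ x (k + 2), (c x z - 2) ^ 2 := fun x _ =>
    Finset.sum_nonneg fun z _ => sq_nonneg _
  have h1 := (Finset.sum_eq_zero_iff_of_nonneg hnn).1
    (le_antisymm e3 (Finset.sum_nonneg hnn)) x (by simpa [hX] using hx)
  have h2 := (Finset.sum_eq_zero_iff_of_nonneg fun z _ => sq_nonneg _).1 h1 z hz
  have h3 := pow_eq_zero_iff two_ne_zero |>.1 h2
  simp only [hc] at h3
  omega

/-- For a lower `z` use symmetry and the induction hypothesis; for a higher one use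
`upCount_eq_two`. That lemma also makes the upward part as large as allowed, so (SSP) leaves at most
`k * e` vertices on the level of `x`; then the counts below and above, each at most one with sum `k
* e`, are all one. -/
lemma twoMeets_of_uniqueMeet [Fintype V] (h : G.IsCubical x₀ n) {k : ℕ}
    (hU : G.UniqueMeet x₀ k) (hU' : G.UniqueMeet x₀ (k + 1))
    (hT : ∀ j, j + 2 = k → G.TwoMeets x₀ j) : G.TwoMeets x₀ k := by
  intro x hx z hz
  obtain ⟨e, hn⟩ : ∃ e, k + e = n := ⟨_, hx ▸ h.card_up x⟩
  rcases h.level_of_mem_secondNbrs hz with h1 | h1 | h1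
  · rw [commonNbrs_comm]
    exact hT (G.level x₀ z) (h1.trans hx) z rfl x (mem_secondNbrs_comm.1 hz)
  · have hle : (G.secondNbrsAt x₀ x k).card ≤ k * e := by
      have h2 := two_mul_card_secondNbrs_down h hT hx
      have h3 : 2 * (G.secondNbrsAt x₀ x (k + 2)).card = e * (e - 1) := by
        rw [← sum_upCount_up hx hn h, mul_comm, ← smul_eq_mul, ← Finset.sum_const]
        exact Finset.sum_congr rfl fun z hz => (upCount_eq_two h hU hU' hT hx hz).symm
      have h4 := two_mul_choose_two k e
      have h5 := h.ssp x
      rw [h.card_secondNbrs hx] at h5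
      rw [hn] at h4
      omega
    have hcard : (G.secondNbrsAt x₀ x k).card = k * e :=
      le_antisymm hle (le_card_secondNbrsAt_level h hU hn hx)
    have hzk : z ∈ G.secondNbrsAt x₀ x k := mem_secondNbrsAt.2 ⟨hz, h1.trans hx⟩
    have hone : ∑ z ∈ G.secondNbrsAt x₀ x k, 1 = k * e := by simpa using hcard
    have hd : G.downCount x₀ x z = 1 := by
      refine (Finset.sum_eq_sum_iff_of_le fun z hz => ?_).1
        ((sum_downCount_level hx hn h).trans hone.symm) z hzk
      rw [mem_secondNbrsAt] at hz
      exact downCount_le_one (hx ▸ hU) (mem_secondNbrs.1 hz.1).1 (hz.2.trans hx.symm)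
    have hu : G.upCount x₀ x z = 1 := by
      refine (Finset.sum_eq_sum_iff_of_le fun z hz => ?_).1
        ((sum_upCount_level hx hn h).trans hone.symm) z hzk
      rw [mem_secondNbrsAt] at hz
      exact upCount_le_one (hx ▸ hU') (mem_secondNbrs.1 hz.1).1 (hz.2.trans hx.symm)
    rw [h.card_commonNbrs, hd, hu]
  · rw [← h.upCount_eq h1]
    exact upCount_eq_two h hU hU' hT hx (mem_secondNbrsAt.2 ⟨hz, by omega⟩)

/-- If `z ≠ z'` shared two lower neighbours, these would have a common lower neighbour `x`, and
(NCP) at `x` would identify `z` and `z'`; its premise is the two-meet property just proved. -/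
lemma meets_step [Fintype V] (h : G.IsCubical x₀ n) {k : ℕ}
    (hU : G.UniqueMeet x₀ k) (hU' : G.UniqueMeet x₀ (k + 1))
    (hT : ∀ j, j + 2 = k → G.TwoMeets x₀ j) :
    G.TwoMeets x₀ k ∧ G.HasMeet x₀ (k + 2) ∧ G.UniqueMeet x₀ (k + 2) := by
  have hk := twoMeets_of_uniqueMeet h hU hU' hT
  have hm : G.HasMeet x₀ (k + 2) := by
    refine hasMeet_of_downCount_eq_two h hU' fun z hz x hx => ?_
    rw [mem_secondNbrsAt] at hx
    rw [h.downCount_eq (by omega)]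
    exact hk x hx.2 z (mem_secondNbrs_comm.1 hx.1)
  refine ⟨hk, hm, fun z z' hz hne y₁ y₂ h1 h1' h2 h2' => ?_⟩
  by_contra hy
  obtain ⟨x, hx1, hx2⟩ := hm z hz y₁ h1 y₂ h2 hy
  rw [mem_down] at hx1 hx2 h1 h2 h1' h2'
  refine hne (h.ncp x (hk x (by omega)) y₁ y₂ z z' hx1.1.symm hx2.1.symm hy ?_ ?_ h1.1.symm
    h2.1.symm h1'.1.symm h2'.1.symm)
  · refine mem_secondNbrs.2 ⟨?_, y₁, hx1.1.symm, h1.1.symm⟩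
    rintro rfl
    omega
  · refine mem_secondNbrs.2 ⟨?_, y₁, hx1.1.symm, h1'.1.symm⟩
    rintro rfl
    omega

theorem IsCubical.meets [Fintype V] (hc : G.graph.Connected) (h : G.IsCubical x₀ n) (k : ℕ) :
    G.TwoMeets x₀ k ∧ G.HasMeet x₀ (k + 2) ∧ G.UniqueMeet x₀ k ∧ G.UniqueMeet x₀ (k + 1) := by
  induction k using Nat.strong_induction_on with
  | _ k ih =>
    have hU : G.UniqueMeet x₀ k ∧ G.UniqueMeet x₀ (k + 1) := by
      match k, ih with
      | 0, _ =>
        constructor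
        · intro z z' hz _ y₁ _ h1
          have := (mem_down.1 h1).2
          omega
        · intro z z' hz _ y₁ y₂ h1 _ h2 _
          have h3 := (mem_down.1 h1).2
          have h4 := (mem_down.1 h2).2
          have h5 : G.level x₀ y₁ = 0 := by omega
          have h6 : G.level x₀ y₂ = 0 := by omega
          rw [level, hc.dist_eq_zero_iff] at h5 h6
          rw [h5, h6]
      | k + 1, ih =>
        have h1 := ih k (Nat.lt_succ_self k)
        exact ⟨h1.2.2.2, (meets_step h h1.2.2.1 h1.2.2.2
          fun j hj => (ih j (by omega)).1).2.2⟩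
    have h2 := meets_step h hU.1 hU.2 fun j hj => (ih j (by omega)).1
    exact ⟨h2.1, h2.2.1, hU.1, hU.2⟩

end WeightedGraph

/-! ### Labelling vertices by subsets of the neighbours of the root. -/

namespace WeightedGraph

variable {V : Type*} {G : WeightedGraph V} {x₀ : V} {n : ℕ}

open Classical in
/-- The neighbours of the root that lie on a geodesic from the root to `v`. -/
noncomputable def label (G : WeightedGraph V) (x₀ v : V) : Finset V :=
  (G.nbrs x₀).filter fun y => G.graph.dist v y + 1 = G.level x₀ v

lemma mem_label {v y : V} :
    y ∈ G.label x₀ v ↔ G.graph.Adj x₀ y ∧ G.graph.dist v y + 1 = G.level x₀ v := by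
  simp [label, mem_nbrs]

lemma level_le_of_adj {v y : V} (h : G.graph.Adj x₀ y) :
    G.level x₀ v ≤ G.graph.dist v y + 1 := by
  have := h.symm.reachable.dist_triangle_right v
  rwa [SimpleGraph.dist_eq_one_iff_adj.2 h.symm] at this

lemma label_subset_of_mem_down {u v : V} (h : u ∈ G.down x₀ v) :
    G.label x₀ u ⊆ G.label x₀ v := by
  intro y hy
  rw [mem_label] at hy ⊢
  rw [mem_down] at h
  have h1 := level_le_of_adj (v := v) hy.1
  have h2 := h.1.reachable.dist_triangle_left y
  rw [SimpleGraph.dist_eq_one_iff_adj.2 h.1] at h2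
  exact ⟨hy.1, by omega⟩

lemma exists_mem_down_of_mem_label (hc : G.graph.Connected) {v y : V}
    (hv : 2 ≤ G.level x₀ v) (hy : y ∈ G.label x₀ v) :
    ∃ u ∈ G.down x₀ v, y ∈ G.label x₀ u := by
  rw [mem_label] at hy
  obtain ⟨p, hp⟩ := hc.exists_walk_length_eq_dist v y
  cases p with
  | nil =>
    rw [SimpleGraph.dist_self] at hy
    omega
  | @cons _ u _ hadj q =>
    have h1 := SimpleGraph.dist_le q
    rw [SimpleGraph.Walk.length_cons] at hp
    have h2 := level_le_of_adj (v := u) hy.1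
    have h3 := hadj.reachable.dist_triangle_left x₀
    rw [SimpleGraph.dist_eq_one_iff_adj.2 hadj] at h3
    change G.level x₀ v ≤ 1 + G.level x₀ u at h3
    exact ⟨u, mem_down.2 ⟨hadj, by omega⟩, mem_label.2 ⟨hy.1, by omega⟩⟩

/-- On the level `k`, the labels are distinct sets of size `k`. -/
def LabelsFaithful (G : WeightedGraph V) (x₀ : V) (k : ℕ) : Prop :=
  (∀ v, G.level x₀ v = k → (G.label x₀ v).card = k) ∧
    ∀ v v', G.level x₀ v = k → G.level x₀ v' = k → G.label x₀ v = G.label x₀ v' → v = v'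

/-- The `k + 1` lower neighbours have distinct labels among the `k + 1` subsets of size `k`, so all
of these occur. -/
lemma exists_mem_down_label_eq (h : G.IsCubical x₀ n) {k : ℕ} (hk : G.LabelsFaithful x₀ k)
    {v : V} (hv : G.level x₀ v = k + 1) (hcard : (G.label x₀ v).card = k + 1) {T : Finset V}
    (hT : T ⊆ G.label x₀ v) (hTk : T.card = k) : ∃ u ∈ G.down x₀ v, G.label x₀ u = T := by
  classical
  have hlev : ∀ u ∈ G.down x₀ v, G.level x₀ u = k := fun u hu => by
    have := (mem_down.1 hu).2
    omega
  have h1 : (G.down x₀ v).image (G.label x₀) = (G.label x₀ v).powersetCard k := by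
    refine Finset.eq_of_subset_of_card_le (fun S hS => ?_) ?_
    · obtain ⟨u, hu, rfl⟩ := Finset.mem_image.1 hS
      exact Finset.mem_powersetCard.2 ⟨label_subset_of_mem_down hu, hk.1 u (hlev u hu)⟩
    · rw [Finset.card_powersetCard, hcard, Finset.card_image_of_injOn, h.card_down, hv]
      · simp
      · exact fun u hu u' hu' huu => hk.2 u u' (hlev u hu) (hlev u' hu') huu
  exact Finset.mem_image.1 (h1 ▸ Finset.mem_powersetCard.2 ⟨hT, hTk⟩)

/-- At most one neighbour below `v` misses a given element of the label of `v`. -/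
lemma eq_of_notMem_label {k : ℕ} (hk : G.LabelsFaithful x₀ k) {v : V}
    (hv : G.level x₀ v = k + 1) (hcard : (G.label x₀ v).card = k + 1) {y : V}
    (hy : y ∈ G.label x₀ v) {u u' : V} (hu : u ∈ G.down x₀ v) (hu' : u' ∈ G.down x₀ v)
    (hyu : y ∉ G.label x₀ u) (hyu' : y ∉ G.label x₀ u') : u = u' := by
  classical
  have key : ∀ w ∈ G.down x₀ v, y ∉ G.label x₀ w →
      G.level x₀ w = k ∧ G.label x₀ w = (G.label x₀ v).erase y := by
    intro w hw hyw
    have h1 : G.level x₀ w = k := by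
      have := (mem_down.1 hw).2
      omega
    refine ⟨h1, Finset.eq_of_subset_of_card_le
      (Finset.subset_erase.2 ⟨label_subset_of_mem_down hw, hyw⟩) ?_⟩
    rw [Finset.card_erase_of_mem hy, hcard, hk.1 w h1]
    simp
  have h1 := key u hu hyu
  have h2 := key u' hu' hyu'
  exact hk.2 u u' h1.1 h2.1 (h1.2.trans h2.2.symm)

/-- Upper bound: each element is missed by at most one of the `k + 2` labels below `w`, so counting
incidences gives `#label * (k + 1) ≤ (k + 2) * (k + 1)`. Lower bound: a smaller label would coincide
with the labels of two different lower neighbours. -/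
lemma card_label_succ (hc : G.graph.Connected) (h : G.IsCubical x₀ n) {k : ℕ}
    (hk : G.LabelsFaithful x₀ k) (hk' : G.LabelsFaithful x₀ (k + 1)) (hT : G.TwoMeets x₀ k)
    (hM : G.HasMeet x₀ (k + 2)) {w : V} (hw : G.level x₀ w = k + 2) :
    (G.label x₀ w).card = k + 2 := by
  classical
  have hlev : ∀ u ∈ G.down x₀ w, G.level x₀ u = k + 1 := fun u hu => by
    have := (mem_down.1 hu).2
    omega
  have hmiss : ∀ y ∈ G.label x₀ w,
      ((G.down x₀ w).filter fun v => y ∉ G.label x₀ v).card ≤ 1 := by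
    intro y hy
    -- If `v₁ ≠ v₂` both miss `y` and `v` has it, the meets of `v` with `v₁` and with `v₂` miss `y`
    -- as well, so they coincide. This vertex and `w` then have three common neighbours.
    obtain ⟨v, hv, hyv⟩ := exists_mem_down_of_mem_label hc (by omega) hy
    rw [Finset.card_le_one]
    intro v₁ h1 v₂ h2
    rw [Finset.mem_filter] at h1 h2
    by_contra hne
    have hv1 : v ≠ v₁ := fun e => h1.2 (e ▸ hyv)
    have hv2 : v ≠ v₂ := fun e => h2.2 (e ▸ hyv)
    obtain ⟨u₁, a1, b1⟩ := hM w hw v hv v₁ h1.1 hv1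
    obtain ⟨u₂, a2, b2⟩ := hM w hw v hv v₂ h2.1 hv2
    have hu : u₁ = u₂ := eq_of_notMem_label hk (hlev v hv) (hk'.1 v (hlev v hv)) hyv a1 a2
      (fun e => h1.2 (label_subset_of_mem_down b1 e))
      (fun e => h2.2 (label_subset_of_mem_down b2 e))
    subst hu
    have hlv := hlev v hv
    have hul : G.level x₀ u₁ = k := by
      have := (mem_down.1 a1).2
      omega
    have hwu : w ∈ G.secondNbrs u₁ := by
      refine mem_secondNbrs.2 ⟨?_, v, (mem_down.1 a1).1.symm, (mem_down.1 hv).1.symm⟩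
      rintro rfl
      omega
    have h3 := hT u₁ hul w hwu
    have h4 : ({v, v₁, v₂} : Finset V) ⊆ G.commonNbrs u₁ w := by
      intro z hz
      rw [mem_commonNbrs]
      simp only [Finset.mem_insert, Finset.mem_singleton] at hz
      rcases hz with rfl | rfl | rfl
      · exact ⟨(mem_down.1 a1).1.symm, (mem_down.1 hv).1.symm⟩
      · exact ⟨(mem_down.1 b1).1.symm, (mem_down.1 h1.1).1.symm⟩
      · exact ⟨(mem_down.1 b2).1.symm, (mem_down.1 h2.1).1.symm⟩
    have h5 := Finset.card_le_card h4
    rw [h3, Finset.card_eq_three.2 ⟨v, v₁, v₂, hv1, hv2, hne, rfl⟩] at h5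
    omega
  have hle : (G.label x₀ w).card ≤ k + 2 := by
    have h1 : ∑ v ∈ G.down x₀ w, ((G.label x₀ w).filter fun y => y ∈ G.label x₀ v).card =
        (k + 2) * (k + 1) := by
      rw [← hw, ← h.card_down w, ← smul_eq_mul, ← Finset.sum_const]
      refine Finset.sum_congr rfl fun v hv => ?_
      rw [← hk'.1 v (hlev v hv)]
      congr 1
      ext y
      rw [Finset.mem_filter]
      exact ⟨fun e => e.2, fun e => ⟨label_subset_of_mem_down hv e, e⟩⟩
    have h1 := (Finset.sum_card_bipartiteAbove_eq_sum_card_bipartiteBelow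
      (s := G.down x₀ w) (t := G.label x₀ w) (fun v y => y ∈ G.label x₀ v)).symm.trans h1
    have h2 : (G.label x₀ w).card * (k + 1) ≤ (k + 2) * (k + 1) := by
      rw [← h1, ← smul_eq_mul, ← Finset.sum_const]
      refine Finset.sum_le_sum fun y hy => ?_
      have h3 := Finset.card_filter_add_card_filter_not (s := G.down x₀ w)
        (fun v => y ∈ G.label x₀ v)
      have h4 := hmiss y hy
      rw [h.card_down, hw] at h3
      simp only [Finset.bipartiteBelow]
      omega
    exact Nat.le_of_mul_le_mul_right h2 (Nat.succ_pos k)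
  refine le_antisymm hle ?_
  have h1 : 1 < (G.down x₀ w).card := by
    rw [h.card_down]
    omega
  obtain ⟨v, hv, v', hv', hne⟩ := Finset.one_lt_card.1 h1
  by_contra hlt
  rw [not_le] at hlt
  have key : ∀ u ∈ G.down x₀ w, G.label x₀ u = G.label x₀ w := fun u hu =>
    Finset.eq_of_subset_of_card_le (label_subset_of_mem_down hu) (by
      rw [hk'.1 u (hlev u hu)]
      omega)
  exact hne (hk'.2 v v' (hlev v hv) (hlev v' hv') ((key v hv).trans (key v' hv').symm))

/-- For injectivity, suppose `w` and `w'` have equal labels. Removing one element gives the label of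
a lower neighbour of each, and faithfulness one level lower makes it the same vertex. Two removed
elements give two common lower neighbours, against unique meets. -/
theorem IsCubical.labelsFaithful [Fintype V] (hc : G.graph.Connected) (h : G.IsCubical x₀ n)
    (k : ℕ) : G.LabelsFaithful x₀ k ∧ G.LabelsFaithful x₀ (k + 1) := by
  classical
  induction k with
  | zero =>
    constructor
    · constructor
      · intro v hv
        rw [Finset.card_eq_zero, Finset.eq_empty_iff_forall_notMem]
        intro y hy
        have := (mem_label.1 hy).2
        omega
      · intro v v' hv hv' _
        rw [level, hc.dist_eq_zero_iff] at hv hv'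
        rw [hv, hv']
    · have key : ∀ v, G.level x₀ v = 0 + 1 → G.label x₀ v = {v} := by
        intro v hv
        ext y
        rw [mem_label, hv, Finset.mem_singleton, Nat.add_right_cancel_iff, hc.dist_eq_zero_iff]
        constructor
        · exact fun e => e.2.symm
        · rintro rfl
          exact ⟨(SimpleGraph.dist_eq_one_iff_adj.1 hv).symm, rfl⟩
      refine ⟨fun v hv => by rw [key v hv]; simp, fun v v' hv hv' e => ?_⟩
      rw [key v hv, key v' hv'] at e
      exact Finset.singleton_inj.1 e
  | succ k ih =>
    obtain ⟨hk, hk'⟩ := ih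
    have hm := h.meets hc k
    have hcard : ∀ w, G.level x₀ w = k + 2 → (G.label x₀ w).card = k + 2 := fun w hw =>
      card_label_succ hc h hk hk' hm.1 hm.2.1 hw
    refine ⟨hk', hcard, fun w w' hw hw' e => ?_⟩
    by_contra hne
    have h2 : 1 < (G.label x₀ w).card := by
      rw [hcard w hw]
      omega
    obtain ⟨y₁, hy₁, y₂, hy₂, hy⟩ := Finset.one_lt_card.1 h2
    have key : ∀ y ∈ G.label x₀ w, ∃ u, u ∈ G.down x₀ w ∧ u ∈ G.down x₀ w' ∧
        G.label x₀ u = (G.label x₀ w).erase y := by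
      intro y hyw
      have hs : (G.label x₀ w).erase y ⊆ G.label x₀ w := Finset.erase_subset _ _
      have hcd : ((G.label x₀ w).erase y).card = k + 1 := by
        rw [Finset.card_erase_of_mem hyw, hcard w hw]
        rfl
      obtain ⟨u, hu, hul⟩ := exists_mem_down_label_eq h hk' hw (hcard w hw) hs hcd
      obtain ⟨u', hu', hul'⟩ := exists_mem_down_label_eq h hk' hw' (hcard w' hw') (e ▸ hs) hcd
      have h3 := (mem_down.1 hu).2
      have h4 := (mem_down.1 hu').2
      have h5 := hk'.2 u u' (by omega) (by omega) (hul.trans hul'.symm)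
      exact ⟨u, hu, h5 ▸ hu', hul⟩
    obtain ⟨u₁, a1, b1, c1⟩ := key y₁ hy₁
    obtain ⟨u₂, a2, b2, c2⟩ := key y₂ hy₂
    have hu := (h.meets hc (k + 1)).2.2.2 w w' hw hne u₁ u₂ a1 b1 a2 b2
    have h6 : y₁ ∈ (G.label x₀ w).erase y₂ := Finset.mem_erase.2 ⟨hy, hy₁⟩
    rw [← c2, ← hu, c1] at h6
    simp at h6

lemma card_filter_hypercubeGraph_adj_le (n : ℕ) (A : Finset (Fin n))
    [DecidablePred ((hypercubeGraph n).Adj A)] :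
    (Finset.univ.filter ((hypercubeGraph n).Adj A)).card ≤ n := by
  classical
  have h1 : Finset.univ.filter ((hypercubeGraph n).Adj A) ⊆
      Finset.univ.image fun i : Fin n => symmDiff A {i} := by
    intro B hB
    rw [Finset.mem_filter] at hB
    obtain ⟨i, hi⟩ := Finset.card_eq_one.1 (show (symmDiff A B).card = 1 from hB.2)
    refine Finset.mem_image.2 ⟨i, Finset.mem_univ i, ?_⟩
    rw [← hi, symmDiff_symmDiff_cancel_left]
  exact (Finset.card_le_card h1).trans (Finset.card_image_le.trans (by simp))

theorem IsCubical.isHypercube [Fintype V] (hc : G.graph.Connected) (h : G.IsCubical x₀ n) :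
    G.IsHypercube n := by
  classical
  have hf : ∀ k, G.LabelsFaithful x₀ k := fun k => (h.labelsFaithful hc k).1
  have hinj : Function.Injective (G.label x₀) := by
    intro v v' e
    have h1 := (hf _).1 v rfl
    have h2 := (hf _).1 v' rfl
    rw [e, h2] at h1
    exact (hf _).2 v v' rfl h1 e
  let e : {y // y ∈ G.nbrs x₀} ≃ Fin n := (G.nbrs x₀).equivFinOfCardEq (h.card_nbrs x₀)
  let φ : V → Finset (Fin n) := fun v =>
    ((G.label x₀ v).subtype (· ∈ G.nbrs x₀)).map e.toEmbedding
  have hsub : ∀ v, ∀ y ∈ G.label x₀ v, y ∈ G.nbrs x₀ := fun v y hy =>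
    mem_nbrs.2 (mem_label.1 hy).1
  have hcard : ∀ v, (φ v).card = G.level x₀ v := fun v => by
    rw [Finset.card_map, Finset.card_subtype, Finset.filter_true_of_mem (hsub v), (hf _).1 v rfl]
  have hφ : Function.Injective φ := by
    intro v v' hv
    apply hinj
    have h1 := Finset.map_injective _ hv
    have h2 := congrArg (Finset.map (Function.Embedding.subtype _)) h1
    rwa [Finset.subtype_map_of_mem (hsub v), Finset.subtype_map_of_mem (hsub v')] at h2
  have hdown : ∀ u v, u ∈ G.down x₀ v → (hypercubeGraph n).Adj (φ u) (φ v) := by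
    intro u v huv
    have h1 : φ u ⊆ φ v := Finset.map_subset_map.2
      (Finset.subtype_mono (label_subset_of_mem_down huv))
    change (symmDiff (φ u) (φ v)).card = 1
    rw [symmDiff_of_le h1, Finset.card_sdiff_of_subset h1, hcard, hcard]
    have := (mem_down.1 huv).2
    omega
  have hadj : ∀ u v, G.graph.Adj u v → (hypercubeGraph n).Adj (φ u) (φ v) := by
    intro u v huv
    rcases h.mem_nbrs_iff.1 huv with h1 | h1
    · exact (hdown v u h1).symm
    · exact hdown u v (mem_up_iff.1 h1)
  -- Both vertices have degree at most `n`, with equality at `v`, so the injection of neighbourhoods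
  -- is onto. This yields surjectivity of `φ` and reflection of adjacency.
  have hlift : ∀ v B, (hypercubeGraph n).Adj (φ v) B → ∃ w, G.graph.Adj v w ∧ φ w = B := by
    intro v B hB
    have h1 : (G.nbrs v).image φ = Finset.univ.filter ((hypercubeGraph n).Adj (φ v)) := by
      refine Finset.eq_of_subset_of_card_le (fun C hC => ?_) ?_
      · obtain ⟨w, hw, rfl⟩ := Finset.mem_image.1 hC
        exact Finset.mem_filter.2 ⟨Finset.mem_univ _, hadj v w (mem_nbrs.1 hw)⟩
      · rw [Finset.card_image_of_injective _ hφ, h.card_nbrs]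
        exact card_filter_hypercubeGraph_adj_le n _
    obtain ⟨w, hw, e⟩ := Finset.mem_image.1
      (h1 ▸ Finset.mem_filter.2 ⟨Finset.mem_univ B, hB⟩)
    exact ⟨w, mem_nbrs.1 hw, e⟩
  have hsurj : Function.Surjective φ := by
    intro B
    induction B using Finset.induction_on with
    | empty => exact ⟨x₀, by rw [← Finset.card_eq_zero, hcard]; simp [level]⟩
    | insert i B hi ih =>
      obtain ⟨v, hv⟩ := ih
      obtain ⟨w, _, hw⟩ := hlift v (insert i B) (by
        change (symmDiff (φ v) (insert i B)).card = 1
        rw [hv, symmDiff_of_le (Finset.subset_insert i B),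
          Finset.card_sdiff_of_subset (Finset.subset_insert i B), Finset.card_insert_of_notMem hi]
        omega)
      exact ⟨w, hw⟩
  refine ⟨⟨Equiv.ofBijective φ ⟨hφ, hsurj⟩, ?_⟩⟩
  intro a b
  rw [unweighted_graph]
  refine ⟨fun hab => ?_, hadj a b⟩
  obtain ⟨w, hw, e⟩ := hlift a (φ b) hab
  rwa [← hφ e]

end WeightedGraph

/-! ### From shell structure, (SSP) and (NCP) to the hypercube. -/

namespace WeightedGraph

variable {V : Type*} {G : WeightedGraph V}

lemma unweighted_sphere (x : V) (k : ℕ) : G.unweighted.sphere x k = G.sphere x k := by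
  simp [sphere]

lemma ssp_unweighted_iff (hc : G.graph.Connected) (htri : ∀ x y z, G.graph.Adj x y →
    G.graph.Adj y z → ¬ G.graph.Adj x z) :
    G.unweighted.SSP ↔ ∀ x, (G.secondNbrs x).card ≤ (G.deg x).choose 2 := by
  refine forall_congr' fun x => ?_
  rw [unweighted_sphere, sphere_two_eq hc htri, Set.encard_coe_eq_coe_finsetCard, unweighted_deg]
  exact Nat.cast_le

lemma ncp_unweighted_iff (hc : G.graph.Connected) (htri : ∀ x y z, G.graph.Adj x y →
    G.graph.Adj y z → ¬ G.graph.Adj x z) :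
    G.unweighted.NCP ↔ ∀ x, (∀ z ∈ G.secondNbrs x, (G.commonNbrs x z).card = 2) →
      ∀ y₁ y₂ z z', G.graph.Adj x y₁ → G.graph.Adj x y₂ → y₁ ≠ y₂ →
      z ∈ G.secondNbrs x → z' ∈ G.secondNbrs x → G.graph.Adj y₁ z → G.graph.Adj y₂ z →
      G.graph.Adj y₁ z' → G.graph.Adj y₂ z' → z = z' := by
  have h1 : ∀ x y, y ∈ G.sphere x 1 ↔ G.graph.Adj x y := fun x y =>
    SimpleGraph.dist_eq_one_iff_adj
  refine forall_congr' fun x => imp_congr ?_ ?_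
  · rw [unweighted_sphere, sphere_two_eq hc htri]
    refine forall₂_congr fun z hz => ?_
    rw [unweighted_backDeg_of_mem_secondNbrs hc htri hz]
    norm_cast
  · simp only [unweighted_sphere, unweighted_graph, sphere_two_eq hc htri, h1, Finset.mem_coe]
    constructor
    · intro h y₁ y₂ z z' a1 a2 a3 a4 a5 a6 a7 a8 a9
      exact h y₁ a1 y₂ a2 a3 z a4 z' a5 a6 a7.symm a8 a9.symm
    · intro h y₁ a1 y₂ a2 a3 z a4 z' a5 a6 a7 a8 a9
      exact h y₁ y₂ z z' a1 a2 a3 a4 a5 a6 a7.symm a8 a9.symm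

theorem CDInfty.ssp_and_ncp (hc : G.graph.Connected) {κ : ℝ} (hκ : 0 < κ)
    (hw : G.HasConstEdgeDegree κ) (h : G.CDInfty (2 * κ)) (hb : G.graph.IsBipartite) {n : ℕ}
    (hn : ∀ x, G.deg x = n) : G.unweighted.SSP ∧ G.unweighted.NCP := by
  have htri : ∀ x y z, G.graph.Adj x y → G.graph.Adj y z → ¬ G.graph.Adj x z :=
    fun x y z => triangle_free_of_isBipartite hb
  rw [ssp_unweighted_iff hc htri, ncp_unweighted_iff hc htri]
  refine ⟨fun x => ?_, ?_⟩
  · rw [hn x]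
    exact h.card_secondNbrs_le hκ hw htri hn x
  · intro x h2 y₁ y₂ z z' a1 a2 a3 a4 a5 a6 a7 a8 a9
    exact h.eq_of_adj_adj hκ hw htri hn h2 a1 a2 a3 a4 a5 a6 a7 a8 a9

lemma dist_ne_of_isBipartite (hc : G.graph.Connected) (hb : G.graph.IsBipartite) {x y z : V}
    (hyz : G.graph.Adj y z) : G.graph.dist y x ≠ G.graph.dist z x := by
  intro h
  let c : G.graph.Coloring Bool := hb.toColoring (by simp)
  obtain ⟨p, hp⟩ := hc.exists_walk_length_eq_dist y x
  obtain ⟨q, hq⟩ := hc.exists_walk_length_eq_dist z x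
  have h1 := c.even_length_iff_congr p
  have h2 := c.even_length_iff_congr q
  rw [hp, h, ← hq, h2] at h1
  have h3 := c.valid hyz
  revert h1 h3
  generalize c x = a
  generalize c y = b
  generalize c z = d
  revert a b d
  decide

theorem HSSAt.isCubical {N : ℝ} {x₀ : V} (hc : G.graph.Connected)
    (h : G.unweighted.HSSAt N 1 x₀) (hssp : G.unweighted.SSP) (hncp : G.unweighted.NCP) :
    G.IsCubical x₀ (G.deg x₀) := by
  classical
  have hb : G.graph.IsBipartite := by
    have := h.bipartite
    rwa [unweighted_graph] at this
  have htri : ∀ x y z, G.graph.Adj x y → G.graph.Adj y z → ¬ G.graph.Adj x z :=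
    fun x y z => triangle_free_of_isBipartite hb
  rw [ssp_unweighted_iff hc htri] at hssp
  rw [ncp_unweighted_iff hc htri] at hncp
  have hdeg : ∀ x, G.deg x = G.deg x₀ := fun x => by
    have h1 := h.deg_eq x
    rw [← h.deg_eq x₀, unweighted_Deg, unweighted_Deg] at h1
    exact_mod_cast h1
  have hstep : ∀ y z, G.graph.Adj y z →
      G.level x₀ y + 1 = G.level x₀ z ∨ G.level x₀ y = G.level x₀ z + 1 := by
    intro y z hyz
    have h1 := dist_ne_of_isBipartite hc hb (x := x₀) hyz
    have h2 := hyz.reachable.dist_triangle_left x₀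
    have h3 := hyz.symm.reachable.dist_triangle_left x₀
    rw [SimpleGraph.dist_eq_one_iff_adj.2 hyz] at h2
    rw [SimpleGraph.dist_eq_one_iff_adj.2 hyz.symm] at h3
    simp only [level]
    omega
  refine ⟨hstep, hdeg, fun v => ?_, fun x => hdeg x ▸ hssp x, hncp⟩
  have h1 := h.backDeg_eq v
  rw [unweighted_backDeg, one_mul, unweighted_graph, Nat.cast_inj] at h1
  rw [level, ← h1, down]
  congr 1
  refine Finset.filter_congr fun y hy => ?_
  have := hstep v y (mem_nbrs.1 hy)
  simp only [level] at this ⊢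
  omega

theorem HSSAt.isHypercube {N : ℝ} {x₀ : V} (hc : G.graph.Connected)
    (h : G.unweighted.HSSAt N 1 x₀) (hssp : G.unweighted.SSP) (hncp : G.unweighted.NCP) :
    (G.deg x₀ : ℝ) = N ∧ G.IsHypercube (G.deg x₀) := by
  have hcub := h.isCubical hc hssp hncp
  -- A vertex of level `k` has `k` lower neighbours, so no level exceeds the degree.
  have hfin : Finite V := finite_of_dist_le hc x₀ (G.deg x₀) fun v => by
    rw [SimpleGraph.dist_comm]
    have := hcub.card_up v
    simp only [level] at this
    omega
  have := Fintype.ofFinite V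
  refine ⟨?_, hcub.isHypercube hc⟩
  have := h.deg_eq x₀
  rwa [unweighted_Deg, mul_one] at this

end WeightedGraph

/-! ### Eigenvalues under curvature and the spectrum of the hypercube. -/

namespace WeightedGraph

variable {V : Type*} {G : WeightedGraph V}

lemma mem_eigenspace [Finite V] {ν : ℝ} {f : V → ℝ} :
    f ∈ G.eigenspace ν ↔ G.lap f = (-ν) • f := by
  constructor
  · intro h
    funext x
    have := h.2 x
    simp only [Pi.smul_apply, smul_eq_mul]
    linarith
  · intro h
    have := Fintype.ofFinite V
    refine ⟨(hasSum_fintype _).summable, fun x => ?_⟩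
    rw [h]
    simp

lemma Gam_smul_right (f g : V → ℝ) (c : ℝ) : G.Gam f (c • g) = c • G.Gam f g := by
  funext x
  simp only [Gam_eq, Pi.smul_apply, smul_eq_mul, Finset.mul_sum, mul_div_assoc']
  congr 1
  exact Finset.sum_congr rfl fun y _ => by ring

lemma Gam₂_of_lap_eq {ν : ℝ} {f : V → ℝ} (h : G.lap f = (-ν) • f) (x : V) :
    G.Gam₂ f f x = G.lap (G.Gam f f) x / 2 + ν * G.Gam f f x := by
  rw [Gam₂, h, Gam_smul_right]
  simp only [Pi.smul_apply, smul_eq_mul]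
  ring

section Finite

variable [Fintype V]

/-- For an eigenfunction, $CD(K,\infty)$ reads `ΔΓ f ≥ 2 (K - ν) Γ f ≥ 0`, so `Γ f` is subharmonic
and hence harmonic. -/
lemma CDInfty.lap_Gam_eq_zero {K ν : ℝ} (hcd : G.CDInfty K) (hν : ν ≤ K) {f : V → ℝ}
    (h : G.lap f = (-ν) • f) (x : V) : G.lap (G.Gam f f) x = 0 := by
  refine lap_eq_zero_of_nonneg (fun x => ?_) x
  have h1 := hcd f x
  rw [Gam₂_of_lap_eq h] at h1
  nlinarith [Gam_nonneg (G := G) f x]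

lemma CDInfty.Gam_const {K : ℝ} (hcd : G.CDInfty K) (hc : G.graph.Connected) {f : V → ℝ}
    (h : G.lap f = (-K) • f) (x y : V) : G.Gam f f x = G.Gam f f y :=
  eq_of_lap_eq_zero hc (hcd.lap_Gam_eq_zero le_rfl h) x y

lemma CDInfty.Gam₂_eq {K : ℝ} (hcd : G.CDInfty K) {f : V → ℝ}
    (h : G.lap f = (-K) • f) (x : V) : G.Gam₂ f f x = K * G.Gam f f x := by
  rw [Gam₂_of_lap_eq h, hcd.lap_Gam_eq_zero le_rfl h, zero_div, zero_add]

/-- The Lichnerowicz bound: eigenfunctions to eigenvalues below `K` are constant. -/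
lemma CDInfty.const_of_lt {K ν : ℝ} (hcd : G.CDInfty K) (hc : G.graph.Connected) (hν : ν < K)
    {f : V → ℝ} (h : G.lap f = (-ν) • f) (x y : V) : f x = f y := by
  refine eq_of_Gam_eq_zero hc (fun z => ?_) x y
  have h1 := hcd f z
  rw [Gam₂_of_lap_eq h, hcd.lap_Gam_eq_zero hν.le h] at h1
  have h2 := Gam_nonneg (G := G) f z
  nlinarith

lemma CDInfty.eigenspace_le_span {K ν : ℝ} (hcd : G.CDInfty K) (hc : G.graph.Connected)
    (hν : ν < K) : G.eigenspace ν ≤ Submodule.span ℝ {fun _ : V => (1 : ℝ)} := by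
  intro f hf
  obtain ⟨x⟩ := hc.nonempty
  refine Submodule.mem_span_singleton.2 ⟨f x, ?_⟩
  funext y
  simp [hcd.const_of_lt hc hν (mem_eigenspace.1 hf) y x]

lemma CDInfty.rank_iSup_lt_le_one {K : ℝ} (hcd : G.CDInfty K) (hc : G.graph.Connected) :
    Module.rank ℝ ↥(⨆ ν ∈ Set.Iio K, G.eigenspace ν) ≤ 1 := by
  have h1 : ⨆ ν ∈ Set.Iio K, G.eigenspace ν ≤ Submodule.span ℝ {fun _ : V => (1 : ℝ)} :=
    iSup₂_le fun ν hν => hcd.eigenspace_le_span hc hν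
  have h2 := rank_span_le (R := ℝ) ({fun _ : V => (1 : ℝ)} : Set (V → ℝ))
  rw [Cardinal.mk_singleton] at h2
  exact (Submodule.rank_mono h1).trans h2

end Finite

/-- The vertex set carries commuting involutions that enumerate the neighbours of each vertex. -/
structure IsFlipSystem (G : WeightedGraph V) {n : ℕ} (s : Fin n → V → V) : Prop where
  sum_nbrs : ∀ (v : V) (h : V → ℝ), ∑ y ∈ G.nbrs v, h y = ∑ i, h (s i v)
  comm : ∀ i j v, s i (s j v) = s j (s i v)
  invol : ∀ i v, s i (s i v) = v

/-- Since the flips commute, `Γ₂` is `κ ^ 2 / 4` times the sum of all squared mixed differences `E j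
i`. By involutivity `E i i` is `-2` times the first difference, so the diagonal terms alone
contribute `2 * κ * Γ`. -/
theorem IsFlipSystem.cdInfty {n : ℕ} {s : Fin n → V → V} (hs : G.IsFlipSystem s) {κ : ℝ}
    (hκ : G.HasConstEdgeDegree κ) : G.CDInfty (2 * κ) := by
  intro f v
  have hlap : ∀ (g : V → ℝ) v, G.lap g v = κ * ∑ i, (g (s i v) - g v) := fun g v => by
    rw [hκ.lap_eq, hs.sum_nbrs v fun y => g y - g v]
  have hGam : ∀ (g h : V → ℝ) v, G.Gam g h v =
      κ / 2 * ∑ i, (g (s i v) - g v) * (h (s i v) - h v) := fun g h v => by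
    rw [hκ.Gam_eq, hs.sum_nbrs v fun y => (g y - g v) * (h y - h v)]
  set E : Fin n → Fin n → ℝ := fun j i =>
    (f (s i (s j v)) - f (s j v)) - (f (s i v) - f v) with hE
  have hsymm : ∀ i j, E i j = E j i := fun i j => by
    simp only [hE]
    rw [hs.comm]
    ring
  have h1 : ∑ j, ∑ i, (f (s i v) - f v) * E j i = ∑ j, ∑ i, (f (s j v) - f v) * E j i := by
    rw [Finset.sum_comm]
    exact Finset.sum_congr rfl fun i _ => Finset.sum_congr rfl fun j _ => by rw [hsymm]
  have h2 : G.Gam₂ f f v = κ ^ 2 / 4 * ∑ j, ∑ i, E j i ^ 2 := by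
    have e1 : G.lap (G.Gam f f) v =
        κ ^ 2 / 2 * ∑ j, ∑ i, (E j i ^ 2 + 2 * ((f (s i v) - f v) * E j i)) := by
      rw [hlap]
      simp only [hGam, ← mul_sub, ← Finset.sum_sub_distrib, Finset.mul_sum]
      refine Finset.sum_congr rfl fun j _ => Finset.sum_congr rfl fun i _ => ?_
      simp only [hE]
      ring
    have e2 : G.Gam f (G.lap f) v =
        κ ^ 2 / 2 * ∑ j, ∑ i, (f (s j v) - f v) * E j i := by
      rw [hGam]
      simp only [hlap, ← mul_sub, ← Finset.sum_sub_distrib, Finset.mul_sum]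
      refine Finset.sum_congr rfl fun j _ => Finset.sum_congr rfl fun i _ => ?_
      simp only [hE]
      ring
    rw [Gam₂, e1, e2, ← h1]
    simp only [Finset.sum_add_distrib, ← Finset.mul_sum]
    ring
  have h3 : ∑ i, 4 * ((f (s i v) - f v) * (f (s i v) - f v)) ≤ ∑ j, ∑ i, E j i ^ 2 := by
    refine Finset.sum_le_sum fun i _ => ?_
    have e : 4 * ((f (s i v) - f v) * (f (s i v) - f v)) = E i i ^ 2 := by
      simp only [hE, hs.invol]
      ring
    rw [e]
    exact Finset.single_le_sum (f := fun j => E i j ^ 2) (fun j _ => sq_nonneg _)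
      (Finset.mem_univ i)
  rw [h2, hGam]
  rw [← Finset.mul_sum] at h3
  nlinarith [sq_nonneg κ]

lemma IsHypercube.exists_flips {n : ℕ} (h : G.IsHypercube n) :
    ∃ (φ : V ≃ Finset (Fin n)) (s : Fin n → V → V), G.IsFlipSystem s ∧
      (∀ v, G.deg v = n) ∧ ∀ i v, φ (s i v) = symmDiff (φ v) {i} := by
  classical
  obtain ⟨Φ⟩ := h
  let s : Fin n → V → V := fun i v => Φ.symm (symmDiff (Φ v) {i})
  have hs : ∀ i v, Φ (s i v) = symmDiff (Φ v) {i} := fun i v => Φ.apply_symm_apply _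
  have hsi : ∀ v, Function.Injective fun i => s i v := fun v i j hij => by
    have h1 := Φ.symm.injective hij
    exact Finset.singleton_injective (symmDiff_right_injective _ h1)
  have hn : ∀ v, G.nbrs v = Finset.univ.image fun i => s i v := by
    intro v
    ext y
    rw [mem_nbrs, ← unweighted_graph, ← Φ.map_adj_iff, Finset.mem_image]
    change (symmDiff (Φ v) (Φ y)).card = 1 ↔ _
    rw [Finset.card_eq_one]
    refine exists_congr fun i => ?_
    constructor
    · intro hi
      refine ⟨Finset.mem_univ i, Φ.injective ?_⟩
      rw [hs, ← hi, symmDiff_symmDiff_cancel_left]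
    · rintro ⟨_, rfl⟩
      rw [hs, symmDiff_symmDiff_cancel_left]
  refine ⟨Φ.toEquiv, s, ⟨fun v h => ?_, fun i j v => Φ.injective ?_, fun i v => Φ.injective ?_⟩,
    fun v => ?_, hs⟩
  · rw [hn, Finset.sum_image fun i _ j _ hij => hsi v hij]
  · rw [hs, hs, hs, hs, symmDiff_right_comm]
  · rw [hs, hs, symmDiff_symmDiff_cancel_right]
  · rw [deg, hn, Finset.card_image_of_injective _ (hsi v), Finset.card_univ, Fintype.card_fin]

theorem IsHypercube.isKthEigenvalue [Nontrivial V] (hc : G.graph.Connected) {n : ℕ}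
    (h : G.IsHypercube n) {κ : ℝ} (hκ0 : 0 < κ) (hκ : G.HasConstEdgeDegree κ) :
    G.CDInfty (2 * κ) ∧ (∀ v, G.deg v = n) ∧ G.IsKthEigenvalue n (2 * κ) := by
  classical
  obtain ⟨φ, s, hs, hdeg, hφ⟩ := h.exists_flips
  have hcd := hs.cdInfty hκ
  have : Fintype V := Fintype.ofEquiv _ φ.symm
  refine ⟨hcd, hdeg, (hcd.rank_iSup_lt_le_one hc).trans ?_, ?_⟩
  · obtain ⟨x⟩ := hc.nonempty
    obtain ⟨y, hy⟩ := hc.preconnected.exists_adj_of_nontrivial x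
    have : 0 < n := by
      rw [← hdeg x, deg]
      exact Finset.card_pos.2 ⟨y, mem_nbrs.2 hy⟩
    exact_mod_cast this
  · set S : Submodule ℝ (V → ℝ) := ⨆ ν ∈ Set.Iic (2 * κ), G.eigenspace ν with hS
    -- Only the flip `i` changes the sign function of coordinate `i`, and it does so by twice its
    -- value: the eigenvalue is `2 * κ`. The constant function is the remaining one of the `n + 1`.
    let b : Option (Fin n) → V → ℝ := fun o v => o.elim 1 fun i => if i ∈ φ v then 1 else -1
    have hb : ∀ o, b o ∈ S := by
      rintro (_ | i)
      · have h0 : (0 : ℝ) ∈ Set.Iic (2 * κ) := by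
          simp only [Set.mem_Iic]
          positivity
        refine Submodule.mem_iSup_of_mem 0 (Submodule.mem_iSup_of_mem h0 ?_)
        rw [mem_eigenspace]
        funext v
        simp [lap_eq, b]
      · refine Submodule.mem_iSup_of_mem (2 * κ)
          (Submodule.mem_iSup_of_mem (Set.self_mem_Iic) ?_)
        rw [mem_eigenspace]
        funext v
        rw [hκ.lap_eq, hs.sum_nbrs v fun y => b (some i) y - b (some i) v]
        rw [Finset.sum_eq_single i]
        · simp only [b, Option.elim, hφ, Finset.mem_symmDiff, Finset.mem_singleton,
            Pi.smul_apply, smul_eq_mul]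
          by_cases hi : i ∈ φ v <;> simp [hi] <;> ring
        · intro j _ hj
          simp only [b, Option.elim, hφ, Finset.mem_symmDiff, Finset.mem_singleton, hj.symm]
          simp
        · simp
    have hli : LinearIndependent ℝ b := by
      rw [Fintype.linearIndependent_iff]
      intro g hg
      have key : ∀ v, g none + ∑ i, g (some i) * (if i ∈ φ v then 1 else -1) = 0 := by
        intro v
        have := congrFun hg v
        rw [Finset.sum_apply, Fintype.sum_option] at this
        simpa [b] using this
      have hsome : ∀ i, g (some i) = 0 := by
        intro i
        have h1 := key (φ.symm ∅)
        have h2 := key (φ.symm {i})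
        simp only [Equiv.apply_symm_apply] at h1 h2
        have h3 : ∑ j, g (some j) * (if j ∈ ({i} : Finset (Fin n)) then (1 : ℝ) else -1) -
            ∑ j, g (some j) * (if j ∈ (∅ : Finset (Fin n)) then (1 : ℝ) else -1) =
            2 * g (some i) := by
          rw [← Finset.sum_sub_distrib, Finset.sum_eq_single i]
          · simp
            ring
          · intro j _ hj
            simp [hj]
          · simp
        linarith
      rintro (_ | i)
      · have h1 := key (φ.symm ∅)
        simpa [hsome] using h1
      · exact hsome i
    have hli' : LinearIndependent ℝ fun o => (⟨b o, hb o⟩ : S) :=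
      LinearIndependent.of_comp S.subtype hli
    have h1 := hli'.cardinal_lift_le_rank
    simpa using h1

end WeightedGraph

/-! ### Maximal multiplicity of the eigenvalue $K$. -/

namespace WeightedGraph

variable {V : Type*} {G : WeightedGraph V}

lemma sub_le_dist_of_lipschitz (hc : G.graph.Connected) {f : V → ℝ}
    (h : ∀ x y, G.graph.Adj x y → f y - f x ≤ 1) (x v : V) : f v - f x ≤ G.graph.dist x v := by
  obtain ⟨p, hp⟩ := hc.exists_walk_length_eq_dist x v
  rw [← hp]
  clear hp
  induction p with
  | nil => simp
  | cons hadj _ ih =>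
    have := h _ _ hadj
    rw [SimpleGraph.Walk.length_cons]
    push_cast
    linarith

lemma Gam_single_eq {κ : ℝ} (hκ : G.HasConstEdgeDegree κ) [DecidableEq V]
    [DecidableRel G.graph.Adj] (f : V → ℝ) {y w : V} (hyw : w ≠ y) :
    G.Gam f (Pi.single w 1) y = if G.graph.Adj y w then κ / 2 * (f w - f y) else 0 := by
  rw [hκ.Gam_eq]
  have h1 : ∀ z ∈ G.nbrs y, (f z - f y) * ((Pi.single w 1 : V → ℝ) z - (Pi.single w 1 : V → ℝ) y)
      = if z = w then f w - f y else 0 := by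
    intro z _
    rw [Pi.single_eq_of_ne hyw.symm, sub_zero, Pi.single_apply]
    split_ifs with h
    · rw [h, mul_one]
    · rw [mul_zero]
  rw [Finset.sum_congr rfl h1, Finset.sum_ite_eq', mul_ite, mul_zero]
  exact if_congr mem_nbrs rfl rfl

/-- The mixed second differences towards a vertex at distance two cancel, for a function realising
equality in the curvature-dimension inequality. -/
lemma CDInfty.sum_commonNbrs_eq_zero {K κ : ℝ} (hcd : G.CDInfty K) (hκ0 : 0 < κ)
    (hκ : G.HasConstEdgeDegree κ) {f : V → ℝ} {x w : V} (hf : G.Gam₂ f f x = K * G.Gam f f x)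
    (hne : w ≠ x) (hxw : ¬ G.graph.Adj x w) :
    ∑ z ∈ G.commonNbrs x w, (f w - 2 * f z + f x) = 0 := by
  classical
  set g : V → ℝ := Pi.single w 1 with hg
  have hyw : ∀ y ∈ G.nbrs x, w ≠ y := fun y hy e => hxw (e ▸ mem_nbrs.1 hy)
  have hgx : g x = 0 := Pi.single_eq_of_ne hne.symm 1
  have hgy : ∀ y ∈ G.nbrs x, g y = 0 := fun y hy => Pi.single_eq_of_ne (hyw y hy).symm 1
  have h0 : ∀ h : V → ℝ, G.Gam g h x = 0 := fun h => by
    rw [hκ.Gam_eq, Finset.sum_eq_zero fun y hy => by rw [hgy y hy, hgx, sub_zero, zero_mul],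
      mul_zero]
  have hlg : ∀ y, w ≠ y → G.lap g y = if G.graph.Adj y w then κ else 0 := fun y hy => by
    rw [hκ.lap_eq, hg, Pi.single_eq_of_ne hy.symm]
    simp only [sub_zero, Pi.single_apply]
    rw [Finset.sum_ite_eq', mul_ite, mul_zero, mul_one]
    exact if_congr mem_nbrs rfl rfl
  -- The indicator of `w` vanishes at `x` and on its neighbours, so only common neighbours of `x`
  -- and `w` survive in the kernel equation.
  have h1 := hcd.polarize hf g
  have hfg : G.Gam f g x = 0 := by rw [Gam_comm, h0]
  rw [Gam₂, h0, hfg, mul_zero, sub_zero, hκ.lap_eq, hκ.Gam_eq f (G.lap g), hfg, hlg x hne,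
    if_neg hxw, Finset.mul_sum, Finset.mul_sum, ← Finset.sum_sub_distrib] at h1
  have h2 : ∀ y ∈ G.nbrs x, κ * (G.Gam f g y - 0) -
      κ / 2 * ((f y - f x) * (G.lap g y - 0)) =
      if G.graph.Adj y w then κ ^ 2 / 2 * (f w - 2 * f y + f x) else 0 := fun y hy => by
    rw [Gam_single_eq hκ f (hyw y hy), hlg y (hyw y hy)]
    split_ifs <;> ring
  rw [Finset.sum_congr rfl h2, ← Finset.sum_filter, ← Finset.mul_sum] at h1
  have h3 : (G.nbrs x).filter (fun y => G.graph.Adj y w) = G.commonNbrs x w := by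
    ext y
    rw [Finset.mem_filter, mem_nbrs, mem_commonNbrs]
  rw [h3] at h1
  have h4 : κ ^ 2 / 2 ≠ 0 := by positivity
  exact (mul_eq_zero.1 ((div_eq_zero_iff.1 h1).resolve_right two_ne_zero)).resolve_left h4

section Finite

variable [Fintype V]

/-- The increments of a function at the neighbours of `x`, on the eigenspace of `K`. -/
noncomputable def eigenspaceIncrements (G : WeightedGraph V) (K : ℝ) (x : V) :
    G.eigenspace K →ₗ[ℝ] ({y // y ∈ G.nbrs x} → ℝ) where
  toFun f y := f.1 y - f.1 x
  map_add' f g := by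
    funext y
    simp only [Submodule.coe_add, Pi.add_apply]
    ring
  map_smul' c f := by
    funext y
    simp only [Submodule.coe_smul, Pi.smul_apply, smul_eq_mul, RingHom.id_apply]
    ring

/-- Vanishing increments give `Γ f x = 0`. Since `Γ f` is constant, `f` is constant, hence zero
because `K ≠ 0`. -/
lemma CDInfty.eigenspaceIncrements_injective {K : ℝ} (hcd : G.CDInfty K) (hK : 0 < K)
    (hc : G.graph.Connected) (x : V) :
    Function.Injective (G.eigenspaceIncrements K x) := by
  rw [injective_iff_map_eq_zero]
  intro f hf
  have hfe := mem_eigenspace.1 f.2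
  have h1 : G.Gam f.1 f.1 x = 0 := by
    rw [Gam_eq, Finset.sum_eq_zero, zero_div]
    intro y hy
    have : f.1 y - f.1 x = 0 := congrFun hf ⟨y, hy⟩
    rw [this]
    ring
  have h2 : ∀ z, G.Gam f.1 f.1 z = 0 := fun z => (hcd.Gam_const hc hfe z x).trans h1
  have h3 := eq_of_Gam_eq_zero hc h2
  ext z
  have h4 : G.lap f.1 z = 0 := by
    rw [lap_eq]
    exact Finset.sum_eq_zero fun y _ => by rw [h3 y z, sub_self, mul_zero]
  rw [hfe, Pi.smul_apply, smul_eq_mul] at h4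
  exact (mul_eq_zero.1 h4).resolve_left (neg_ne_zero.2 hK.ne')

lemma CDInfty.le_finrank_eigenspace {K : ℝ} (hcd : G.CDInfty K) (hc : G.graph.Connected) {n : ℕ}
    (hn : G.IsKthEigenvalue n K) : n ≤ Module.finrank ℝ (G.eigenspace K) := by
  have h1 : ⨆ ν ∈ Set.Iic K, G.eigenspace ν ≤
      Submodule.span ℝ {fun _ : V => (1 : ℝ)} ⊔ G.eigenspace K := by
    refine iSup₂_le fun ν hν => ?_
    rcases (Set.mem_Iic.1 hν).lt_or_eq with h | rfl
    · exact (hcd.eigenspace_le_span hc h).trans le_sup_left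
    · exact le_sup_right
  have h2 := hn.2.trans (Submodule.rank_mono h1)
  rw [← Module.finrank_eq_rank, Nat.cast_le] at h2
  have h3 := Submodule.finrank_add_le_finrank_add_finrank
    (Submodule.span ℝ {fun _ : V => (1 : ℝ)}) (G.eigenspace K)
  have h4 := finrank_span_le_card (R := ℝ) ({fun _ : V => (1 : ℝ)} : Set (V → ℝ))
  rw [Set.toFinset_singleton, Finset.card_singleton] at h4
  omega

/-- If the `n`-th eigenvalue is `K` and all degrees are at most `n`, then the graph is `n`-regular
and all increments at a vertex are realised by eigenfunctions. -/
lemma CDInfty.exists_eigenfunction {K : ℝ} (hcd : G.CDInfty K) (hK : 0 < K)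
    (hc : G.graph.Connected) {n : ℕ} (hn : G.IsKthEigenvalue n K) {x : V}
    (hdeg : G.deg x ≤ n) : G.deg x = n ∧
      ∀ d : V → ℝ, ∃ f : V → ℝ, G.lap f = (-K) • f ∧ ∀ y, G.graph.Adj x y → f y = f x + d y := by
  have hinj := hcd.eigenspaceIncrements_injective hK hc x
  have h1 := LinearMap.finrank_le_finrank_of_injective hinj
  have h2 : Module.finrank ℝ ({y // y ∈ G.nbrs x} → ℝ) = G.deg x := by
    rw [Module.finrank_fintype_fun_eq_card, Fintype.card_coe, deg]
  have h3 := hcd.le_finrank_eigenspace hc hn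
  refine ⟨by omega, fun d => ?_⟩
  have hsurj := (LinearMap.injective_iff_surjective_of_finrank_eq_finrank
    (by omega : Module.finrank ℝ (G.eigenspace K) =
      Module.finrank ℝ ({y // y ∈ G.nbrs x} → ℝ))).1 hinj
  obtain ⟨f, hf⟩ := hsurj fun y => d y
  refine ⟨f.1, mem_eigenspace.1 f.2, fun y hy => ?_⟩
  have : f.1 y - f.1 x = d y := congrFun hf ⟨y, mem_nbrs.2 hy⟩
  linarith

/-- All increments at all vertices are realised by eigenfunctions to the eigenvalue `K`. -/
def HasFullEigenspace (G : WeightedGraph V) (K : ℝ) : Prop :=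
  ∀ x, ∀ d : V → ℝ, ∃ f : V → ℝ, G.lap f = (-K) • f ∧ ∀ y, G.graph.Adj x y → f y = f x + d y

-- Take the eigenfunction whose only nonzero increment at `x` is `1`, towards `y`. The two
-- identities are `Γ e x = Γ e y` and the eigenvalue equation at `x`.
open Classical in
lemma CDInfty.exists_coordinate {K : ℝ} (hcd : G.CDInfty K)
    (hc : G.graph.Connected) (hfull : G.HasFullEigenspace K) {x y : V}
    (hxy : G.graph.Adj x y) :
    ∃ e : V → ℝ, G.lap e = (-K) • e ∧ e y = e x + 1 ∧
      (∀ z, G.graph.Adj x z → z ≠ y → e z = e x) ∧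
      G.edgeDeg y x + ∑ z ∈ (G.nbrs y).filter (· ≠ x), G.edgeDeg y z * (e z - e y) ^ 2 =
        G.edgeDeg x y ∧
      G.edgeDeg x y = -(K * e x) := by
  obtain ⟨e, he, hd⟩ := hfull x (fun z => if z = y then 1 else 0)
  have h1 : e y = e x + 1 := by simpa using hd y hxy
  have h2 : ∀ z, G.graph.Adj x z → z ≠ y → e z = e x := fun z hz hzy => by
    simpa [hzy] using hd z hz
  have hsum : ∀ a : ℝ → ℝ, a 0 = 0 → ∑ z ∈ G.nbrs x, G.edgeDeg x z * a (e z - e x) =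
      G.edgeDeg x y * a 1 := by
    intro a ha
    rw [Finset.sum_eq_single y]
    · rw [h1, add_sub_cancel_left]
    · intro z hz hzy
      rw [h2 z (mem_nbrs.1 hz) hzy, sub_self, ha, mul_zero]
    · exact fun h => absurd (mem_nbrs.2 hxy) h
  refine ⟨e, he, h1, h2, ?_, ?_⟩
  · have h3 := hcd.Gam_const hc he x y
    have h4 : G.Gam e e x = G.edgeDeg x y / 2 := by
      rw [Gam_eq]
      have := hsum (fun t => t * t) (by simp)
      simp only [mul_one] at this
      rw [this]
    have h5 : ∑ z ∈ G.nbrs y, G.edgeDeg y z * ((e z - e y) * (e z - e y)) =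
        G.edgeDeg y x + ∑ z ∈ (G.nbrs y).filter (· ≠ x), G.edgeDeg y z * (e z - e y) ^ 2 := by
      rw [Finset.filter_ne', ← Finset.add_sum_erase _ _ (mem_nbrs.2 hxy.symm), h1]
      congr 1
      · ring
      · exact Finset.sum_congr rfl fun z _ => by ring
    rw [h4, Gam_eq, h5] at h3
    linarith
  · have h3 := congrFun he x
    rw [lap_eq] at h3
    have := hsum (fun t => t) rfl
    simp only [mul_one] at this
    rw [this] at h3
    rw [h3, Pi.smul_apply, smul_eq_mul]
    ring

/-- The gradient identity gives `edgeDeg y x ≤ edgeDeg x y`, and by exchanging the roles equality.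
So the remaining squares vanish and `e` is flat around `y` apart from `x`; comparing the eigenvalue
equations at `x` and `y` yields `K / 2`. -/
lemma CDInfty.hasConstEdgeDegree {K : ℝ} (hcd : G.CDInfty K)
    (hc : G.graph.Connected) (hfull : G.HasFullEigenspace K) :
    G.HasConstEdgeDegree (K / 2) ∧ ∀ x y, G.graph.Adj x y →
      ∃ e : V → ℝ, G.lap e = (-K) • e ∧ e y = e x + 1 ∧
      (∀ z, G.graph.Adj x z → z ≠ y → e z = e x) ∧
      ∀ z, G.graph.Adj y z → z ≠ x → e z = e y := by
  classical
  have hnn : ∀ (e : V → ℝ) (x y : V), ∀ z ∈ (G.nbrs y).filter (· ≠ x),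
      0 ≤ G.edgeDeg y z * (e z - e y) ^ 2 :=
    fun e x y z _ => mul_nonneg (edgeDeg_nonneg y z) (sq_nonneg _)
  have hle : ∀ x y, G.graph.Adj x y → G.edgeDeg y x ≤ G.edgeDeg x y := by
    intro x y hxy
    obtain ⟨e, _, _, _, h4, _⟩ := hcd.exists_coordinate hc hfull hxy
    have := Finset.sum_nonneg (hnn e x y)
    linarith
  have hflat : ∀ x y, G.graph.Adj x y → G.edgeDeg x y = K / 2 ∧
      ∃ e : V → ℝ, G.lap e = (-K) • e ∧ e y = e x + 1 ∧
      (∀ z, G.graph.Adj x z → z ≠ y → e z = e x) ∧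
      ∀ z, G.graph.Adj y z → z ≠ x → e z = e y := by
    intro x y hxy
    obtain ⟨e, he, h1, h2, h4, h5⟩ := hcd.exists_coordinate hc hfull hxy
    have heq : G.edgeDeg y x = G.edgeDeg x y := le_antisymm (hle x y hxy) (hle y x hxy.symm)
    have h6 : ∑ z ∈ (G.nbrs y).filter (· ≠ x), G.edgeDeg y z * (e z - e y) ^ 2 = 0 := by
      linarith
    have h7 : ∀ z, G.graph.Adj y z → z ≠ x → e z = e y := by
      intro z hz hzx
      have h8 := (Finset.sum_eq_zero_iff_of_nonneg (hnn e x y)).1 h6 z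
        (Finset.mem_filter.2 ⟨mem_nbrs.2 hz, hzx⟩)
      have h9 := (mul_eq_zero.1 h8).resolve_left (edgeDeg_pos hz).ne'
      have := pow_eq_zero_iff two_ne_zero |>.1 h9
      linarith
    refine ⟨?_, e, he, h1, h2, h7⟩
    have h8 := congrFun he y
    rw [lap_eq, Finset.sum_eq_single x, Pi.smul_apply, smul_eq_mul, h1, heq] at h8
    · linarith
    · intro z hz hzx
      rw [h7 z (mem_nbrs.1 hz) hzx, sub_self, mul_zero]
    · exact fun h => absurd (mem_nbrs.2 hxy.symm) h
  refine ⟨fun x y => ?_, fun x y hxy => (hflat x y hxy).2⟩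
  by_cases hxy : G.graph.Adj x y
  · exact Or.inr (hflat x y hxy).1
  · exact Or.inl (edgeDeg_eq_zero hxy)

/-- If all increments are realised by eigenfunctions, then some geodesic is as long as the degree
allows. -/
theorem CDInfty.exists_le_dist {K : ℝ} (hcd : G.CDInfty K) (hK : 0 < K)
    (hc : G.graph.Connected) (hfull : G.HasFullEigenspace K) {n : ℕ} (hn : ∀ x, G.deg x = n) :
    G.HasConstEdgeDegree (K / 2) ∧ ∃ x v, n ≤ G.graph.dist x v := by
  classical
  obtain ⟨hκ, hcoord⟩ := hcd.hasConstEdgeDegree hc hfull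
  refine ⟨hκ, ?_⟩
  have htri : ∀ x y z, G.graph.Adj x y → G.graph.Adj y z → ¬ G.graph.Adj x z := by
    intro x y z hxy hyz hxz
    obtain ⟨e, _, h1, h2, h3⟩ := hcoord x y hxy
    have h4 := h2 z hxz hyz.ne'
    have h5 := h3 z hyz hxz.ne'
    linarith
  have hrect : ∀ f : V → ℝ, G.lap f = (-K) • f → ∀ x w, w ∈ G.secondNbrs x →
      ∑ z ∈ G.commonNbrs x w, (f w - 2 * f z + f x) = 0 := by
    intro f hf x w hw
    obtain ⟨hne, y, h1, h2⟩ := mem_secondNbrs.1 hw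
    exact hcd.sum_commonNbrs_eq_zero (half_pos hK) hκ (hcd.Gam₂_eq hf x) hne
      (htri x y w h1 h2)
  -- For the coordinate function of the edge towards `y`, each common neighbour contributes `1`,
  -- with an extra `-2` at `y`; the total is zero.
  have htwo : ∀ x w, w ∈ G.secondNbrs x → (G.commonNbrs x w).card = 2 := by
    intro x w hw
    obtain ⟨hne, y, h1, h2⟩ := mem_secondNbrs.1 hw
    obtain ⟨e, he, e1, e2, e3⟩ := hcoord x y h1
    have h3 := hrect e he x w hw
    have h4 : ∀ z ∈ G.commonNbrs x w,
        e w - 2 * e z + e x = 1 - if z = y then (2 : ℝ) else 0 := by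
      intro z hz
      rw [e3 w h2 hne, e1]
      split_ifs with h
      · rw [h, e1]
        ring
      · rw [e2 z (mem_commonNbrs.1 hz).1 h]
        ring
    rw [Finset.sum_congr rfl h4, Finset.sum_sub_distrib, Finset.sum_ite_eq',
      if_pos (mem_commonNbrs.2 ⟨h1, h2⟩), Finset.sum_const, nsmul_eq_mul, mul_one,
      sub_eq_zero] at h3
    exact_mod_cast h3
  obtain ⟨x⟩ := hc.nonempty
  obtain ⟨F, hF, hFx⟩ := hfull x fun _ => 1
  -- With exactly two common neighbours `v'` and `z` of `v` and `w`, the cancellation reads `F w - F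
  -- v' = F z - F v`: opposite sides of a square have equal increments.
  have hstep : ∀ v v', G.graph.Adj v v' → (∀ y, G.graph.Adj v y → (F y - F v) ^ 2 = 1) →
      ∀ w, G.graph.Adj v' w → (F w - F v') ^ 2 = 1 := by
    intro v v' hvv hv w hw
    by_cases hwv : w = v
    · rw [hwv, ← hv v' hvv]
      ring
    · have hws : w ∈ G.secondNbrs v := mem_secondNbrs.2 ⟨hwv, v', hvv, hw⟩
      have hv'c : v' ∈ G.commonNbrs v w := mem_commonNbrs.2 ⟨hvv, hw⟩
      have h1 := htwo v w hws
      have h2 := hrect F hF v w hws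
      have h3 : ((G.commonNbrs v w).erase v').card = 1 := by
        rw [Finset.card_erase_of_mem hv'c, h1]
      obtain ⟨z, hz⟩ := Finset.card_eq_one.1 h3
      rw [← Finset.add_sum_erase _ _ hv'c, hz, Finset.sum_singleton] at h2
      have hzc : z ∈ G.commonNbrs v w :=
        Finset.mem_of_mem_erase (hz ▸ Finset.mem_singleton_self z)
      rw [← hv z (mem_commonNbrs.1 hzc).1]
      congr 1
      linarith
  have hinc : ∀ v y, G.graph.Adj v y → (F y - F v) ^ 2 = 1 := by
    intro v
    have := eq_of_forall_adj hc (f := fun v => ∀ y, G.graph.Adj v y → (F y - F v) ^ 2 = 1)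
      (fun a b hab => propext ⟨hstep a b hab, hstep b a hab.symm⟩) x v
    refine this.mp fun y hy => ?_
    rw [hFx y hy]
    ring
  have hcard : ∀ v c, (∀ y, G.graph.Adj v y → F y - F v = c) → n * c = -(2 * F v) := by
    intro v c hv
    have h1 := congrFun hF v
    rw [hκ.lap_eq, Finset.sum_congr rfl fun y hy => hv y (mem_nbrs.1 hy), Finset.sum_const,
      nsmul_eq_mul, ← deg, hn, Pi.smul_apply, smul_eq_mul] at h1
    have : K * (n * c) = K * -(2 * F v) := by linarith
    exact mul_left_cancel₀ hK.ne' this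
  have hx := hcard x 1 fun y hy => by rw [hFx y hy]; ring
  -- The eigenvalue equation gives `F x = -n / 2`. At a maximum all increments are `-1`, so `F v = n
  -- / 2`; as `F` is 1-Lipschitz, `x` and `v` are at distance at least `n`.
  obtain ⟨v, _, hv⟩ := Finset.exists_max_image Finset.univ F ⟨x, Finset.mem_univ x⟩
  have hv' := hcard v (-1) fun y hy => by
    rcases sq_eq_sq_iff_eq_or_eq_neg.1 ((hinc v y hy).trans (one_pow 2).symm) with h | h
    · linarith [hv y (Finset.mem_univ y)]
    · exact h
  refine ⟨x, v, ?_⟩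
  have h1 := sub_le_dist_of_lipschitz hc (f := F) (fun a b hab =>
    (abs_le.1 ((sq_le_one_iff_abs_le_one _).1 (hinc a b hab).le)).2) x v
  have h2 : (n : ℝ) ≤ G.graph.dist x v := by linarith
  exact_mod_cast h2

end Finite

end WeightedGraph

/-! ### The cycle of implications. -/

theorem mainTheorem1 {V : Type*} [Countable V] [Nontrivial V] (G : WeightedGraph V)
    (hconn : G.graph.Connected) (K : ℝ) (hK : 0 < K) (x₀ : V) (D : ℝ)
    (hD : G.Deg x₀ = D) (hDmax : IsLUB (Set.range G.Deg) D) :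
    List.TFAE
      [ (∃ n : ℕ, (n : ℝ) = 2 * D / K ∧ G.IsHypercube n) ∧ G.HasConstEdgeDegree (K / 2),
        G.CDInfty K ∧ ∃ k : ℕ, IsGreatest (Set.range G.deg) k ∧ G.IsKthEigenvalue k K,
        (∃ κ₀ : ℝ, G.HasConstEdgeDegree κ₀) ∧ G.CDInfty K ∧
          ENat.toENNReal G.graph.ediam = ENNReal.ofReal (2 * D / K),
        (∃ κ₀ : ℝ, G.HasConstEdgeDegree κ₀) ∧ G.HSS (2 * D / K) (K / 2) ∧ G.CDInfty K,
        G.HasConstEdgeDegree (K / 2) ∧ G.unweighted.HSS (2 * D / K) 1 ∧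
          G.unweighted.SSP ∧ G.unweighted.NCP ] := by
  have hDle : ∀ z, G.Deg z ≤ D := fun z => hDmax.1 ⟨z, rfl⟩
  have hD0 : 0 < D := hD ▸ WeightedGraph.Deg_pos hconn x₀
  have hK2 : 2 * (K / 2) = K := by ring
  have hfin : G.CDInfty K → Finite V := fun h =>
    WeightedGraph.finite_of_dist_le hconn x₀ ⌈2 * D / K⌉₊ fun v =>
      Nat.cast_le.1 ((h.dist_le hK hconn hDle hD0 x₀ v).trans (Nat.le_ceil _))
  tfae_have 1 → 2 := by
    rintro ⟨⟨n, _, hcube⟩, hκ⟩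
    obtain ⟨hcd, hdeg, heig⟩ := hcube.isKthEigenvalue hconn (half_pos hK) hκ
    rw [hK2] at hcd heig
    refine ⟨hcd, n, ⟨⟨x₀, hdeg x₀⟩, ?_⟩, heig⟩
    rintro _ ⟨z, rfl⟩
    exact (hdeg z).le
  tfae_have 2 → 3 := by
    rintro ⟨hcd, n, hn, heig⟩
    have := hfin hcd
    have := Fintype.ofFinite V
    have hex := fun x => hcd.exists_eigenfunction hK hconn heig (hn.2 ⟨x, rfl⟩)
    obtain ⟨hκ, x, v, hxv⟩ :=
      hcd.exists_le_dist hK hconn (fun x => (hex x).2) fun x => (hex x).1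
    refine ⟨⟨_, hκ⟩, hcd, ?_⟩
    -- Regularity and edge degree `K / 2` turn the general diameter bound into `n`, matching the
    -- lower bound from the pair `x`, `v`.
    have hnD : 2 * D / K = n := by
      rw [← hD, hκ.Deg_eq, (hex x₀).1]
      field_simp
    have hdiam : G.graph.ediam = n := by
      refine le_antisymm (SimpleGraph.ediam_le_of_edist_le fun a b => ?_) ?_
      · rw [← (hconn.preconnected a b).coe_dist_eq_edist, Nat.cast_le]
        have := hcd.dist_le hK hconn hDle hD0 a b
        rw [hnD] at this
        exact_mod_cast this
      · refine le_trans ?_ (SimpleGraph.edist_le_ediam (u := x) (v := v))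
        rw [← (hconn.preconnected x v).coe_dist_eq_edist, Nat.cast_le]
        exact hxv
    rw [hdiam, hnD]
    simp
  tfae_have 3 → 4 := by
    rintro ⟨hκ, hcd, hdiam⟩
    have := hfin hcd
    have := Fintype.ofFinite V
    obtain ⟨x, v, hxv⟩ := SimpleGraph.exists_edist_eq_ediam_of_finite (G := G.graph)
    refine ⟨hκ, ⟨x, hcd.hssAt_of_le_dist hK hconn hDle hD0 (v := v) ?_⟩, hcd⟩
    rw [← hxv, ← (hconn.preconnected x v).coe_dist_eq_edist, ENat.toENNReal_coe,
      ← ENNReal.ofReal_natCast] at hdiam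
    exact ((ENNReal.ofReal_eq_ofReal_iff (Nat.cast_nonneg _) (by positivity)).1 hdiam).ge
  tfae_have 4 → 5 := by
    rintro ⟨⟨κ₀, hκ₀⟩, ⟨x, hx⟩, hcd⟩
    have hκ := hx.hasConstEdgeDegree hconn hκ₀
    have hu := hx.unweighted hκ
    have hdeg : ∀ z, G.deg z = G.deg x := fun z => by
      have h1 := hu.deg_eq z
      rw [← hu.deg_eq x, WeightedGraph.unweighted_Deg, WeightedGraph.unweighted_Deg] at h1
      exact_mod_cast h1
    rw [← hK2] at hcd
    exact ⟨hκ, ⟨x, hu⟩, hcd.ssp_and_ncp hconn (half_pos hK) hκ hx.bipartite hdeg⟩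
  tfae_have 5 → 1 := by
    rintro ⟨hκ, ⟨x, hx⟩, hssp, hncp⟩
    obtain ⟨h1, h2⟩ := hx.isHypercube hconn hssp hncp
    exact ⟨⟨_, h1, h2⟩, hκ⟩
  tfae_finish
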